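/- **Setting.** Let $n\ge 1$, let $\mathcal T_h$ be a triangulation (finite conforming simplicial mesh) of a bounded polyhedral domain $\Omega\subset\mathbb R^n$ ($\overline\Omega=\bigcup_{K\in\mathcal T_h}K$, $\Omega$ the interior of this union), and let $\mathcal E_h^0$ be the set of interior $(n-1)$-simplices, i.e. those shared by two elements. For $e=K_1\cap K_2\in\mathcal E_h^0$ fix the unit normal $n$ pointing from $K_1$ to $K_2$, and put $\llbracket f\rrbracket=f_1n_1+f_2n_2$ with $n_1=n$, $n_2=-n$, $f_i=f|_{K_i}$, and $\{g\}=\tfrac12(g_1+g_2)$. Let $P_d$ denote polynomials of degree $\le d$ (so $P_{-1}=0$), and for an integer $r\ge 0$ let $$V_h^r=\{f\in L^2(\Omega): f|_K\in P_r(K)\ \forall K\in\mathcal T_h\},\qquad \mathfrak g_h^r=\{A\in L(V_h^r,V_h^r): A\mathbf 1=0\},$$ $$H_0(\mathrm{div},\Omega)=\{u\in L^2(\Omega)^n:\ \mathrm{div}\,u\in L^2(\Omega),\ u\cdot n|_{\partial\Omega}=0\},$$ $$RT_{2r}(\mathcal T_h)=\{u\in H_0(\mathrm{div},\Omega): u|_K\in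 P_{2r}(K)^n+x\,P_{2r}(K)\ \forall K\in\mathcal T_h\}.$$ Let $p\in(2,\infty]$. For $u\in H_0(\mathrm{div},\Omega)\cap L^p(\Omega)^n$ the operator $A_u\in L(V_h^r,V_h^r)$ is defined, with $\langle\cdot,\cdot\rangle$ the $L^2(\Omega)$ inner product, by $$\langle A_uf,g\rangle=\sum_{K\in\mathcal T_h}\int_K(u\cdot\nabla f)\,g\,dx-\sum_{e\in\mathcal E_h^0}\int_e u\cdot\llbracket f\rrbracket\{g\}\,ds,\qquad f,g\in V_h^r,$$ where the integrals over $e$ are understood in the sense of the normal trace of $u$ (defined by Green's formula; well defined on single facets because $p>2$). Let $S_h^r=\{A_u: u\in H_0(\mathrm{div},\Omega)\cap L^p(\Omega)^n\}$. **Proposition 3.4.** $RT_{2r}(\mathcal T_h)\subset L^p(\Omega)^n$, the operators $A_u$ are well defined, and $S_h^r$ is a linear subspace of $\mathfrak g_h^r$. The map $u\in RT_{2r}(\mathcal T_h)\mapsto A_u\in S_h^r$ is an isomorphism of vector spaces. Its inverse is given as follows. For each $K\in\mathcal T_h$ let $(\mathbf p_K^\alpha)_\alpha$ be a basis of $P_{2r-1}(K)^n$,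 and for each $e\in\mathcal E_h^0$ let $(p_e^\beta)_\beta$ be a basis of $P_{2r}(e)$. Then: 1. The functionals $u\mapsto\int_K u\cdot\mathbf p_K^\alpha\,dx$ and $u\mapsto\int_e(u\cdot n)\,p_e^\beta\,ds$ form a basis of $RT_{2r}(\mathcal T_h)^*$. Let $\boldsymbol\phi_K^\alpha,\boldsymbol\phi_e^\beta$ be the dual basis of $RT_{2r}(\mathcal T_h)$. 2. Consider the map $$V_h^r\otimes V_h^r\to\bigoplus_{K\in\mathcal T_h}P_{2r-1}(K)^n\oplus\bigoplus_{e\in\mathcal E_h^0}P_{2r}(e),\qquad f\otimes g\mapsto\Big(\big((\nabla f)\,g|_K\big)_K,\ \big(-\,n\cdot\llbracket f\rrbracket_e\{g\}_e\big)_e\Big).$$ For all $K,\alpha$ and all $e,\beta$ there are finite families $(f_K^{\alpha,j},g_K^{\alpha,j})_j$ and $(f_e^{\beta,j},g_e^{\beta,j})_j$ in $V_h^r\times V_h^r$ such that $\sum_jf_K^{\alpha,j}\otimes g_K^{\alpha,j}$ and $\sum_jf_e^{\beta,j}\otimes g_e^{\beta,j}$ are mapped to $(\mathbf p_K^\alpha,0)$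 and $(0,p_e^\beta)$ (extended by zero to the other elements and facets), respectively. 3. For every choice of such families, the inverse of $u\mapsto A_u$ is $$A\in S_h^r\ \longmapsto\ \sum_{K\in\mathcal T_h}\sum_\alpha\Big(\sum_j\langle Af_K^{\alpha,j},g_K^{\alpha,j}\rangle\Big)\boldsymbol\phi_K^\alpha+\sum_{e\in\mathcal E_h^0}\sum_\beta\Big(\sum_j\langle Af_e^{\beta,j},g_e^{\beta,j}\rangle\Big)\boldsymbol\phi_e^\beta\ \in RT_{2r}(\mathcal T_h).$$ -/

import Mathlib

open MeasureTheory MvPolynomial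
open scoped ContDiff ENNReal RealInnerProductSpace

noncomputable section

namespace DiscreteFlow

/-- Euclidean `n`-space. -/
abbrev E (n : ℕ) : Type := EuclideanSpace ℝ (Fin n)

/-! ### Polynomials -/

/-- Value of a polynomial at a point of Euclidean space. -/
def pval {n : ℕ} (q : MvPolynomial (Fin n) ℝ) (x : E n) : ℝ := MvPolynomial.eval (fun i => x i) q

/-- `P_d`: polynomials in `n` variables of total degree at most `d`. The degree bound is an integer,
so that `P_{-1} = 0`. -/
def polyLE (n : ℕ) (d : ℤ) : Submodule ℝ (MvPolynomial (Fin n) ℝ) :=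
  MvPolynomial.restrictSupport ℝ {m : Fin n →₀ ℕ | (m.degree : ℤ) ≤ d}

/-- `(P_d)^n`: polynomial vector fields with components in `P_d`. -/
def vecPolyLE (n : ℕ) (d : ℤ) : Submodule ℝ (Fin n → MvPolynomial (Fin n) ℝ) :=
  Submodule.pi Set.univ (fun _ => polyLE n d)

/-- Restriction of polynomials to the simplex with vertex set `e`. -/
def restrictTo {n : ℕ} (e : Finset (E n)) :
    MvPolynomial (Fin n) ℝ →ₗ[ℝ] (convexHull ℝ (e : Set (E n)) → ℝ) where
  toFun q := fun x => pval q x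
  map_add' p q := by funext x; simp [pval]
  map_smul' c q := by funext x; simp [pval, MvPolynomial.smul_eval]

/-- `P_d(e)`: the space of functions on the simplex `e` that are restrictions of polynomials of
degree at most `d`. -/
def facetPoly {n : ℕ} (e : Finset (E n)) (d : ℤ) :
    Submodule ℝ (convexHull ℝ (e : Set (E n)) → ℝ) :=
  (polyLE n d).map (restrictTo e)

/-! ### Triangulations -/

/-- A triangulation (finite conforming simplicial mesh) of a bounded polyhedral domain of `ℝⁿ`:
a finite geometric simplicial complex, each simplex of which is a face of an `n`-simplex. -/
structure Triangulation (n : ℕ) where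
  complex : Geometry.SimplicialComplex ℝ (E n)
  finite : complex.faces.Finite
  pure : ∀ s ∈ complex.faces, ∃ t ∈ complex.faces, s ⊆ t ∧ t.card = n + 1

namespace Triangulation

variable {n : ℕ} (T : Triangulation n)

/-- The triangulated domain `Ω`: the interior of the union of the closed simplices. -/
def dom : Set (E n) := interior T.complex.space

/-- Lebesgue measure on `Ω`. -/
abbrev vol : Measure (E n) := volume.restrict T.dom

/-- The elements `K` of the triangulation: its `n`-simplices, given by their vertex sets. -/
abbrev Cell : Type := {s : Finset (E n) // s ∈ T.complex.faces ∧ s.card = n + 1}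

/-- The closed simplex spanned by an element. -/
def hull (K : T.Cell) : Set (E n) := convexHull ℝ (K.1 : Set (E n))

/-- The interior `(n-1)`-simplices `e`: those shared by two distinct elements. -/
abbrev IntFacet : Type :=
  {s : Finset (E n) // s ∈ T.complex.faces ∧ s.card = n ∧
    ∃ K₁ K₂ : T.Cell, K₁ ≠ K₂ ∧ s ⊆ K₁.1 ∧ s ⊆ K₂.1}

instance : Fintype T.Cell :=
  Set.Finite.fintype (s := {s | s ∈ T.complex.faces ∧ s.card = n + 1})
    (T.finite.subset fun _ h => h.1)

instance : Fintype T.IntFacet :=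
  Set.Finite.fintype (s := {s | s ∈ T.complex.faces ∧ s.card = n ∧
    ∃ K₁ K₂ : T.Cell, K₁ ≠ K₂ ∧ s ⊆ K₁.1 ∧ s ⊆ K₂.1})
    (T.finite.subset fun _ h => h.1)

instance : DecidableEq T.Cell := Classical.decEq _

instance : DecidableEq T.IntFacet := Classical.decEq _

/-- An orientation of the interior facets: it orders the two elements `K₁`, `K₂` adjacent to each
interior facet `e`. The unit normal `n` to `e` is the one pointing from `K₁` to `K₂`. It serves to write scalar
components along `n`; the opposite orientation changes the signs of both `u · n` and `⟦f⟧ · n`. -/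
structure Orientation where
  K₁ : T.IntFacet → T.Cell
  K₂ : T.IntFacet → T.Cell
  sub₁ : ∀ e, e.1 ⊆ (K₁ e).1
  sub₂ : ∀ e, e.1 ⊆ (K₂ e).1
  ne : ∀ e, K₁ e ≠ K₂ e

lemma space_bounded : Bornology.IsBounded T.complex.space := by
  unfold Geometry.SimplicialComplex.space
  refine (Bornology.isBounded_biUnion T.finite).2 fun s _ => ?_
  exact isBounded_convexHull.2 s.finite_toSet.isBounded

instance : IsFiniteMeasure T.vol := by
  refine ⟨?_⟩
  rw [Measure.restrict_apply_univ]
  exact (T.space_bounded.subset interior_subset).measure_lt_top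

/-- An element is a nondegenerate simplex, so its vertices are an affine basis. -/
def cellBasis (K : T.Cell) : AffineBasis K.1 ℝ (E n) where
  toFun := fun a => a.1
  ind' := T.complex.indep K.2.1
  tot' := by
    rw [(T.complex.indep K.2.1).affineSpan_eq_top_iff_card_eq_finrank_add_one]
    simp [K.2.2]

open Classical in
/-- Barycentric coordinate `λ_a` of `x` with respect to the vertex `a` of the element `K`. -/
def bary (K : T.Cell) (a : E n) (x : E n) : ℝ :=
  if h : a ∈ K.1 then (T.cellBasis K).coord ⟨a, h⟩ x else 0

/-! ### `L²(Ω)`, `H(div, Ω)` and `H₀(div, Ω)` -/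

/-- `L²(Ω)`. -/
abbrev L2 : Type := Lp ℝ 2 T.vol

/-- `L²(Ω)ⁿ`. -/
abbrev L2Vec : Type := Lp (E n) 2 T.vol

/-- `d` is the distributional divergence of `u` in `Ω`. -/
def IsWeakDiv (u : T.L2Vec) (d : T.L2) : Prop :=
  ∀ φ : E n → ℝ, ContDiff ℝ ∞ φ → HasCompactSupport φ → tsupport φ ⊆ T.dom →
    ∫ x, (fderiv ℝ φ x (u x) + d x * φ x) ∂T.vol = 0

/-- `u · n = 0` on `∂Ω`, for a field `u` with divergence `d`. The normal trace on `∂Ω` is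
the functional `φ ↦ ∫_Ω (u · ∇φ + (div u) φ)`, for functions `φ` smooth up to the boundary. -/
def NormalTraceZero (u : T.L2Vec) (d : T.L2) : Prop :=
  ∀ φ : E n → ℝ, ContDiff ℝ ∞ φ → HasCompactSupport φ →
    ∫ x, (fderiv ℝ φ x (u x) + d x * φ x) ∂T.vol = 0

lemma integrable_test (u : T.L2Vec) (d : T.L2) {φ : E n → ℝ} (h1 : ContDiff ℝ ∞ φ)
    (h2 : HasCompactSupport φ) :
    Integrable (fun x => fderiv ℝ φ x (u x) + d x * φ x) T.vol := by
  have hu : Integrable (fun x => u x) T.vol := (Lp.memLp u).integrable (by norm_num)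
  have hd : Integrable (fun x => d x) T.vol := (Lp.memLp d).integrable (by norm_num)
  have hc : Continuous (fderiv ℝ φ) := h1.continuous_fderiv (by simp)
  obtain ⟨C, hC⟩ := hc.bounded_above_of_compact_support (h2.fderiv ℝ)
  obtain ⟨C', hC'⟩ := h1.continuous.bounded_above_of_compact_support h2
  refine Integrable.add ?_ (hd.mul_bdd (c := C')
    h1.continuous.aestronglyMeasurable (Filter.Eventually.of_forall hC'))
  refine (hu.norm.const_mul C).mono' ?_ (Filter.Eventually.of_forall fun x => ?_)
  · exact (ContinuousLinearMap.apply ℝ ℝ).aestronglyMeasurable_comp₂ hu.aestronglyMeasurable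
      hc.aestronglyMeasurable
  · exact ((fderiv ℝ φ x).le_opNorm (u x)).trans
      (mul_le_mul_of_nonneg_right (hC x) (norm_nonneg _))

lemma integral_test_add (u v : T.L2Vec) (c d : T.L2) {φ : E n → ℝ} (h1 : ContDiff ℝ ∞ φ)
    (h2 : HasCompactSupport φ) :
    ∫ x, (fderiv ℝ φ x ((u + v : T.L2Vec) x) + (c + d : T.L2) x * φ x) ∂T.vol =
      ∫ x, (fderiv ℝ φ x (u x) + c x * φ x) ∂T.vol +
      ∫ x, (fderiv ℝ φ x (v x) + d x * φ x) ∂T.vol := by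
  rw [← integral_add (T.integrable_test u c h1 h2) (T.integrable_test v d h1 h2)]
  refine integral_congr_ae ?_
  filter_upwards [Lp.coeFn_add u v, Lp.coeFn_add c d] with x hx hy
  rw [hx, hy, Pi.add_apply, Pi.add_apply, map_add]
  ring

lemma integral_test_smul (t : ℝ) (u : T.L2Vec) (c : T.L2) (φ : E n → ℝ) :
    ∫ x, (fderiv ℝ φ x ((t • u : T.L2Vec) x) + (t • c : T.L2) x * φ x) ∂T.vol =
      t * ∫ x, (fderiv ℝ φ x (u x) + c x * φ x) ∂T.vol := by
  rw [← integral_const_mul]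
  refine integral_congr_ae ?_
  filter_upwards [Lp.coeFn_smul t u, Lp.coeFn_smul t c] with x hx hy
  rw [hx, hy, Pi.smul_apply, Pi.smul_apply, map_smul, smul_eq_mul, smul_eq_mul]
  ring

lemma integral_test_zero (φ : E n → ℝ) :
    ∫ x, (fderiv ℝ φ x ((0 : T.L2Vec) x) + (0 : T.L2) x * φ x) ∂T.vol = 0 := by
  have := T.integral_test_smul 0 0 0 φ
  simpa only [zero_smul, zero_mul] using this

/-- `H(div, Ω)`: square integrable fields with square integrable distributional divergence. -/
def Hdiv : Submodule ℝ T.L2Vec where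
  carrier := {u | ∃ d : T.L2, T.IsWeakDiv u d}
  zero_mem' := ⟨0, fun φ _ _ _ => T.integral_test_zero φ⟩
  add_mem' := by
    rintro u v ⟨c, hc⟩ ⟨d, hd⟩
    refine ⟨c + d, fun φ h1 h2 h3 => ?_⟩
    rw [T.integral_test_add u v c d h1 h2, hc φ h1 h2 h3, hd φ h1 h2 h3, add_zero]
  smul_mem' := by
    rintro t u ⟨c, hc⟩
    refine ⟨t • c, fun φ h1 h2 h3 => ?_⟩
    rw [T.integral_test_smul t u c φ, hc φ h1 h2 h3, mul_zero]

open Classical in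
/-- The distributional divergence `div u ∈ L²(Ω)` of `u ∈ H(div, Ω)` (and `0` for other `u`).
It is unique, by density of the test functions in `L²(Ω)`. -/
def weakDiv (u : T.L2Vec) : T.L2 := if h : ∃ d : T.L2, T.IsWeakDiv u d then h.choose else 0

/-- `H₀(div, Ω)`: the fields in `H(div, Ω)` with `u · n = 0` on `∂Ω`. -/
def H0div : Submodule ℝ T.L2Vec where
  carrier := {u | ∃ d : T.L2, T.IsWeakDiv u d ∧ T.NormalTraceZero u d}
  zero_mem' := ⟨0, fun φ _ _ _ => T.integral_test_zero φ, fun φ _ _ => T.integral_test_zero φ⟩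
  add_mem' := by
    rintro u v ⟨c, hc, hc'⟩ ⟨d, hd, hd'⟩
    refine ⟨c + d, fun φ h1 h2 h3 => ?_, fun φ h1 h2 => ?_⟩
    · rw [T.integral_test_add u v c d h1 h2, hc φ h1 h2 h3, hd φ h1 h2 h3, add_zero]
    · rw [T.integral_test_add u v c d h1 h2, hc' φ h1 h2, hd' φ h1 h2, add_zero]
  smul_mem' := by
    rintro t u ⟨c, hc, hc'⟩
    refine ⟨t • c, fun φ h1 h2 h3 => ?_, fun φ h1 h2 => ?_⟩
    · rw [T.integral_test_smul t u c φ, hc φ h1 h2 h3, mul_zero]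
    · rw [T.integral_test_smul t u c φ, hc' φ h1 h2, mul_zero]

/-- `H₀(div, Ω) ∩ L^p(Ω)ⁿ`. -/
def H0divLp (p : ℝ≥0∞) : Submodule ℝ T.L2Vec where
  carrier := {u | u ∈ T.H0div ∧ MemLp (fun x => u x) p T.vol}
  zero_mem' := ⟨Submodule.zero_mem _,
    (memLp_congr_ae (Lp.coeFn_zero (E n) 2 T.vol)).2 MemLp.zero⟩
  add_mem' := fun {u v} hu hv => ⟨Submodule.add_mem _ hu.1 hv.1,
    (memLp_congr_ae (Lp.coeFn_add u v)).2 (hu.2.add hv.2)⟩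
  smul_mem' := fun t u hu => ⟨Submodule.smul_mem _ t hu.1,
    (memLp_congr_ae (Lp.coeFn_smul t u)).2 (hu.2.const_smul t)⟩

/-! ### The finite element spaces -/

/-- `f` coincides on the element `K` with the polynomial `q`. -/
def EqPolyOn (f : T.L2) (K : T.Cell) (q : MvPolynomial (Fin n) ℝ) : Prop :=
  ∀ᵐ x ∂T.vol, x ∈ T.hull K → f x = pval q x

/-- `V_h^r`: the functions in `L²(Ω)` whose restriction to each element is in `P_r`. -/
def V (r : ℕ) : Submodule ℝ T.L2 where
  carrier := {f | ∀ K : T.Cell, ∃ q ∈ polyLE n r, T.EqPolyOn f K q}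
  zero_mem' := by
    intro K
    refine ⟨0, Submodule.zero_mem _, ?_⟩
    filter_upwards [Lp.coeFn_zero ℝ 2 T.vol] with x hx _
    rw [hx]
    simp [pval]
  add_mem' := by
    intro f g hf hg K
    obtain ⟨p, hp, hfp⟩ := hf K
    obtain ⟨q, hq, hgq⟩ := hg K
    refine ⟨p + q, Submodule.add_mem _ hp hq, ?_⟩
    filter_upwards [Lp.coeFn_add f g, hfp, hgq] with x hx h1 h2 hK
    rw [hx, Pi.add_apply, h1 hK, h2 hK]
    simp [pval]
  smul_mem' := by
    intro c f hf K
    obtain ⟨p, hp, hfp⟩ := hf K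
    refine ⟨c • p, Submodule.smul_mem _ c hp, ?_⟩
    filter_upwards [Lp.coeFn_smul c f, hfp] with x hx h1 hK
    rw [hx, Pi.smul_apply, h1 hK]
    simp [pval, MvPolynomial.smul_eval]

/-- The polynomial `f|_K` for `f ∈ V_h^r`; it is unique because `K` has nonempty interior. -/
def loc {r : ℕ} (f : T.V r) (K : T.Cell) : MvPolynomial (Fin n) ℝ := (f.2 K).choose

/-- The constant function `1`, as an element of `V_h^r`. -/
def one (r : ℕ) : T.V r :=
  ⟨Lp.const 2 T.vol (1 : ℝ), by
    intro K
    refine ⟨1, ?_, ?_⟩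
    · rw [← MvPolynomial.C_1, MvPolynomial.C_apply, polyLE,
        MvPolynomial.monomial_mem_restrictSupport]
      simp
    · filter_upwards [Lp.coeFn_const (p := 2) (μ := T.vol) (1 : ℝ)] with x hx _
      rw [hx]
      simp [pval]⟩

/-- The Lie algebra `𝔤_h^r = {A ∈ L(V_h^r, V_h^r) | A 1 = 0}`. -/
def 𝔤 (r : ℕ) : Submodule ℝ (Module.End ℝ (T.V r)) where
  carrier := {A | A (T.one r) = 0}
  zero_mem' := by simp
  add_mem' := by
    intro A B hA hB
    exact (congrArg₂ (· + ·) hA hB).trans (add_zero _)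
  smul_mem' := by
    intro c A hA
    exact (congrArg (c • ·) hA).trans (smul_zero _)

/-- `u` coincides on the element `K` with the polynomial field `a + x b`. -/
def EqFieldOn (u : T.L2Vec) (K : T.Cell) (a : Fin n → MvPolynomial (Fin n) ℝ)
    (b : MvPolynomial (Fin n) ℝ) : Prop :=
  ∀ᵐ x ∂T.vol, x ∈ T.hull K → ∀ i, u x i = pval (a i) x + x i * pval b x

/-- The Raviart-Thomas space `RT_k`: the fields `u ∈ H₀(div, Ω)` with
`u|_K ∈ (P_k)ⁿ + x P_k` on each element `K`. -/
def RT (k : ℕ) : Submodule ℝ T.L2Vec where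
  carrier := {u | u ∈ T.H0div ∧
    ∀ K : T.Cell, ∃ a ∈ vecPolyLE n k, ∃ b ∈ polyLE n k, T.EqFieldOn u K a b}
  zero_mem' := by
    refine ⟨Submodule.zero_mem _, fun K => ⟨0, Submodule.zero_mem _, 0, Submodule.zero_mem _, ?_⟩⟩
    filter_upwards [Lp.coeFn_zero (E n) 2 T.vol] with x hx _ i
    rw [hx]
    simp [pval]
  add_mem' := by
    rintro u v ⟨hu, hu'⟩ ⟨hv, hv'⟩
    refine ⟨Submodule.add_mem _ hu hv, fun K => ?_⟩
    obtain ⟨a, ha, b, hb, h⟩ := hu' K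
    obtain ⟨a', ha', b', hb', h'⟩ := hv' K
    refine ⟨a + a', Submodule.add_mem _ ha ha', b + b', Submodule.add_mem _ hb hb', ?_⟩
    filter_upwards [Lp.coeFn_add u v, h, h'] with x hx h1 h2 hK i
    rw [hx, Pi.add_apply, PiLp.add_apply, h1 hK i, h2 hK i]
    simp only [pval, Pi.add_apply, map_add]
    ring
  smul_mem' := by
    rintro t u ⟨hu, hu'⟩
    refine ⟨Submodule.smul_mem _ t hu, fun K => ?_⟩
    obtain ⟨a, ha, b, hb, h⟩ := hu' K
    refine ⟨t • a, Submodule.smul_mem _ t ha, t • b, Submodule.smul_mem _ t hb, ?_⟩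
    filter_upwards [Lp.coeFn_smul t u, h] with x hx h1 hK i
    rw [hx, Pi.smul_apply, PiLp.smul_apply, h1 hK i]
    simp only [pval, Pi.smul_apply, MvPolynomial.smul_eval, smul_eq_mul]
    ring

/-! ### Integrals over facets -/

/-- For a facet `e` of the element `K` and a polynomial `q`, a function on `K` with boundary values
`q` on `e` and `0` on the other facets of `K`, namely
`q ∏_{a ∈ e} λ_a / (λ_a + λ_b)`, where `b` is the vertex of `K` opposite to `e`, so that
`λ_b = 1 - ∑_{a ∈ e} λ_a`. It is bounded, smooth in the interior of `K`, and its gradient is in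
`L^s(K)` for every `s < 2`. -/
def facetLift (K : T.Cell) (e : Finset (E n)) (q : MvPolynomial (Fin n) ℝ) (x : E n) : ℝ :=
  pval q x * ∏ a ∈ e, (T.bary K a x / (T.bary K a x + (1 - ∑ a' ∈ e, T.bary K a' x)))

/-- The integral `∫_e (u · n_K) q ds` over a facet `e` of the element `K`, where `n_K` is the unit
normal to `e` pointing out of `K` and `u ∈ H(div, Ω) ∩ L^p(Ω)ⁿ` with `p > 2`. As always for the
normal trace of such fields, it is given by Green's formula
`∫_{∂K} (u · n_K) w ds = ∫_K (u · ∇w + (div u) w) dx`,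
used for a function `w` equal to `q` on `e` and to `0` on the rest of `∂K`. The integral on the
right converges because `∇w ∈ L^s(K)` for `1/p + 1/s = 1`, and it depends only on `q|_e`. For fields
that are smooth on `K` it is the classical surface integral. -/
def facetIntegral (u : T.L2Vec) (K : T.Cell) (e : Finset (E n)) (q : MvPolynomial (Fin n) ℝ) : ℝ :=
  ∫ x in T.hull K, (fderiv ℝ (T.facetLift K e q) x (u x) +
    T.weakDiv u x * T.facetLift K e q x) ∂T.vol

/-- The degree of freedom `u ↦ ∫_K u · 𝐩 dx`. -/
def cellDof (u : T.L2Vec) (K : T.Cell) (P : Fin n → MvPolynomial (Fin n) ℝ) : ℝ :=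
  ∫ x in T.hull K, (∑ i, u x i * pval (P i) x) ∂T.vol

variable {T}

namespace Orientation

variable (o : T.Orientation) {r : ℕ}

/-- `∫_e (u · n) q ds` for an interior facet `e`, with its normal `n` pointing from `K₁` to
`K₂`, that is, out of `K₁`. -/
def flux (u : T.L2Vec) (e : T.IntFacet) (q : MvPolynomial (Fin n) ℝ) : ℝ :=
  T.facetIntegral u (o.K₁ e) e.1 q

/-- The normal component of the jump: `⟦f⟧ = f₁ n₁ + f₂ n₂ = (f₁ - f₂) n` on `e`. -/
def jump (f : T.V r) (e : T.IntFacet) : MvPolynomial (Fin n) ℝ :=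
  T.loc f (o.K₁ e) - T.loc f (o.K₂ e)

/-- The average `{g} = (g₁ + g₂) / 2` on `e`. -/
def avg (g : T.V r) (e : T.IntFacet) : MvPolynomial (Fin n) ℝ :=
  (1 / 2 : ℝ) • (T.loc g (o.K₁ e) + T.loc g (o.K₂ e))

/-- The bilinear form
`(f, g) ↦ ∑_K ∫_K (∇_u f) g dx - ∑_e ∫_e u · ⟦f⟧ {g} ds`, where `∇_u f = u · ∇f`. -/
def form (u : T.L2Vec) (f g : T.V r) : ℝ :=
  (∑ K : T.Cell, ∫ x in T.hull K,
      ((∑ i, u x i * pval (pderiv i (T.loc f K)) x) * pval (T.loc g K) x) ∂T.vol) -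
    ∑ e : T.IntFacet, o.flux u e (o.jump f e * o.avg g e)

/-- `A` is the discrete derivation of `u`: `⟨A f, g⟩` equals the form above, for all
`f, g ∈ V_h^r`, where `⟨ , ⟩` is the inner product of `L²(Ω)`. -/
def IsDerivation (u : T.L2Vec) (A : Module.End ℝ (T.V r)) : Prop :=
  ∀ f g : T.V r, ⟪A f, g⟫ = o.form u f g

open Classical in
/-- `A_u ∈ L(V_h^r, V_h^r)`, the operator with `⟨A_u f, g⟩` equal to the form above (unique,
because the inner product is nondegenerate on `V_h^r`). -/
def derivation (r : ℕ) (u : T.L2Vec) : Module.End ℝ (T.V r) :=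
  if h : ∃ A : Module.End ℝ (T.V r), o.IsDerivation u A then h.choose else 0

/-- `S_h^r = {A_u | u ∈ H₀(div, Ω) ∩ L^p(Ω)ⁿ}`. -/
def S (r : ℕ) (p : ℝ≥0∞) : Set (Module.End ℝ (T.V r)) :=
  o.derivation r '' (T.H0divLp p : Set T.L2Vec)

/-- Component at the element `K` of the image of `∑_j f_j ⊗ g_j`: the field `∑_j (∇f_j) g_j` on
`K`. -/
def cellImage {N : ℕ} (f g : Fin N → T.V r) (K : T.Cell) : Fin n → MvPolynomial (Fin n) ℝ :=
  fun i => ∑ j, pderiv i (T.loc (f j) K) * T.loc (g j) K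

/-- Component at the interior facet `e` of the image of `∑_j f_j ⊗ g_j`: the function
`-∑_j ⟦f_j⟧ {g_j}` on `e`. -/
def facetImage {N : ℕ} (f g : Fin N → T.V r) (e : T.IntFacet) :
    convexHull ℝ (e.1 : Set (E n)) → ℝ :=
  restrictTo e.1 (-∑ j, o.jump (f j) e * o.avg (g j) e)

/-- The image of `∑_j f_j ⊗ g_j` is `(P, 0)`, with the field `P` placed on the element `K`. -/
def ImageIsCell {N : ℕ} (f g : Fin N → T.V r) (K : T.Cell) (P : Fin n → MvPolynomial (Fin n) ℝ) :
    Prop :=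
  cellImage f g K = P ∧ (∀ K', K' ≠ K → cellImage f g K' = 0) ∧ ∀ e, o.facetImage f g e = 0

/-- The image of `∑_j f_j ⊗ g_j` is `(0, q)`, with the function `q` placed on the facet `e`. -/
def ImageIsFacet {N : ℕ} (f g : Fin N → T.V r) (e : T.IntFacet)
    (q : convexHull ℝ (e.1 : Set (E n)) → ℝ) : Prop :=
  (∀ K, cellImage f g K = 0) ∧ o.facetImage f g e = q ∧ ∀ e', e' ≠ e → o.facetImage f g e' = 0

end Orientation

end Triangulation

end DiscreteFlow

end

/-! The form defining `A_u` sees `u` only through its moments against the element and facet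
components of the image of `f ⊗ g`. These components have degree at most `2r - 1` on elements and
`2r` on interior facets, so `A_u` depends only on the degrees of freedom of `RT_{2r}`
(`derivation_eq_zero`). Conversely, every such polynomial datum is an image of a finite tensor
(`exists_imageIsCell`, `exists_imageIsFacet`), so each degree of freedom of `u` is a sum `∑ ⟨A_u
f_j, g_j⟩` (`sum_inner_of_imageIsCell`, `sum_inner_of_imageIsFacet`). Knowing `A_u` is therefore the
same as knowing the degrees of freedom. Unisolvence (`dofL_bijective`) does the rest: each `u`
shares its degrees of freedom, hence its operator, with exactly one Raviart-Thomas field, and the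
inversion formula expands that field in the dual basis.

Unisolvence is proved without counting dimensions. For injectivity (`RT_eq_zero`), vanishing facet
moments force vanishing normal traces; then `dλ_i(u) = λ_i w_i` on each element, and a suitable
interior moment equals `∫ ∑ λ_i w_i²`. For surjectivity (`eq_zero_of_forall_dof_eq_zero`), a linear
relation between the functionals is tested on bubble fields, which detect the element part, and on
pairs of radial fields glued across a facet, which detect the facet part.

Surface measure never appears. Traces are handled through `greenInt`, the integral of `div (w U)`
over a simplex, and two facts: it is zero if the normal component of `w U` is zero on every facet
(`greenInt_eq_zero`), and for a radial field with nonnegative density it is zero only if the density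
vanishes on the opposite facet (`eq_zero_of_greenInt_eq_zero`). Both follow by splitting the field
along the edges of the simplex and integrating along lines parallel to each edge.

For a general `u` in `L^p`, `p > 2`, the facet integral converges because the gradient of the lift
is in `L^s` for `s < 2` (`memLp_fderiv_lift`), and it depends only on the polynomial on the facet
(`facetIntegral_congr`) by a cutoff argument. -/

noncomputable section

namespace DiscreteFlow

/-! ### Fubini along a family of parallel lines. -/

section Slices

variable {n : ℕ}

/-- The shear `(x, s) ↦ (x + s t, s)` preserves the volume. -/
lemma measurePreserving_shear (t : E n) :
    MeasurePreserving (fun p : E n × ℝ => (p.1 + p.2 • t, p.2))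
      ((volume : Measure (E n)).prod (volume : Measure ℝ))
      ((volume : Measure (E n)).prod (volume : Measure ℝ)) := by
  have h := MeasurePreserving.skew_product (μa := (volume : Measure ℝ)) (μb := (volume : Measure ℝ))
    (μc := (volume : Measure (E n))) (μd := (volume : Measure (E n))) (f := id)
    (g := fun s x => x + s • t) (MeasurePreserving.id _)
    (by
      have : Continuous (Function.uncurry fun (s : ℝ) (x : E n) => x + s • t) := by
        unfold Function.uncurry; fun_prop
      exact this.measurable)
    (Filter.Eventually.of_forall fun s => (measurePreserving_add_right volume (s • t)).map_eq)
  have := (Measure.measurePreserving_swap (μ := (volume : Measure ℝ)) (ν := (volume : Measure (E n)))).comp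
    (h.comp (Measure.measurePreserving_swap (μ := (volume : Measure (E n))) (ν := (volume : Measure ℝ))))
  exact this

/-- Integration along parallel lines, one for each point of a unit slab transversal to them. -/
lemma integrable_slice {f : E n → ℝ} (hf : Integrable f) {l : E n → ℝ} (hl : Continuous l)
    (t : E n) (hlt : ∀ x (s : ℝ), l (x + s • t) = l x + s) :
    Integrable (fun x => ∫ s : ℝ, f (x + s • t)) (volume.restrict (l ⁻¹' Set.Icc 0 1)) ∧
    ∫ x in l ⁻¹' Set.Icc 0 1, (∫ s : ℝ, f (x + s • t)) = ∫ x, f x := by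
  have hms : MeasurableSet (l ⁻¹' Set.Icc 0 1) := hl.measurable measurableSet_Icc
  -- For fixed `x` the admissible `s` form an interval of length one, so integrating in `s` returns
  -- `f x`. After the shear the condition becomes `l x ∈ [0, 1]`, with no `s` left in it.
  set A : Set (E n × ℝ) := {p | l p.1 - p.2 ∈ Set.Icc (0:ℝ) 1} with hA
  have hAm : MeasurableSet A := by
    have : Continuous fun p : E n × ℝ => l p.1 - p.2 := by fun_prop
    exact this.measurable measurableSet_Icc
  set k : E n × ℝ → ℝ := A.indicator (fun p => f p.1) with hk
  have hslice : ∀ x : E n, (fun s => k (x, s)) = (Set.Icc (l x - 1) (l x)).indicator (fun _ => f x) := by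
    intro x
    funext s
    by_cases h : s ∈ Set.Icc (l x - 1) (l x)
    · rw [Set.indicator_of_mem h, hk, Set.indicator_of_mem]
      simp only [hA, Set.mem_ofPred_eq, Set.mem_Icc] at h ⊢
      constructor <;> linarith [h.1, h.2]
    · rw [Set.indicator_of_notMem h, hk, Set.indicator_of_notMem]
      intro h'
      apply h
      simp only [hA, Set.mem_ofPred_eq, Set.mem_Icc] at h' ⊢
      constructor <;> linarith [h'.1, h'.2]
  have hint1 : ∀ x : E n, ∫ s, k (x, s) = f x := by
    intro x
    rw [hslice, integral_indicator measurableSet_Icc]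
    simp
  have hint2 : ∀ x : E n, ∫ s, ‖k (x, s)‖ = ‖f x‖ := by
    intro x
    have : (fun s => ‖k (x, s)‖) = (Set.Icc (l x - 1) (l x)).indicator (fun _ => ‖f x‖) := by
      funext s
      rw [congrFun (hslice x) s, norm_indicator_eq_indicator_norm]
    rw [this, integral_indicator measurableSet_Icc]
    simp
  have hkm : AEStronglyMeasurable k ((volume : Measure (E n)).prod (volume : Measure ℝ)) :=
    (hf.aestronglyMeasurable.comp_fst).indicator hAm
  have hki : Integrable k ((volume : Measure (E n)).prod (volume : Measure ℝ)) := by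
    rw [integrable_prod_iff hkm]
    refine ⟨Filter.Eventually.of_forall fun x => ?_, ?_⟩
    · rw [hslice, integrable_indicator_iff measurableSet_Icc]
      exact integrableOn_const (by simp)
    · simp_rw [hint2]
      exact hf.norm
  have hkint : ∫ p, k p ∂((volume : Measure (E n)).prod (volume : Measure ℝ)) = ∫ x, f x := by
    rw [integral_prod _ hki]
    simp_rw [hint1]
  have hsh := measurePreserving_shear t
  set h : E n × ℝ → ℝ := fun p => k (p.1 + p.2 • t, p.2) with hh
  have hhi : Integrable h ((volume : Measure (E n)).prod (volume : Measure ℝ)) :=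
    hsh.integrable_comp_of_integrable hki
  have hhint : ∫ p, h p ∂((volume : Measure (E n)).prod (volume : Measure ℝ)) = ∫ x, f x := by
    rw [← hkint]
    have hemb : MeasurableEmbedding (fun p : E n × ℝ => (p.1 + p.2 • t, p.2)) := by
      let e : (E n × ℝ) ≃ₜ (E n × ℝ) :=
        { toFun := fun p => (p.1 + p.2 • t, p.2)
          invFun := fun p => (p.1 - p.2 • t, p.2)
          left_inv := fun p => by simp
          right_inv := fun p => by simp
          continuous_toFun := by fun_prop
          continuous_invFun := by fun_prop }
      exact e.measurableEmbedding
    exact hsh.integral_comp hemb k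
  have hhs : ∀ x : E n, (fun s => h (x, s)) =
      fun s => (l ⁻¹' Set.Icc 0 1).indicator (fun x => f (x + s • t)) x := by
    intro x
    funext s
    by_cases hx : x ∈ l ⁻¹' Set.Icc 0 1
    · rw [Set.indicator_of_mem hx, hh, hk]
      dsimp only
      rw [Set.indicator_of_mem]
      simpa [hA, hlt] using hx
    · rw [Set.indicator_of_notMem hx, hh, hk]
      dsimp only
      rw [Set.indicator_of_notMem]
      intro h'
      apply hx
      simpa [hA, hlt] using h'
  have hfun : (fun x => ∫ s, h (x, s)) =
      (l ⁻¹' Set.Icc 0 1).indicator (fun x => ∫ s : ℝ, f (x + s • t)) := by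
    funext x
    rw [hhs]
    by_cases hx : x ∈ l ⁻¹' Set.Icc 0 1
    · simp [Set.indicator_of_mem hx]
    · simp [Set.indicator_of_notMem hx]
  constructor
  · rw [← IntegrableOn, ← integrable_indicator_iff hms, ← hfun]
    exact hhi.integral_prod_left
  · rw [← integral_indicator hms, ← hfun, ← hhint, integral_prod _ hhi]

end Slices

/-! ### Barycentric coordinates and the facets of a simplex. -/

section Barycentric

variable {n : ℕ} {ι : Type*} (β : AffineBasis ι ℝ (E n))

/-- The differential of a barycentric coordinate. -/
def dcoord (i : ι) : E n →L[ℝ] ℝ := LinearMap.toContinuousLinearMap (β.coord i).linear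

lemma coord_add_vec (i : ι) (x v : E n) : β.coord i (x + v) = β.coord i x + dcoord β i v := by
  have := (β.coord i).map_vadd x v
  rw [vadd_eq_add, vadd_eq_add, add_comm v x] at this
  rw [this, add_comm]
  rfl

lemma dcoord_sub (i : ι) (x y : E n) : dcoord β i (x - y) = β.coord i x - β.coord i y := by
  have := coord_add_vec β i y (x - y)
  rw [add_sub_cancel] at this
  linarith

lemma coord_eq (i : ι) (x : E n) : β.coord i x = β.coord i 0 + dcoord β i x := by
  have := coord_add_vec β i 0 x
  rwa [zero_add] at this

lemma hasFDerivAt_coord (i : ι) (x : E n) : HasFDerivAt (β.coord i) (dcoord β i) x := by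
  have : (β.coord i : E n → ℝ) = fun x => β.coord i 0 + dcoord β i x := by
    funext x; exact coord_eq β i x
  rw [this]
  exact (dcoord β i).hasFDerivAt.const_add _

lemma contDiff_coord (i : ι) {m : WithTop ℕ∞} : ContDiff ℝ m (β.coord i) := by
  have : (β.coord i : E n → ℝ) = fun x => β.coord i 0 + dcoord β i x := by
    funext x; exact coord_eq β i x
  rw [this]
  exact contDiff_const.add (dcoord β i).contDiff

lemma continuous_coord (i : ι) : Continuous (β.coord i) := (contDiff_coord β i (m := 0)).continuous

lemma fderiv_coord (i : ι) (x : E n) : fderiv ℝ (β.coord i) x = dcoord β i :=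
  (hasFDerivAt_coord β i x).fderiv

lemma sum_dcoord [Fintype ι] (v : E n) : ∑ i, dcoord β i v = 0 := by
  have h1 := β.sum_coord_apply_eq_one (0 + v)
  have h2 := β.sum_coord_apply_eq_one (0 : E n)
  simp_rw [coord_add_vec, Finset.sum_add_distrib] at h1
  linarith

lemma sum_dcoord_smul [Fintype ι] (v : E n) : ∑ i, dcoord β i v • β i = v := by
  have h1 := β.linear_combination_coord_eq_self (0 + v)
  have h2 := β.linear_combination_coord_eq_self (0 : E n)
  simp_rw [coord_add_vec, add_smul, Finset.sum_add_distrib, h2, zero_add] at h1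
  exact h1

lemma dcoord_edge [DecidableEq ι] (i j k : ι) :
    dcoord β k (β i - β j) = (if k = i then 1 else 0) - (if k = j then 1 else 0) := by
  rw [dcoord_sub, β.coord_apply, β.coord_apply]

lemma volume_coord_eq_zero (i : ι) : volume {x | β.coord i x = 0} = 0 := by
  let S : AffineSubspace ℝ (E n) := (AffineSubspace.mk' (0 : ℝ) ⊥).comap (β.coord i)
  have hS : (S : Set (E n)) = {x | β.coord i x = 0} := by
    ext x
    simp [S]
  rw [← hS]
  refine Measure.addHaar_affineSubspace _ _ fun h => ?_
  have : β i ∈ (S : Set (E n)) := by rw [h]; trivial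
  rw [hS] at this
  simp at this

/-- The closed simplex. -/
def simplex : Set (E n) := convexHull ℝ (Set.range β)

lemma mem_simplex {x : E n} : x ∈ simplex β ↔ ∀ i, 0 ≤ β.coord i x := by
  rw [simplex, β.convexHull_eq_nonneg_coord]; rfl

lemma coord_le_one [Fintype ι] {x : E n} (hx : x ∈ simplex β) (i : ι) : β.coord i x ≤ 1 := by
  rw [← β.sum_coord_apply_eq_one x]
  exact Finset.single_le_sum (f := fun i => β.coord i x) (fun j _ => (mem_simplex β).1 hx j)
    (Finset.mem_univ i)

lemma isCompact_simplex [Finite ι] : IsCompact (simplex β) :=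
  (Set.finite_range β).isCompact_convexHull ℝ

lemma measurableSet_simplex [Finite ι] : MeasurableSet (simplex β) :=
  (isCompact_simplex β).isClosed.measurableSet

lemma mem_interior_simplex [Finite ι] {x : E n} :
    x ∈ interior (simplex β) ↔ ∀ i, 0 < β.coord i x := by
  rw [simplex, β.interior_convexHull]; rfl

lemma ae_coord_ne_zero [Finite ι] : ∀ᵐ x : E n, ∀ i, β.coord i x ≠ 0 := by
  rw [ae_all_iff]
  intro i
  rw [ae_iff]
  simpa using volume_coord_eq_zero β i

lemma simplex_ae_eq_interior [Finite ι] : interior (simplex β) =ᵐ[volume] simplex β := by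
  filter_upwards [ae_coord_ne_zero β] with x hx
  apply propext
  change x ∈ interior (simplex β) ↔ x ∈ simplex β
  rw [mem_interior_simplex, mem_simplex]
  exact forall_congr' fun i => ⟨le_of_lt, fun h => lt_of_le_of_ne h (hx i).symm⟩

/-- Points of the simplex on at most one facet. -/
def Generic (x : E n) : Prop :=
  x ∈ simplex β ∧ ∀ i j, β.coord i x = 0 → β.coord j x = 0 → i = j

/-- The relative interior of the facet opposite to the vertex `i`. -/
def openFacet (i : ι) : Set (E n) := {x | β.coord i x = 0 ∧ ∀ j, j ≠ i → 0 < β.coord j x}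

variable {β} in
lemma generic_of_mem_interior [Finite ι] {x : E n} (hx : x ∈ interior (simplex β)) : Generic β x :=
  ⟨interior_subset hx, fun i _ hi _ => absurd hi ((mem_interior_simplex β).1 hx i).ne'⟩

variable {β} in
lemma generic_of_mem_openFacet {i : ι} {x : E n} (hx : x ∈ openFacet β i) : Generic β x := by
  have h0 : ∀ j, β.coord j x = 0 → j = i := fun j hj => by
    by_contra hne
    exact (hx.2 j hne).ne' hj
  refine ⟨(mem_simplex β).2 fun j => ?_, fun j k hj hk => (h0 j hj).trans (h0 k hk).symm⟩
  by_cases h : j = i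
  · rw [h, hx.1]
  · exact (hx.2 j h).le

end Barycentric

end DiscreteFlow

namespace DiscreteFlow

/-! ### Integrals over a simplex of derivatives in an edge direction. -/

section EdgeDerivative

variable {n : ℕ} {ι : Type*} {β : AffineBasis ι ℝ (E n)} {i j : ι}

lemma coord_line_left (hij : i ≠ j) (x : E n) (s : ℝ) :
    β.coord i (x + s • (β i - β j)) = β.coord i x + s := by
  classical
  rw [coord_add_vec, map_smul, dcoord_edge]
  simp [hij]

lemma coord_line_right (hij : i ≠ j) (x : E n) (s : ℝ) :
    β.coord j (x + s • (β i - β j)) = β.coord j x - s := by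
  classical
  rw [coord_add_vec, map_smul, dcoord_edge]
  simp [hij.symm, sub_eq_add_neg]

lemma coord_line_other {k : ι} (hi : k ≠ i) (hj : k ≠ j) (x : E n) (s : ℝ) :
    β.coord k (x + s • (β i - β j)) = β.coord k x := by
  classical
  rw [coord_add_vec, map_smul, dcoord_edge]
  simp [hi, hj]

/-- Along the line only `λ_i` and `λ_j` change, with constant sum; the chord leaves the simplex at
parameter `λ_j(x)`, where `λ_j` reaches zero while `λ_i` takes the value of the sum. -/
lemma line_end_mem (hij : i ≠ j) {x : E n} (hx : ∀ k, k ≠ i → k ≠ j → 0 < β.coord k x)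
    (hs : 0 < β.coord i x + β.coord j x) :
    x + β.coord j x • (β i - β j) ∈ openFacet β j := by
  refine ⟨by rw [coord_line_right hij, sub_self], fun k hk => ?_⟩
  by_cases h : k = i
  · rw [h, coord_line_left hij]; exact hs
  · rw [coord_line_other h hk]; exact hx k h hk

lemma line_start_mem (hij : i ≠ j) {x : E n} (hx : ∀ k, k ≠ i → k ≠ j → 0 < β.coord k x)
    (hs : 0 < β.coord i x + β.coord j x) :
    x + (-β.coord i x) • (β i - β j) ∈ openFacet β i := by
  refine ⟨by rw [coord_line_left hij, add_neg_cancel], fun k hk => ?_⟩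
  by_cases h : k = j
  · rw [h, coord_line_right hij]; linarith
  · rw [coord_line_other hk h]; exact hx k hk h

lemma line_mem_simplex (hij : i ≠ j) {x : E n} (hx : ∀ k, k ≠ i → k ≠ j → 0 < β.coord k x) (s : ℝ) :
    x + s • (β i - β j) ∈ simplex β ↔ s ∈ Set.Icc (-β.coord i x) (β.coord j x) := by
  rw [mem_simplex, Set.mem_Icc]
  constructor
  · intro h
    have h1 := h i
    have h2 := h j
    rw [coord_line_left hij] at h1
    rw [coord_line_right hij] at h2
    constructor <;> linarith
  · rintro ⟨h1, h2⟩ k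
    by_cases hki : k = i
    · rw [hki, coord_line_left hij]; linarith
    by_cases hkj : k = j
    · rw [hkj, coord_line_right hij]; linarith
    · rw [coord_line_other hki hkj]; exact (hx k hki hkj).le

/-- Integral of the derivative of `G` along the chord of the simplex through `x` parallel to an
edge. -/
lemma integral_line [Finite ι] (hij : i ≠ j) {G : E n → ℝ} (hG : ∀ x, Generic β x → ContDiffAt ℝ 1 G x)
    {x : E n} (hx : ∀ k, k ≠ i → k ≠ j → 0 < β.coord k x) (hs : 0 < β.coord i x + β.coord j x) :
    ∫ s : ℝ, (simplex β).indicator (fun y => fderiv ℝ G y (β i - β j)) (x + s • (β i - β j)) =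
      G (x + β.coord j x • (β i - β j)) - G (x + (-β.coord i x) • (β i - β j)) := by
  set t := β i - β j with ht
  -- The chord touches the boundary only at its two ends, and each end lies on a single facet
  -- because `λ_i + λ_j` is positive. So `G` is `C¹` along the whole closed chord.
  have hgen : ∀ s ∈ Set.Icc (-β.coord i x) (β.coord j x), Generic β (x + s • t) := by
    intro s hs'
    refine ⟨(line_mem_simplex hij hx s).2 hs', fun k l hk hl => ?_⟩
    have key : ∀ k, β.coord k (x + s • t) = 0 →
        (k = i ∧ s = -β.coord i x) ∨ (k = j ∧ s = β.coord j x) := by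
      intro k hk
      by_cases hki : k = i
      · rw [hki, ht, coord_line_left hij] at hk
        exact Or.inl ⟨hki, by linarith⟩
      by_cases hkj : k = j
      · rw [hkj, ht, coord_line_right hij] at hk
        exact Or.inr ⟨hkj, by linarith⟩
      · rw [ht, coord_line_other hki hkj] at hk
        exact absurd hk (hx k hki hkj).ne'
    rcases key k hk with ⟨h1, h2⟩ | ⟨h1, h2⟩ <;> rcases key l hl with ⟨h3, h4⟩ | ⟨h3, h4⟩
    · rw [h1, h3]
    · linarith
    · linarith
    · rw [h1, h3]
  have h1 : (fun s : ℝ => (simplex β).indicator (fun y => fderiv ℝ G y t) (x + s • t)) =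
      (Set.Icc (-β.coord i x) (β.coord j x)).indicator (fun s => fderiv ℝ G (x + s • t) t) := by
    funext s
    by_cases h : s ∈ Set.Icc (-β.coord i x) (β.coord j x)
    · rw [Set.indicator_of_mem h, Set.indicator_of_mem ((line_mem_simplex hij hx s).2 h)]
    · rw [Set.indicator_of_notMem h,
        Set.indicator_of_notMem (fun h' => h ((line_mem_simplex hij hx s).1 h'))]
  have hle : -β.coord i x ≤ β.coord j x := by linarith
  have hline : ∀ s : ℝ, HasDerivAt (fun s : ℝ => x + s • t) t s := fun s => by
    simpa using ((hasDerivAt_id s).smul_const t).const_add x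
  rw [h1, integral_indicator measurableSet_Icc, integral_Icc_eq_integral_Ioc,
    ← intervalIntegral.integral_of_le hle]
  refine intervalIntegral.integral_eq_sub_of_hasDerivAt (f := fun s : ℝ => G (x + s • t)) ?_ ?_
  · intro s hs'
    rw [Set.uIcc_of_le hle] at hs'
    exact ((hG _ (hgen s hs')).differentiableAt (by simp)).hasFDerivAt.comp_hasDerivAt s (hline s)
  · apply ContinuousOn.intervalIntegrable
    intro s hs'
    rw [Set.uIcc_of_le hle] at hs'
    have hc : ContinuousAt (fun s : ℝ => fderiv ℝ G (x + s • t)) s :=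
      ContinuousAt.comp (f := fun s : ℝ => x + s • t) (g := fderiv ℝ G)
        ((hG _ (hgen s hs')).continuousAt_fderiv (by simp)) (hline s).continuousAt
    exact (hc.clm_apply continuousAt_const).continuousWithinAt

variable [Fintype ι]

/-- Such a line either misses the simplex, because another coordinate is negative all along it, or
meets it in at most one point. -/
lemma integral_line_eq_zero (hij : i ≠ j) (f : E n → ℝ)
    {x : E n} (hne : ∀ k, β.coord k x ≠ 0)
    (h : ¬((∀ k, k ≠ i → k ≠ j → 0 < β.coord k x) ∧ 0 < β.coord i x + β.coord j x)) :
    ∫ s : ℝ, (simplex β).indicator f (x + s • (β i - β j)) = 0 := by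
  by_cases hx : ∀ k, k ≠ i → k ≠ j → 0 < β.coord k x
  · have hs : β.coord i x + β.coord j x ≤ 0 := not_lt.1 fun h' => h ⟨hx, h'⟩
    refine integral_eq_zero_of_ae ?_
    have : ∀ᵐ s : ℝ, s ≠ β.coord j x := by
      rw [ae_iff]; simp
    filter_upwards [this] with s hs'
    refine Set.indicator_of_notMem (fun hmem => hs' ?_) _
    have := (line_mem_simplex hij hx s).1 hmem
    linarith [this.1, this.2]
  · push Not at hx
    obtain ⟨k, hki, hkj, hk⟩ := hx
    have : ∀ s : ℝ, (simplex β).indicator f (x + s • (β i - β j)) = 0 := fun s => by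
      refine Set.indicator_of_notMem (fun hmem => ?_) _
      have := (mem_simplex β).1 hmem k
      rw [coord_line_other hki hkj] at this
      exact hne k (le_antisymm hk this)
    simp [this]

/-- A function vanishing on the facet `i` and nonnegative on the facet `j` has a nonnegative
integral of its derivative along the edge from `j` to `i`. -/
lemma integral_edge_nonneg (hij : i ≠ j) {G : E n → ℝ}
    (hG : ∀ x, Generic β x → ContDiffAt ℝ 1 G x)
    (hint : IntegrableOn (fun x => fderiv ℝ G x (β i - β j)) (simplex β))
    (h0 : ∀ x ∈ openFacet β i, G x = 0) (h1 : ∀ x ∈ openFacet β j, 0 ≤ G x) :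
    0 ≤ ∫ x in simplex β, fderiv ℝ G x (β i - β j) := by
  have hsl := integrable_slice ((integrable_indicator_iff (measurableSet_simplex β)).2 hint)
    (continuous_coord β i) (β i - β j) (coord_line_left hij)
  rw [← integral_indicator (measurableSet_simplex β), ← hsl.2]
  refine integral_nonneg_of_ae ?_
  filter_upwards [ae_restrict_of_ae (ae_coord_ne_zero β)] with x hx
  by_cases h : (∀ k, k ≠ i → k ≠ j → 0 < β.coord k x) ∧ 0 < β.coord i x + β.coord j x
  · rw [integral_line hij hG h.1 h.2, h0 _ (line_start_mem hij h.1 h.2), sub_zero]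
    exact h1 _ (line_end_mem hij h.1 h.2)
  · exact (integral_line_eq_zero hij _ hx h).ge

/-- The equality case of `integral_edge_nonneg`. Nonnegative chord integrals with zero total vanish
almost everywhere; each is the value of `G` at the exit point of the chord, and continuity then
gives every exit point. -/
lemma eq_zero_of_integral_edge_eq_zero (hij : i ≠ j) {G : E n → ℝ}
    (hG : ∀ x, Generic β x → ContDiffAt ℝ 1 G x)
    (hint : IntegrableOn (fun x => fderiv ℝ G x (β i - β j)) (simplex β))
    (h0 : ∀ x ∈ openFacet β i, G x = 0) (h1 : ∀ x ∈ openFacet β j, 0 ≤ G x)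
    (hz : ∫ x in simplex β, fderiv ℝ G x (β i - β j) = 0) :
    ∀ x ∈ openFacet β j, G x = 0 := by
  have hsl := integrable_slice ((integrable_indicator_iff (measurableSet_simplex β)).2 hint)
    (continuous_coord β i) (β i - β j) (coord_line_left hij)
  rw [← integral_indicator (measurableSet_simplex β), ← hsl.2, integral_eq_zero_iff_of_nonneg_ae ?_ hsl.1] at hz
  swap
  · filter_upwards [ae_restrict_of_ae (ae_coord_ne_zero β)] with x hx
    by_cases h : (∀ k, k ≠ i → k ≠ j → 0 < β.coord k x) ∧ 0 < β.coord i x + β.coord j x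
    · rw [integral_line hij hG h.1 h.2, h0 _ (line_start_mem hij h.1 h.2), sub_zero]
      exact h1 _ (line_end_mem hij h.1 h.2)
    · exact (integral_line_eq_zero hij _ hx h).ge
  -- An open set of base points inside the slab of `integrable_slice`, so that equality almost
  -- everywhere can be upgraded to equality everywhere.
  set O : Set (E n) := interior (simplex β) ∩ {x | β.coord i x < 1} with hO
  have hOo : IsOpen O := isOpen_interior.inter (isOpen_lt (continuous_coord β i) continuous_const)
  have hOs : O ⊆ β.coord i ⁻¹' Set.Icc 0 1 := fun x hx =>
    ⟨((mem_interior_simplex β).1 hx.1 i).le, le_of_lt hx.2⟩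
  set Φ : E n → E n := fun x => x + β.coord j x • (β i - β j) with hΦ
  have hΦc : Continuous Φ := continuous_id.add ((continuous_coord β j).smul continuous_const)
  have hpos : ∀ x ∈ O, (∀ k, k ≠ i → k ≠ j → 0 < β.coord k x) ∧ 0 < β.coord i x + β.coord j x :=
    fun x hx => ⟨fun k _ _ => (mem_interior_simplex β).1 hx.1 k,
      add_pos ((mem_interior_simplex β).1 hx.1 i) ((mem_interior_simplex β).1 hx.1 j)⟩
  have hmem : ∀ x ∈ O, Φ x ∈ openFacet β j := fun x hx =>
    line_end_mem hij (hpos x hx).1 (hpos x hx).2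
  have hae : (fun x => G (Φ x)) =ᵐ[volume.restrict O] fun _ => (0 : ℝ) := by
    filter_upwards [ae_restrict_of_ae_restrict_of_subset hOs hz, ae_restrict_mem hOo.measurableSet]
      with x hx hxO
    rw [integral_line hij hG (hpos x hxO).1 (hpos x hxO).2,
      h0 _ (line_start_mem hij (hpos x hxO).1 (hpos x hxO).2), sub_zero] at hx
    exact hx
  have hcont : ContinuousOn (fun x => G (Φ x)) O := fun x hx =>
    (ContinuousAt.comp (f := Φ) (g := G)
      (hG _ (generic_of_mem_openFacet (hmem x hx))).continuousAt hΦc.continuousAt).continuousWithinAt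
  have hall := Measure.eqOn_open_of_ae_eq hae hOo hcont continuousOn_const
  intro x hx
  have hxi : 0 < β.coord i x := hx.2 i hij
  have hxi1 := coord_le_one β (generic_of_mem_openFacet hx).1 i
  -- Stepping back halfway along the chord ending at `x` makes both `λ_i` and `λ_j` equal to `λ_i(x)
  -- / 2`, so `y` lies in `O` and its exit point is `x`.
  set y : E n := x + (-(β.coord i x / 2)) • (β i - β j) with hy
  have hyi : β.coord i y = β.coord i x / 2 := by rw [hy, coord_line_left hij]; ring
  have hyj : β.coord j y = β.coord i x / 2 := by rw [hy, coord_line_right hij, hx.1]; ring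
  have hyO : y ∈ O := by
    refine ⟨(mem_interior_simplex β).2 fun k => ?_, ?_⟩
    · by_cases hki : k = i
      · rw [hki, hyi]; linarith
      by_cases hkj : k = j
      · rw [hkj, hyj]; linarith
      · rw [hy, coord_line_other hki hkj]; exact hx.2 k hkj
    · change β.coord i y < 1
      rw [hyi]; linarith
  have hyx : Φ y = x := by
    rw [hΦ]
    dsimp only
    rw [hyj, hy, add_assoc, ← add_smul]
    simp
  have := hall hyO
  simpa [hyx] using this

/-- `integral_edge_nonneg` for `G` and for `-G`. -/
lemma integral_edge_eq_zero (hij : i ≠ j) {G : E n → ℝ}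
    (hG : ∀ x, Generic β x → ContDiffAt ℝ 1 G x)
    (hint : IntegrableOn (fun x => fderiv ℝ G x (β i - β j)) (simplex β))
    (h0 : ∀ x ∈ openFacet β i, G x = 0) (h1 : ∀ x ∈ openFacet β j, G x = 0) :
    ∫ x in simplex β, fderiv ℝ G x (β i - β j) = 0 := by
  refine le_antisymm ?_ (integral_edge_nonneg hij hG hint h0 fun x hx => (h1 x hx).ge)
  have hneg : ∀ x, fderiv ℝ (fun y => -G y) x = -fderiv ℝ G x := fun x => fderiv_neg
  have := integral_edge_nonneg hij (G := fun y => -G y) (fun x hx => (hG x hx).neg)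
    (by simp_rw [hneg]; exact hint.neg) (fun x hx => by simp [h0 x hx])
    (fun x hx => by simp [h1 x hx])
  simp_rw [hneg, neg_apply, integral_neg] at this
  linarith

end EdgeDerivative

end DiscreteFlow

namespace DiscreteFlow

/-! ### Green's formula on a simplex without surface measure. -/

section Green

variable {n : ℕ} {ι : Type*} [Fintype ι] {β : AffineBasis ι ℝ (E n)}

variable (β) in
/-- Functions of class `C¹` on the simplex outside its faces of codimension two, integrable with
their differential. -/
structure Nice (w : E n → ℝ) : Prop where
  contDiffAt : ∀ x, Generic β x → ContDiffAt ℝ 1 w x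
  integrable : IntegrableOn w (simplex β)
  integrable_fderiv : IntegrableOn (fderiv ℝ w) (simplex β)

omit [Fintype ι] in
lemma ae_simplex_interior [Finite ι] : ∀ᵐ x ∂(volume.restrict (simplex β)), x ∈ interior (simplex β) := by
  filter_upwards [ae_restrict_mem (measurableSet_simplex β), ae_restrict_of_ae (ae_coord_ne_zero β)]
    with x hx hne
  exact (mem_interior_simplex β).2 fun i => lt_of_le_of_ne ((mem_simplex β).1 hx i) (hne i).symm

lemma ae_simplex_generic : ∀ᵐ x ∂(volume.restrict (simplex β)), Generic β x :=
  ae_simplex_interior.mono fun _ hx => generic_of_mem_interior hx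

lemma Nice.ae_differentiableAt {w : E n → ℝ} (hw : Nice β w) :
    ∀ᵐ x ∂(volume.restrict (simplex β)), DifferentiableAt ℝ w x :=
  ae_simplex_generic.mono fun x hx => (hw.contDiffAt x hx).differentiableAt (by simp)

lemma ContDiff.nice {w : E n → ℝ} (hw : ContDiff ℝ 1 w) : Nice β w where
  contDiffAt x _ := hw.contDiffAt
  integrable := hw.continuous.continuousOn.integrableOn_compact (isCompact_simplex β)
  integrable_fderiv :=
    (hw.continuous_fderiv (by simp)).continuousOn.integrableOn_compact (isCompact_simplex β)

lemma integrable_add_of_normed {F : Type*} [NormedAddCommGroup F] {μ : Measure (E n)} {f g : E n → F}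
    (hf : Integrable f μ) (hg : Integrable g μ) : Integrable (fun x => f x + g x) μ := hf.add hg

lemma Nice.mul {w ψ : E n → ℝ} (hψ : ContDiff ℝ 1 ψ) (hw : Nice β w) :
    Nice β (fun x => ψ x * w x) where
  contDiffAt x hx := hψ.contDiffAt.mul (hw.contDiffAt x hx)
  integrable := hw.integrable.continuousOn_mul hψ.continuous.continuousOn (isCompact_simplex β)
  integrable_fderiv := by
    have h1 : Integrable (fun x => ψ x • fderiv ℝ w x) (volume.restrict (simplex β)) :=
      hw.integrable_fderiv.continuousOn_smul hψ.continuous.continuousOn (isCompact_simplex β)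
    have h2 : Integrable (fun x => w x • fderiv ℝ ψ x) (volume.restrict (simplex β)) :=
      hw.integrable.smul_continuousOn (hψ.continuous_fderiv (by simp)).continuousOn
        (isCompact_simplex β)
    refine (integrable_add_of_normed h1 h2).congr ?_
    filter_upwards [hw.ae_differentiableAt] with x hx
    exact (fderiv_mul (hψ.differentiable (by simp) x) hx).symm

lemma Nice.integrable_fderiv_apply {w : E n → ℝ} (hw : Nice β w) {U : E n → E n}
    (hU : Continuous U) : IntegrableOn (fun x => fderiv ℝ w x (U x)) (simplex β) := by
  obtain ⟨C, hC⟩ := (isCompact_simplex β).exists_bound_of_continuousOn hU.continuousOn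
  refine (hw.integrable_fderiv.norm.mul_const C).mono' ?_ ?_
  · exact (ContinuousLinearMap.apply ℝ ℝ).aestronglyMeasurable_comp₂
      hU.aestronglyMeasurable hw.integrable_fderiv.aestronglyMeasurable
  · filter_upwards [ae_restrict_mem (measurableSet_simplex β)] with x hx
    exact ((fderiv ℝ w x).le_opNorm _).trans (by gcongr; exact hC x hx)

variable (β) in
/-- The divergence of a vector field in barycentric terms. -/
def divB (U : E n → E n) (x : E n) : ℝ := ∑ i, dcoord β i (fderiv ℝ U x (β i))

variable (β) in
/-- `∫_K div (w U)`, the right-hand side of Green's formula. -/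
def greenInt (U : E n → E n) (w : E n → ℝ) : ℝ :=
  ∫ x in simplex β, (fderiv ℝ w x (U x) + divB β U x * w x)

lemma continuous_divB {U : E n → E n} (hU : ContDiff ℝ 1 U) : Continuous (divB β U) := by
  unfold divB
  have := hU.continuous_fderiv (by simp)
  fun_prop

lemma Nice.integrable_green {w : E n → ℝ} (hw : Nice β w) {U : E n → E n} (hU : ContDiff ℝ 1 U) :
    IntegrableOn (fun x => fderiv ℝ w x (U x) + divB β U x * w x) (simplex β) :=
  (hw.integrable_fderiv_apply hU.continuous).add
    (hw.integrable.continuousOn_mul (continuous_divB hU).continuousOn (isCompact_simplex β))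

/-- Applies `D` to the decomposition `v = ∑ dλ_i(v) λ_j(x) (β i - β j)` into edge directions, valid
since `∑ λ_j = 1` and `∑ dλ_i = 0`. It reduces Green's formula to derivatives along edges. -/
lemma sum_dcoord_smul_eq {x : E n} {D : E n →L[ℝ] ℝ} (v : E n) :
    ∑ i, ∑ j, dcoord β i v * β.coord j x * D (β i - β j) = D v := by
  have h1 : ∑ i, ∑ j, dcoord β i v * β.coord j x * D (β i - β j) =
      (∑ i, dcoord β i v * D (β i)) * (∑ j, β.coord j x) -
      (∑ i, dcoord β i v) * ∑ j, β.coord j x * D (β j) := by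
    rw [Finset.sum_mul_sum, Finset.sum_mul_sum, ← Finset.sum_sub_distrib]
    refine Finset.sum_congr rfl fun i _ => ?_
    rw [← Finset.sum_sub_distrib]
    refine Finset.sum_congr rfl fun j _ => ?_
    rw [map_sub]; ring
  rw [h1, sum_dcoord, β.sum_coord_apply_eq_one]
  conv_rhs => rw [← sum_dcoord_smul β v]
  simp [map_sum]

lemma divB_eq (U : E n → E n) (x y : E n) :
    ∑ i, ∑ j, β.coord j y * dcoord β i (fderiv ℝ U x (β i - β j)) = divB β U x := by
  have h1 : ∑ i, ∑ j, β.coord j y * dcoord β i (fderiv ℝ U x (β i - β j)) =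
      ∑ i, ((∑ j, β.coord j y) * dcoord β i (fderiv ℝ U x (β i)) -
        ∑ j, β.coord j y * dcoord β i (fderiv ℝ U x (β j))) := by
    refine Finset.sum_congr rfl fun i _ => ?_
    rw [Finset.sum_mul, ← Finset.sum_sub_distrib]
    refine Finset.sum_congr rfl fun j _ => ?_
    rw [map_sub, map_sub]; ring
  rw [h1, Finset.sum_sub_distrib, β.sum_coord_apply_eq_one, Finset.sum_comm]
  simp_rw [← Finset.mul_sum, sum_dcoord]
  simp [divB]

/-- Green's formula for fields whose product with `w` has zero normal trace. -/
lemma greenInt_eq_zero {U : E n → E n} (hU : ContDiff ℝ 1 U) {w : E n → ℝ} (hw : Nice β w)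
    (h : ∀ i, ∀ x ∈ openFacet β i, w x * dcoord β i (U x) = 0) : greenInt β U w = 0 := by
  classical
  -- `w U` is the sum of the fields `dλ_i(U) λ_j w (β i - β j)`. The scalar factor vanishes on facet
  -- `i` by hypothesis and on facet `j` because of `λ_j`, so every edge integral is zero.
  have hψ : ∀ i j, ContDiff ℝ 1 (fun x => dcoord β i (U x) * β.coord j x) := fun i j =>
    ((dcoord β i).contDiff.comp hU).mul (contDiff_coord β j)
  have hN : ∀ i j, Nice β (fun x => dcoord β i (U x) * β.coord j x * w x) := fun i j =>
    hw.mul (hψ i j)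
  have hij : ∀ i j, ∫ x in simplex β,
      fderiv ℝ (fun x => dcoord β i (U x) * β.coord j x * w x) x (β i - β j) = 0 := by
    intro i j
    by_cases hne : i = j
    · simp [hne]
    refine integral_edge_eq_zero hne (hN i j).contDiffAt
      ((hN i j).integrable_fderiv_apply continuous_const) ?_ ?_
    · intro x hx
      have := h i x hx
      linear_combination β.coord j x * this
    · intro x hx
      rw [hx.1]; ring
  have hsum : ∑ i, ∑ j, ∫ x in simplex β,
      fderiv ℝ (fun x => dcoord β i (U x) * β.coord j x * w x) x (β i - β j) = 0 :=
    Finset.sum_eq_zero fun i _ => Finset.sum_eq_zero fun j _ => hij i j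
  rw [← hsum, greenInt]
  have e1 : ∀ i, ∑ j, ∫ x in simplex β,
      fderiv ℝ (fun x => dcoord β i (U x) * β.coord j x * w x) x (β i - β j) =
      ∫ x in simplex β, ∑ j,
      fderiv ℝ (fun x => dcoord β i (U x) * β.coord j x * w x) x (β i - β j) := fun i =>
    (integral_finsetSum _ fun j _ => (hN i j).integrable_fderiv_apply continuous_const).symm
  simp_rw [e1]
  rw [← integral_finsetSum _ fun i _ => integrable_finsetSum _ fun j _ =>
    (hN i j).integrable_fderiv_apply continuous_const]
  refine integral_congr_ae ?_
  filter_upwards [hw.ae_differentiableAt] with x hx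
  have hUd : DifferentiableAt ℝ U x := hU.differentiable (by simp) x
  have hterm : ∀ i j, fderiv ℝ (fun x => dcoord β i (U x) * β.coord j x * w x) x (β i - β j) =
      dcoord β i (U x) * β.coord j x * fderiv ℝ w x (β i - β j) +
      w x * (β.coord j x * dcoord β i (fderiv ℝ U x (β i - β j))) +
      w x * (dcoord β i (U x) * ((if j = i then 1 else 0) - 1)) := by
    intro i j
    have h1 : HasFDerivAt (fun x => dcoord β i (U x)) ((dcoord β i).comp (fderiv ℝ U x)) x :=
      (dcoord β i).hasFDerivAt.comp x hUd.hasFDerivAt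
    have h2 := ((h1.mul (hasFDerivAt_coord β j x)).mul hx.hasFDerivAt).fderiv
    erw [h2]
    simp only [add_apply, smul_apply,
      ContinuousLinearMap.comp_apply, smul_eq_mul, dcoord_edge]
    by_cases hji : j = i
    · simp [hji]
    · simp [hji]; ring
  simp_rw [hterm, Finset.sum_add_distrib, ← Finset.mul_sum]
  rw [divB_eq, Finset.sum_congr rfl fun i _ => Finset.sum_congr rfl fun j _ => rfl]
  -- The terms in which the product rule differentiates `λ_j`: the sum over `j` is the same number
  -- for every `i`, and `∑ dλ_i(U) = 0`.
  have h3 : ∑ i, dcoord β i (U x) * ∑ j, ((if j = i then (1:ℝ) else 0) - 1) = 0 := by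
    have : ∀ i : ι, ∑ j, ((if j = i then (1:ℝ) else 0) - 1) = 1 - Fintype.card ι := by
      intro i; simp
    simp_rw [this]
    rw [← Finset.sum_mul, sum_dcoord, zero_mul]
  rw [h3]
  have h4 := sum_dcoord_smul_eq (β := β) (x := x) (D := fderiv ℝ w x) (U x)
  simp_rw [mul_assoc, ← Finset.mul_sum] at h4 ⊢
  rw [h4]; ring

/-- The right-hand side is the dimension, written through the number of vertices. -/
lemma divB_sub_const (c : E n) (x : E n) :
    divB β (fun y => y - c) x = (Fintype.card ι : ℝ) - 1 := by
  classical
  have h0 : ∀ i, fderiv ℝ (fun y : E n => y - c) x (β i) = β i := by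
    intro i
    rw [fderiv_sub_const, fderiv_fun_id]; rfl
  unfold divB
  simp_rw [h0]
  obtain ⟨b⟩ := β.nonempty
  have h1 : ∑ i, dcoord β i (β i) = ∑ i, dcoord β i (β i - β b) + ∑ i, dcoord β i (β b) := by
    rw [← Finset.sum_add_distrib]; simp
  rw [h1, sum_dcoord, add_zero]
  simp [dcoord_edge]

/-- If the flux of the nonnegative density `g (x - b)` through the facet opposite to `b` is zero,
then the density vanishes there. -/
lemma eq_zero_of_greenInt_eq_zero [Nontrivial ι] (b : ι) {g : E n → ℝ} (hg : Nice β g)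
    (hpos : ∀ x ∈ openFacet β b, 0 ≤ g x) (hz : greenInt β (fun x => x - β b) g = 0) :
    ∀ x ∈ openFacet β b, g x = 0 := by
  classical
  have hN : ∀ a, Nice β (fun x => β.coord a x * g x) := fun a => hg.mul (contDiff_coord β a)
  -- Here `x - β b = ∑ λ_a (β a - β b)` splits the flux into edge integrals of `λ_a g`. Each of
  -- these functions vanishes on facet `a` and is nonnegative on facet `b`, so all the integrals are
  -- nonnegative; a single `a ≠ b` is enough to conclude, as `λ_a > 0` on the open facet `b`.
  have hsum : ∑ a, ∫ x in simplex β, fderiv ℝ (fun x => β.coord a x * g x) x (β a - β b) = 0 := by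
    rw [← integral_finsetSum _ fun a _ => (hN a).integrable_fderiv_apply continuous_const, ← hz,
      greenInt]
    refine integral_congr_ae ?_
    filter_upwards [hg.ae_differentiableAt] with x hx
    have hterm : ∀ a, fderiv ℝ (fun x => β.coord a x * g x) x (β a - β b) =
        β.coord a x * fderiv ℝ g x (β a - β b) + g x * (1 - if a = b then 1 else 0) := by
      intro a
      have h2 := ((hasFDerivAt_coord β a x).mul hx.hasFDerivAt).fderiv
      erw [h2]
      simp only [add_apply, smul_apply, smul_eq_mul,
        dcoord_edge, if_true]
    simp_rw [hterm, Finset.sum_add_distrib, ← Finset.mul_sum]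
    rw [divB_sub_const]
    have h5 : ∑ a, β.coord a x * fderiv ℝ g x (β a - β b) = fderiv ℝ g x (x - β b) := by
      have : x - β b = ∑ a, β.coord a x • (β a - β b) := by
        simp_rw [smul_sub]
        rw [Finset.sum_sub_distrib, β.linear_combination_coord_eq_self, ← Finset.sum_smul,
          β.sum_coord_apply_eq_one, one_smul]
      rw [this, map_sum]
      simp
    rw [h5]
    simp only [Finset.sum_sub_distrib, Finset.sum_const, Finset.card_univ, nsmul_eq_mul, mul_one,
      Finset.sum_ite_eq', Finset.mem_univ, if_true]
    ring
  have hnn : ∀ a, a ≠ b →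
      0 ≤ ∫ x in simplex β, fderiv ℝ (fun x => β.coord a x * g x) x (β a - β b) := fun a hab =>
    integral_edge_nonneg hab (hN a).contDiffAt ((hN a).integrable_fderiv_apply continuous_const)
      (fun x hx => by rw [hx.1, zero_mul])
      (fun x hx => mul_nonneg (hx.2 a hab).le (hpos x hx))
  have hnn' : ∀ a ∈ Finset.univ,
      0 ≤ ∫ x in simplex β, fderiv ℝ (fun x => β.coord a x * g x) x (β a - β b) := by
    intro a _
    by_cases hab : a = b
    · simp [hab]
    · exact hnn a hab
  obtain ⟨a, hab⟩ := exists_ne b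
  have hza := (Finset.sum_eq_zero_iff_of_nonneg hnn').1 hsum a (Finset.mem_univ a)
  intro x hx
  have := eq_zero_of_integral_edge_eq_zero hab (hN a).contDiffAt
    ((hN a).integrable_fderiv_apply continuous_const)
    (fun x hx => by rw [hx.1, zero_mul])
    (fun x hx => mul_nonneg (hx.2 a hab).le (hpos x hx)) hza x hx
  exact (mul_eq_zero.1 this).resolve_left (hx.2 a hab).ne'

end Green

end DiscreteFlow

namespace DiscreteFlow

/-! ### Integrability of negative powers of barycentric coordinates. -/

section Integrability

variable {n : ℕ} {ι : Type*} [Fintype ι] [DecidableEq ι] (β : AffineBasis ι ℝ (E n))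

lemma sum_ne_add {M : Type*} [AddCommMonoid M] (c : ι) (f : ι → M) :
    (∑ i : {i // i ≠ c}, f i) + f c = ∑ i, f i := by
  rw [← Finset.sum_erase_add Finset.univ f (Finset.mem_univ c)]
  congr 1
  exact (Finset.sum_subtype (Finset.univ.erase c) (by simp) f).symm

/-- The linear part of the barycentric coordinates other than that of the vertex `c`. -/
def coordEquiv (c : ι) : E n ≃L[ℝ] ({i // i ≠ c} → ℝ) :=
  LinearEquiv.toContinuousLinearEquiv
  { toFun := fun v i => dcoord β i v
    map_add' := fun v w => by funext i; simp
    map_smul' := fun t v => by funext i; simp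
    invFun := fun y => ∑ i : {i // i ≠ c}, y i • (β i - β c)
    left_inv := fun v => by
      have h1 := sum_ne_add c (fun i : ι => dcoord β i v • (β i - β c))
      rw [sub_self, smul_zero, add_zero] at h1
      change ∑ i : {i // i ≠ c}, dcoord β i v • (β i - β c) = v
      rw [h1]
      simp_rw [smul_sub]
      rw [Finset.sum_sub_distrib, sum_dcoord_smul, ← Finset.sum_smul, sum_dcoord, zero_smul,
        sub_zero]
    right_inv := fun y => by
      funext j
      simp only [map_sum, map_smul, dcoord_edge, smul_eq_mul]
      have : ∀ i : {i // i ≠ c}, y i * ((if (j : ι) = i then 1 else 0) - if (j : ι) = c then 1 else 0)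
          = if j = i then y i else 0 := by
        intro i
        simp [j.2, Subtype.ext_iff]
      exact (Finset.sum_congr rfl fun i _ => this i).trans
        ((Finset.sum_ite_eq _ _ _).trans (if_pos (Finset.mem_univ j))) }

/-- All barycentric coordinates but one form an affine coordinate system, which carries Lebesgue
measure to a multiple of itself; Fubini gives the rest. -/
lemma integrable_prod_coord (c : ι) {g : {i // i ≠ c} → ℝ → ℝ} (hg : ∀ i, Integrable (g i)) :
    Integrable (fun x : E n => ∏ i : {i // i ≠ c}, g i (β.coord i x)) := by
  have h1 : Integrable (fun y : {i // i ≠ c} → ℝ => ∏ i, g i (y i)) := Integrable.fintype_prod hg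
  have h2 := h1.comp_add_left (fun i : {i // i ≠ c} => β.coord i 0)
  set M := coordEquiv β c
  have hmap : Measure.IsAddHaarMeasure (Measure.map M (volume : Measure (E n))) :=
    M.isAddHaarMeasure_map volume
  have h3 := Measure.isAddLeftInvariant_eq_smul (Measure.map M (volume : Measure (E n))) volume
  have h4 : Integrable (fun y : {i // i ≠ c} → ℝ => ∏ i, g i (β.coord i 0 + y i))
      (Measure.map M (volume : Measure (E n))) := by
    rw [h3]
    exact h2.smul_measure_nnreal
  have h5 := (M.toHomeomorph.measurableEmbedding.integrable_map_iff).1 h4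
  refine h5.congr (Filter.Eventually.of_forall fun x => ?_)
  refine Finset.prod_congr rfl fun i _ => ?_
  rw [coord_eq β i x]
  rfl

lemma integrable_indicator_rpow {σ : ℝ} (hσ : σ < 1) :
    Integrable ((Set.Icc (0:ℝ) 1).indicator fun t => t ^ (-σ)) := by
  rw [integrable_indicator_iff measurableSet_Icc, integrableOn_Icc_iff_integrableOn_Ioc]
  have := intervalIntegral.intervalIntegrable_rpow' (a := 0) (b := 1) (r := -σ) (by linarith)
  rwa [intervalIntegrable_iff_integrableOn_Ioc_of_le zero_le_one] at this

/-- The third vertex `c` is what makes `λ_a` and `λ_b` independent coordinates. On the simplex all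
coordinates are in `[0, 1]`, so the function agrees there with a product of integrable functions of
one variable each. -/
lemma integrableOn_rpow_coord {a b c : ι} (hab : a ≠ b) (hac : a ≠ c) (hbc : b ≠ c) {σ : ℝ}
    (hσ : σ < 1) :
    IntegrableOn (fun x : E n => (β.coord a x) ^ (-σ) * (β.coord b x) ^ (-σ)) (simplex β) := by
  set g : {i // i ≠ c} → ℝ → ℝ := fun i =>
    (Set.Icc (0:ℝ) 1).indicator fun t => if i.1 = a ∨ i.1 = b then t ^ (-σ) else 1 with hg
  have hgi : ∀ i, Integrable (g i) := by
    intro i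
    by_cases h : i.1 = a ∨ i.1 = b
    · simp only [hg, h, if_true]; exact integrable_indicator_rpow hσ
    · simp only [hg, h, if_false]
      rw [integrable_indicator_iff measurableSet_Icc]
      exact integrableOn_const (by simp)
  refine ((integrable_prod_coord β c hgi).integrableOn (s := simplex β)).congr_fun ?_
    (measurableSet_simplex β)
  intro x hx
  have hx' : ∀ i, β.coord i x ∈ Set.Icc (0:ℝ) 1 := fun i => ⟨(mem_simplex β).1 hx i, coord_le_one β hx i⟩
  have h1 : ∀ i : {i // i ≠ c}, g i (β.coord i x) =
      if i = ⟨a, hac⟩ ∨ i = ⟨b, hbc⟩ then (β.coord i x) ^ (-σ) else 1 := by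
    intro i
    rw [hg]
    dsimp only
    rw [Set.indicator_of_mem (hx' i)]
    simp only [Subtype.ext_iff]
  dsimp only
  simp_rw [h1]
  rw [Finset.prod_ite, Finset.prod_const_one, mul_one]
  have h2 : Finset.univ.filter (fun i : {i // i ≠ c} => i = ⟨a, hac⟩ ∨ i = ⟨b, hbc⟩) =
      {⟨a, hac⟩, ⟨b, hbc⟩} := by
    ext i; simp
  rw [h2, Finset.prod_pair (by simpa using hab)]

/-- `1 / (λ_a + λ_b)` is in `L^s` of the simplex for `s < 2`. -/
lemma memLp_inv_add {a b : ι} (hab : a ≠ b) {s : ℝ≥0∞} (hs0 : s ≠ 0) (hs : s < 2) :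
    MemLp (fun x : E n => (β.coord a x + β.coord b x)⁻¹) s (volume.restrict (simplex β)) := by
  have hca := continuous_coord β a
  have hcb := continuous_coord β b
  have hmeas : AEStronglyMeasurable (fun x : E n => (β.coord a x + β.coord b x)⁻¹)
      (volume.restrict (simplex β)) := (hca.add hcb).measurable.inv.aestronglyMeasurable
  have hsInf : s ≠ ⊤ := (hs.trans (by simp)).ne
  have hs2 : s.toReal < 2 := by
    have := (ENNReal.toReal_lt_toReal hsInf (by simp)).2 hs
    simpa using this
  have hfin : IsFiniteMeasure (volume.restrict (simplex β)) :=
    ⟨by rw [Measure.restrict_apply_univ]; exact (isCompact_simplex β).measure_lt_top⟩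
  by_cases hc : ∃ c, a ≠ c ∧ b ≠ c
  · obtain ⟨c, hac, hbc⟩ := hc
    rw [← integrable_norm_rpow_iff hmeas hs0 hsInf]
    refine (integrableOn_rpow_coord β hab hac hbc (σ := s.toReal / 2) (by linarith)).mono'
      (by
        have : Measurable fun x : E n => ‖(β.coord a x + β.coord b x)⁻¹‖ ^ s.toReal :=
          (hca.add hcb).measurable.inv.norm.pow_const _
        exact this.aestronglyMeasurable) ?_
    filter_upwards [ae_simplex_interior (β := β)] with x hx
    have ha : 0 < β.coord a x := (mem_interior_simplex β).1 hx a
    have hb : 0 < β.coord b x := (mem_interior_simplex β).1 hx b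
    rw [Real.norm_of_nonneg (by positivity), Real.norm_of_nonneg (by positivity),
      ← Real.mul_rpow ha.le hb.le, Real.inv_rpow (by positivity), Real.rpow_neg (by positivity)]
    -- This bounds `(λ_a + λ_b)^(-s)` by `(λ_a λ_b)^(-s/2)`, whose exponents are above `-1` exactly
    -- because `s < 2`.
    have hle : β.coord a x * β.coord b x ≤ (β.coord a x + β.coord b x) ^ 2 := by nlinarith
    gcongr
    calc (β.coord a x * β.coord b x) ^ (s.toReal / 2)
        ≤ ((β.coord a x + β.coord b x) ^ 2) ^ (s.toReal / 2) := by
          gcongr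
      _ = (β.coord a x + β.coord b x) ^ s.toReal := by
          rw [← Real.rpow_natCast, ← Real.rpow_mul (by positivity)]
          congr 1
          push_cast; ring
  -- Without a third vertex the simplex is a segment and `λ_a + λ_b = 1`.
  · push Not at hc
    have h1 : ∀ x, β.coord a x + β.coord b x = 1 := by
      intro x
      rw [← β.sum_coord_apply_eq_one x]
      have : (Finset.univ : Finset ι) = {a, b} := by
        ext c
        simp only [Finset.mem_univ, Finset.mem_insert, Finset.mem_singleton, true_iff]
        by_contra h
        push Not at h
        exact h.2 (hc c h.1.symm).symm
      rw [this, Finset.sum_pair hab]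
    simp_rw [h1]
    exact memLp_const _

end Integrability

/-! ### The discontinuous lift from a facet and its singular gradient. -/

section Lift

variable {n : ℕ} {ι : Type*} [Fintype ι] [DecidableEq ι] (β : AffineBasis ι ℝ (E n))

/-- The function `∏_{a ≠ b} λ_a / (λ_a + λ_b)`, equal to `1` on the facet opposite to `b` and to `0`
on the other facets. -/
def lift (b : ι) (x : E n) : ℝ :=
  ∏ a ∈ Finset.univ.erase b, (β.coord a x / (β.coord a x + β.coord b x))

variable {β}

omit [Fintype ι] [DecidableEq ι] in
lemma Generic.add_pos {x : E n} (hx : Generic β x) {a b : ι} (hab : a ≠ b) :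
    0 < β.coord a x + β.coord b x := by
  have ha := (mem_simplex β).1 hx.1 a
  have hb := (mem_simplex β).1 hx.1 b
  refine lt_of_le_of_ne (by linarith) fun h => hab (hx.2 a b (by linarith) (by linarith))

omit [Fintype ι] [DecidableEq ι] in
lemma contDiffAt_ratio {x : E n} {a b : ι} (h : β.coord a x + β.coord b x ≠ 0)
    {m : WithTop ℕ∞} :
    ContDiffAt ℝ m (fun x => β.coord a x / (β.coord a x + β.coord b x)) x :=
  (contDiff_coord β a).contDiffAt.div
    ((contDiff_coord β a).contDiffAt.add (contDiff_coord β b).contDiffAt) h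

/-- Within the simplex a denominator `λ_a + λ_b` vanishes only where two coordinates vanish
together, that is, off the generic points. -/
lemma contDiffAt_lift {x : E n} {b : ι} (hx : Generic β x) {m : WithTop ℕ∞} :
    ContDiffAt ℝ m (lift β b) x := by
  unfold lift
  exact contDiffAt_prod fun a ha => contDiffAt_ratio (hx.add_pos (Finset.ne_of_mem_erase ha)).ne'

omit [Fintype ι] [DecidableEq ι] in
lemma ratio_mem {x : E n} (hx : x ∈ simplex β) (a b : ι) :
    0 ≤ β.coord a x / (β.coord a x + β.coord b x) ∧
      β.coord a x / (β.coord a x + β.coord b x) ≤ 1 := by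
  have ha := (mem_simplex β).1 hx a
  have hb := (mem_simplex β).1 hx b
  refine ⟨by positivity, div_le_one_of_le₀ (by linarith) (by positivity)⟩

lemma lift_mem {x : E n} (hx : x ∈ simplex β) (b : ι) : 0 ≤ lift β b x ∧ lift β b x ≤ 1 :=
  ⟨Finset.prod_nonneg fun a _ => (ratio_mem hx a b).1,
    Finset.prod_le_one (fun a _ => (ratio_mem hx a b).1) fun a _ => (ratio_mem hx a b).2⟩

lemma lift_eq_one {x : E n} {b : ι} (hx : x ∈ openFacet β b) : lift β b x = 1 :=
  Finset.prod_eq_one fun a ha => by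
    rw [hx.1, add_zero, div_self (hx.2 a (Finset.ne_of_mem_erase ha)).ne']

lemma lift_eq_zero {x : E n} {b c : ι} (hc : c ≠ b) (hx : β.coord c x = 0) : lift β b x = 0 :=
  Finset.prod_eq_zero (Finset.mem_erase.2 ⟨hc, Finset.mem_univ _⟩) (by rw [hx, zero_div])

omit [Fintype ι] [DecidableEq ι] in
/-- The differential of `λ_a / (λ_a + λ_b)` blows up at most like `1 / (λ_a + λ_b)`. -/
lemma norm_fderiv_ratio_le {x : E n} (hx : x ∈ simplex β) {a b : ι}
    (h : 0 < β.coord a x + β.coord b x) :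
    ‖fderiv ℝ (fun x => β.coord a x / (β.coord a x + β.coord b x)) x‖ ≤
      (‖dcoord β a‖ + ‖dcoord β b‖) * (β.coord a x + β.coord b x)⁻¹ := by
  have ha := (mem_simplex β).1 hx a
  have hb := (mem_simplex β).1 hx b
  have hd : HasFDerivAt (fun x => β.coord a x / (β.coord a x + β.coord b x))
      (((β.coord a x + β.coord b x) ^ 2)⁻¹ • (β.coord b x • dcoord β a - β.coord a x • dcoord β b))
      x := by
    have h1 := (hasFDerivAt_coord β a x).mul
      ((hasDerivAt_inv h.ne').comp_hasFDerivAt x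
        ((hasFDerivAt_coord β a x).add (hasFDerivAt_coord β b x)))
    refine h1.congr_fderiv ?_
    have h' := h.ne'
    ext v
    simp only [add_apply, sub_apply, smul_apply, smul_eq_mul,
      Function.comp_apply, Pi.add_apply]
    field_simp
    ring
  rw [hd.fderiv, norm_smul, Real.norm_of_nonneg (by positivity)]
  set S := β.coord a x + β.coord b x with hS
  have h2 : ‖β.coord b x • dcoord β a - β.coord a x • dcoord β b‖ ≤
      S * (‖dcoord β a‖ + ‖dcoord β b‖) := by
    refine (norm_sub_le _ _).trans ?_
    rw [norm_smul, norm_smul, Real.norm_of_nonneg ha, Real.norm_of_nonneg hb, mul_add]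
    gcongr <;> linarith
  calc (S ^ 2)⁻¹ * ‖β.coord b x • dcoord β a - β.coord a x • dcoord β b‖
      ≤ (S ^ 2)⁻¹ * (S * (‖dcoord β a‖ + ‖dcoord β b‖)) := by gcongr
    _ = (‖dcoord β a‖ + ‖dcoord β b‖) * S⁻¹ := by field_simp

/-- Product rule: all the undifferentiated factors lie in `[0, 1]`. -/
lemma norm_fderiv_lift_le {x : E n} (hx : Generic β x) (b : ι) :
    ‖fderiv ℝ (lift β b) x‖ ≤ ∑ a ∈ Finset.univ.erase b,
      (‖dcoord β a‖ + ‖dcoord β b‖) * (β.coord a x + β.coord b x)⁻¹ := by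
  have hd : ∀ a ∈ Finset.univ.erase b, DifferentiableAt ℝ
      (fun x => β.coord a x / (β.coord a x + β.coord b x)) x := fun a ha =>
    (contDiffAt_ratio (hx.add_pos (Finset.ne_of_mem_erase ha)).ne' (m := 1)).differentiableAt
      (by simp)
  have h1 : fderiv ℝ (lift β b) x = ∑ a ∈ Finset.univ.erase b,
      (∏ c ∈ (Finset.univ.erase b).erase a, β.coord c x / (β.coord c x + β.coord b x)) •
        fderiv ℝ (fun x => β.coord a x / (β.coord a x + β.coord b x)) x :=
    fderiv_finsetProd hd
  rw [h1]
  refine (norm_sum_le _ _).trans (Finset.sum_le_sum fun a ha => ?_)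
  rw [norm_smul]
  have hprod : ‖∏ c ∈ (Finset.univ.erase b).erase a,
      β.coord c x / (β.coord c x + β.coord b x)‖ ≤ 1 := by
    rw [Real.norm_of_nonneg (Finset.prod_nonneg fun c _ => (ratio_mem hx.1 c b).1)]
    exact Finset.prod_le_one (fun c _ => (ratio_mem hx.1 c b).1) fun c _ => (ratio_mem hx.1 c b).2
  calc _ ≤ 1 * ((‖dcoord β a‖ + ‖dcoord β b‖) * (β.coord a x + β.coord b x)⁻¹) :=
        mul_le_mul hprod (norm_fderiv_ratio_le hx.1 (hx.add_pos (Finset.ne_of_mem_erase ha)))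
          (norm_nonneg _) zero_le_one
    _ = _ := one_mul _

omit [DecidableEq ι] in
lemma continuousOn_interior_ae {F : Type*} [NormedAddCommGroup F] {f : E n → F}
    (h : ContinuousOn f (interior (simplex β))) :
    AEStronglyMeasurable f (volume.restrict (simplex β)) := by
  have h1 : volume.restrict (simplex β) = volume.restrict (interior (simplex β)) :=
    Measure.restrict_congr_set (simplex_ae_eq_interior β).symm
  rw [h1]
  have : SecondCountableTopologyEither (E n) F := ⟨Or.inl inferInstance⟩
  exact h.aestronglyMeasurable isOpen_interior.measurableSet

lemma memLp_fderiv_lift (b : ι) {s : ℝ≥0∞} (hs0 : s ≠ 0) (hs : s < 2) :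
    MemLp (fderiv ℝ (lift β b)) s (volume.restrict (simplex β)) := by
  have hm : AEStronglyMeasurable (fderiv ℝ (lift β b)) (volume.restrict (simplex β)) := by
    refine continuousOn_interior_ae fun x hx => ?_
    exact ((contDiffAt_lift (generic_of_mem_interior hx) (m := 1)).continuousAt_fderiv
      (by simp)).continuousWithinAt
  have hb : MemLp (fun x => ∑ a ∈ Finset.univ.erase b,
      (‖dcoord β a‖ + ‖dcoord β b‖) * (β.coord a x + β.coord b x)⁻¹) s
      (volume.restrict (simplex β)) :=
    memLp_finsetSum _ fun a ha => (memLp_inv_add β (Finset.ne_of_mem_erase ha) hs0 hs).const_mul _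
  refine hb.mono' hm ?_
  filter_upwards [ae_simplex_generic (β := β)] with x hx
  exact norm_fderiv_lift_le hx b

instance : IsFiniteMeasure (volume.restrict (simplex β)) :=
  ⟨by rw [Measure.restrict_apply_univ]; exact (isCompact_simplex β).measure_lt_top⟩

lemma nice_lift (b : ι) : Nice β (lift β b) where
  contDiffAt x hx := contDiffAt_lift hx
  integrable := by
    have hm : AEStronglyMeasurable (lift β b) (volume.restrict (simplex β)) :=
      continuousOn_interior_ae fun x hx =>
        (contDiffAt_lift (generic_of_mem_interior hx) (m := 0)).continuousAt.continuousWithinAt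
    refine (integrable_const (1:ℝ)).mono' hm ?_
    filter_upwards [ae_restrict_mem (measurableSet_simplex β)] with x hx
    rw [Real.norm_of_nonneg (lift_mem hx b).1]
    exact (lift_mem hx b).2
  integrable_fderiv := (memLp_fderiv_lift b (s := 1) (by simp) (by simp)).integrable le_rfl

end Lift

end DiscreteFlow

namespace DiscreteFlow

/-! ### Polynomials of bounded degree and divisibility by a barycentric coordinate. -/

section Polynomials

variable {n : ℕ}

@[simp] lemma pval_add (p q : MvPolynomial (Fin n) ℝ) (x : E n) :
    pval (p + q) x = pval p x + pval q x := by simp [pval]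

@[simp] lemma pval_sub (p q : MvPolynomial (Fin n) ℝ) (x : E n) :
    pval (p - q) x = pval p x - pval q x := by simp [pval]

@[simp] lemma pval_neg (p : MvPolynomial (Fin n) ℝ) (x : E n) : pval (-p) x = -pval p x := by
  simp [pval]

@[simp] lemma pval_mul (p q : MvPolynomial (Fin n) ℝ) (x : E n) :
    pval (p * q) x = pval p x * pval q x := by simp [pval]

@[simp] lemma pval_smul (c : ℝ) (p : MvPolynomial (Fin n) ℝ) (x : E n) :
    pval (c • p) x = c * pval p x := by simp [pval, MvPolynomial.smul_eval]

@[simp] lemma pval_zero (x : E n) : pval (0 : MvPolynomial (Fin n) ℝ) x = 0 := by simp [pval]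

@[simp] lemma pval_one (x : E n) : pval (1 : MvPolynomial (Fin n) ℝ) x = 1 := by simp [pval]

@[simp] lemma pval_C (c : ℝ) (x : E n) : pval (C c : MvPolynomial (Fin n) ℝ) x = c := by
  simp [pval]

@[simp] lemma pval_X (i : Fin n) (x : E n) : pval (X i : MvPolynomial (Fin n) ℝ) x = x i := by
  simp [pval]

lemma pval_sum {α : Type*} (s : Finset α) (f : α → MvPolynomial (Fin n) ℝ) (x : E n) :
    pval (∑ a ∈ s, f a) x = ∑ a ∈ s, pval (f a) x := by simp [pval, map_sum]

lemma contDiff_pval (q : MvPolynomial (Fin n) ℝ) {m : WithTop ℕ∞} : ContDiff ℝ m (pval q) := by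
  induction q using MvPolynomial.induction_on with
  | C a =>
    have : pval (C a : MvPolynomial (Fin n) ℝ) = fun _ => a := by funext x; simp
    rw [this]; exact contDiff_const
  | add p q hp hq =>
    have : pval (p + q) = fun x => pval p x + pval q x := by funext x; simp
    rw [this]; exact hp.add hq
  | mul_X p i hp =>
    have : pval (p * X i) = fun x => pval p x * x i := by funext x; simp
    rw [this]
    refine hp.mul ?_
    exact (EuclideanSpace.proj (𝕜 := ℝ) i : E n →L[ℝ] ℝ).contDiff

lemma continuous_pval (q : MvPolynomial (Fin n) ℝ) : Continuous (pval q) :=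
  (contDiff_pval q (m := 0)).continuous

/-- A polynomial vanishing on a nonempty open set is zero. -/
lemma eq_zero_of_pval_eq_zero {q : MvPolynomial (Fin n) ℝ} {U : Set (E n)} (hU : IsOpen U)
    (hne : U.Nonempty) (h : ∀ x ∈ U, pval q x = 0) : q = 0 := by
  obtain ⟨x, hx⟩ := hne
  set V : Set (Fin n → ℝ) := (WithLp.toLp 2) ⁻¹' U with hV
  have hVo : IsOpen V := hU.preimage (PiLp.continuous_toLp 2 _)
  have hxV : (fun i => x i) ∈ V := by
    change WithLp.toLp 2 (fun i => x i) ∈ U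
    exact hx
  obtain ⟨ε, hε, hball⟩ := Metric.isOpen_iff.1 hVo _ hxV
  refine MvPolynomial.funext_set (fun i => Metric.ball (x i) ε) (fun i => ?_) fun y hy => ?_
  · rw [Real.ball_eq_Ioo]
    exact Set.Ioo_infinite (by linarith)
  · rw [map_zero]
    have : y ∈ V := hball (by
      rw [ball_pi _ hε]
      exact hy)
    exact h _ this

lemma mem_polyLE {d : ℤ} {q : MvPolynomial (Fin n) ℝ} :
    q ∈ polyLE n d ↔ ∀ m ∈ q.support, (m.degree : ℤ) ≤ d := by
  rw [polyLE, mem_restrictSupport_iff]; rfl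

lemma polyLE_mono {d e : ℤ} (h : d ≤ e) : polyLE n d ≤ polyLE n e :=
  restrictSupport_mono _ fun _ hm => le_trans hm h

lemma monomial_mem_polyLE {d : ℤ} {m : Fin n →₀ ℕ} (h : (m.degree : ℤ) ≤ d) (c : ℝ) :
    monomial m c ∈ polyLE n d := (monomial_mem_restrictSupport ℝ).2 (Or.inl h)

lemma C_mem_polyLE (c : ℝ) {d : ℤ} (hd : 0 ≤ d) : (C c : MvPolynomial (Fin n) ℝ) ∈ polyLE n d := by
  rw [C_apply]; exact monomial_mem_polyLE (by simpa using hd) c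

lemma one_mem_polyLE {d : ℤ} (hd : 0 ≤ d) : (1 : MvPolynomial (Fin n) ℝ) ∈ polyLE n d := by
  rw [← C_1]; exact C_mem_polyLE 1 hd

lemma X_mem_polyLE (i : Fin n) {d : ℤ} (hd : 1 ≤ d) :
    (X i : MvPolynomial (Fin n) ℝ) ∈ polyLE n d := monomial_mem_polyLE (by simpa using hd) 1

lemma mul_mem_polyLE {d e f : ℤ} {p q : MvPolynomial (Fin n) ℝ} (hp : p ∈ polyLE n d)
    (hq : q ∈ polyLE n e) (hf : d + e ≤ f) : p * q ∈ polyLE n f := by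
  classical
  rw [mem_polyLE] at *
  intro m hm
  obtain ⟨a, ha, b, hb, rfl⟩ := Finset.mem_add.1 (support_mul p q hm)
  rw [map_add]
  push_cast
  linarith [hp a ha, hq b hb]

lemma C_mul_mem_polyLE {d : ℤ} (c : ℝ) {q : MvPolynomial (Fin n) ℝ} (hq : q ∈ polyLE n d) :
    C c * q ∈ polyLE n d := mul_mem_polyLE (C_mem_polyLE c le_rfl) hq (by simp)

/-- Induction over the monomials of a polynomial of bounded degree. -/
lemma polyLE_induction {d : ℤ} {W : Submodule ℝ (MvPolynomial (Fin n) ℝ)}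
    (h : ∀ m : Fin n →₀ ℕ, (m.degree : ℤ) ≤ d → monomial m 1 ∈ W) : polyLE n d ≤ W := by
  rw [polyLE, restrictSupport_eq_span, Submodule.span_le]
  rintro _ ⟨m, hm, rfl⟩
  exact h m hm

variable {ι : Type*} (β : AffineBasis ι ℝ (E n))

/-- The linear form `D` as a polynomial. -/
def linPoly (D : E n →L[ℝ] ℝ) : MvPolynomial (Fin n) ℝ :=
  ∑ k, C (D (EuclideanSpace.single k 1)) * X k

lemma sum_apply_single (D : E n →L[ℝ] ℝ) (v : E n) :
    ∑ k, D (EuclideanSpace.single k 1) * v k = D v := by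
  conv_rhs => rw [← (EuclideanSpace.basisFun (Fin n) ℝ).sum_repr v]
  rw [map_sum]
  refine Finset.sum_congr rfl fun k _ => ?_
  simp [mul_comm]

lemma pval_linPoly (D : E n →L[ℝ] ℝ) (x : E n) : pval (linPoly D) x = D x := by
  rw [linPoly, pval_sum]
  simp only [pval_mul, pval_C, pval_X]
  exact sum_apply_single D x

lemma linPoly_mem (D : E n →L[ℝ] ℝ) : linPoly D ∈ polyLE n 1 :=
  Submodule.sum_mem _ fun k _ => C_mul_mem_polyLE _ (X_mem_polyLE k le_rfl)

/-- The barycentric coordinate as a polynomial. -/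
def coordPoly (i : ι) : MvPolynomial (Fin n) ℝ := C (β.coord i 0) + linPoly (dcoord β i)

lemma pval_coordPoly (i : ι) (x : E n) : pval (coordPoly β i) x = β.coord i x := by
  rw [coordPoly, pval_add, pval_C, pval_linPoly, coord_eq β i x]

lemma coordPoly_mem (i : ι) : coordPoly β i ∈ polyLE n 1 :=
  Submodule.add_mem _ (C_mem_polyLE _ zero_le_one) (linPoly_mem _)

/-- Substitution of `x - λ_b(x) v`, the projection along `v` to the hyperplane `λ_b = 0` if
`λ_b` has derivative `1` in the direction `v`. -/
def projPoly (b : ι) (v : E n) : MvPolynomial (Fin n) ℝ →ₐ[ℝ] MvPolynomial (Fin n) ℝ :=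
  aeval fun k => X k - C (v k) * coordPoly β b

lemma pval_projPoly (b : ι) (v : E n) (q : MvPolynomial (Fin n) ℝ) (x : E n) :
    pval (projPoly β b v q) x = pval q (x - β.coord b x • v) := by
  have hX : ∀ k, pval (projPoly β b v (X k)) x = (x - β.coord b x • v) k := by
    intro k
    rw [projPoly, aeval_X, pval_sub, pval_mul, pval_X, pval_C, pval_coordPoly]
    simp [mul_comm]
  induction q using MvPolynomial.induction_on with
  | C a => rw [show projPoly β b v (C a) = C a from (projPoly β b v).commutes a]; simp
  | add p q hp hq => rw [map_add, pval_add, pval_add, hp, hq]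
  | mul_X p i hp => rw [map_mul, pval_mul, pval_mul, hp, hX, pval_X]

/-- The substitution moves `x` by a multiple of `λ_b(x)`, so it changes a polynomial by a multiple
of `λ_b`. The point is the degree bound on the cofactor. -/
lemma exists_sub_projPoly (b : ι) (v : E n) {d : ℤ} {q : MvPolynomial (Fin n) ℝ}
    (hq : q ∈ polyLE n d) :
    ∃ w ∈ polyLE n (d - 1), q - projPoly β b v q = coordPoly β b * w := by
  -- Writing `π` for the substitution, the degree of `π q` is carried along so that `Q` passes to
  -- products, by `pq - πp πq = (p - πp) q + πp (q - πq)`. It then holds for all monomials.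
  let Q : ℕ → MvPolynomial (Fin n) ℝ → Prop := fun d q => q ∈ polyLE n d ∧
    projPoly β b v q ∈ polyLE n d ∧
    ∃ w ∈ polyLE n ((d : ℤ) - 1), q - projPoly β b v q = coordPoly β b * w
  have hone : Q 0 1 := ⟨one_mem_polyLE (by simp), by rw [map_one]; exact one_mem_polyLE (by simp),
    0, Submodule.zero_mem _, by simp⟩
  have hmul : ∀ d e p q, Q d p → Q e q → Q (d + e) (p * q) := by
    rintro d e p q ⟨hp, hp', w, hw, hpw⟩ ⟨hq, hq', z, hz, hqz⟩
    refine ⟨mul_mem_polyLE hp hq (by simp),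
      by rw [map_mul]; exact mul_mem_polyLE hp' hq' (by simp),
      w * q + projPoly β b v p * z, Submodule.add_mem _
        (mul_mem_polyLE hw hq (by push_cast; linarith))
        (mul_mem_polyLE hp' hz (by push_cast; linarith)), ?_⟩
    rw [map_mul]
    linear_combination q * hpw + projPoly β b v p * hqz
  have hX : ∀ k, Q 1 (X k) := fun k => by
    have h1 : projPoly β b v (X k) = X k - C (v k) * coordPoly β b := by rw [projPoly, aeval_X]
    refine ⟨X_mem_polyLE k (by simp), ?_, C (v k), C_mem_polyLE _ (by simp), ?_⟩
    · rw [h1]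
      exact Submodule.sub_mem _ (X_mem_polyLE k (by simp)) (C_mul_mem_polyLE _ (coordPoly_mem β b))
    · rw [h1]; ring
  have hmon : ∀ m : Fin n →₀ ℕ, Q m.degree (monomial m 1) := by
    intro m
    induction m using Finsupp.induction_linear with
    | zero => simpa using hone
    | add f g hf hg =>
      have := hmul _ _ _ _ hf hg
      rwa [monomial_mul, one_mul, ← map_add] at this
    | single k a =>
      induction a with
      | zero => simpa using hone
      | succ a ih =>
        have := hmul _ _ _ _ ih (hX k)
        rw [X, monomial_mul, one_mul, ← Finsupp.single_add] at this
        simpa using this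
  let W : Submodule ℝ (MvPolynomial (Fin n) ℝ) :=
    ((polyLE n (d - 1)).map (LinearMap.mulLeft ℝ (coordPoly β b))).comap
      (LinearMap.id - (projPoly β b v).toLinearMap)
  have hW : polyLE n d ≤ W := polyLE_induction fun m hm => by
    obtain ⟨-, -, w, hw, h⟩ := hmon m
    exact ⟨w, polyLE_mono (by linarith) hw, h.symm⟩
  obtain ⟨w, hw, h⟩ := hW hq
  exact ⟨w, hw, h.symm⟩

variable {β}

lemma interior_simplex_nonempty [Fintype ι] : (interior (simplex β)).Nonempty := by
  have := β.nonempty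
  exact ⟨_, (mem_interior_simplex β).2 fun i => by
    rw [β.coord_apply_centroid (Finset.mem_univ i)]
    simp [Fintype.card_pos]⟩

/-- A polynomial vanishing on a facet is divisible by the corresponding barycentric coordinate. -/
lemma exists_eq_coordPoly_mul [Fintype ι] [Nontrivial ι] (b : ι) {d : ℤ}
    {q : MvPolynomial (Fin n) ℝ} (hq : q ∈ polyLE n d) (h : ∀ x ∈ openFacet β b, pval q x = 0) :
    ∃ w ∈ polyLE n (d - 1), q = coordPoly β b * w := by
  obtain ⟨a, hab⟩ := exists_ne b
  -- Projection along the edge from `β b` to `β a` sends interior points to the open facet, where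
  -- `q` vanishes. So the projected polynomial is zero and `q` itself is the multiple of `λ_b`.
  obtain ⟨w, hw, hqw⟩ := exists_sub_projPoly β b (-(β a - β b)) hq
  have h0 : projPoly β b (-(β a - β b)) q = 0 := by
    refine eq_zero_of_pval_eq_zero isOpen_interior (interior_simplex_nonempty (β := β)) fun x hx => ?_
    rw [pval_projPoly, smul_neg, sub_neg_eq_add]
    have hx' := (mem_interior_simplex β).1 hx
    exact h _ (line_end_mem hab (fun k _ _ => hx' k) (add_pos (hx' a) (hx' b)))
  rw [h0, sub_zero] at hqw
  exact ⟨w, hw, hqw⟩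

/-- The field with polynomial components. -/
def fieldOf (a : Fin n → MvPolynomial (Fin n) ℝ) (x : E n) : E n :=
  WithLp.toLp 2 fun i => pval (a i) x

lemma fieldOf_apply (a : Fin n → MvPolynomial (Fin n) ℝ) (x : E n) (i : Fin n) :
    fieldOf a x i = pval (a i) x := rfl

lemma contDiff_fieldOf (a : Fin n → MvPolynomial (Fin n) ℝ) {m : WithTop ℕ∞} :
    ContDiff ℝ m (fieldOf a) := by
  rw [contDiff_euclidean]
  exact fun i => contDiff_pval (a i)

lemma clm_fieldOf (D : E n →L[ℝ] ℝ) (a : Fin n → MvPolynomial (Fin n) ℝ) (x : E n) :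
    D (fieldOf a x) = pval (∑ k, C (D (EuclideanSpace.single k 1)) * a k) x := by
  rw [← sum_apply_single D, pval_sum]
  simp [fieldOf_apply]

end Polynomials

end DiscreteFlow

namespace DiscreteFlow

open scoped Classical

/-! ### Elements as simplices, and integration over the domain element by element. -/

namespace Triangulation

variable {n : ℕ} (T : Triangulation n)

instance (K : T.Cell) [NeZero n] : Nontrivial K.1 := by
  rw [← Finite.one_lt_card_iff_nontrivial, Nat.card_eq_fintype_card, Fintype.card_coe, K.2.2]
  have := NeZero.ne n
  omega

lemma cellBasis_apply (K : T.Cell) (a : K.1) : T.cellBasis K a = a.1 := rfl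

lemma hull_eq (K : T.Cell) : T.hull K = simplex (T.cellBasis K) := by
  have : Set.range (T.cellBasis K) = (K.1 : Set (E n)) := by
    ext x; simp [cellBasis_apply]
  rw [hull, simplex, this]

lemma isClosed_hull (K : T.Cell) : IsClosed (T.hull K) := by
  rw [hull_eq]; exact (isCompact_simplex _).isClosed

lemma measurableSet_hull (K : T.Cell) : MeasurableSet (T.hull K) := (T.isClosed_hull K).measurableSet

/-! ### Facets of an element -/

lemma exists_opposite (K : T.Cell) {e : Finset (E n)} (he : e ⊆ K.1) (hc : e.card = n) :
    ∃ b : K.1, e = K.1.erase b := by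
  have h1 : (K.1 \ e).card = 1 := by
    rw [Finset.card_sdiff_of_subset he, K.2.2, hc]; omega
  obtain ⟨b, hb⟩ := Finset.card_eq_one.1 h1
  have hbK : b ∈ K.1 \ e := by rw [hb]; exact Finset.mem_singleton_self b
  refine ⟨⟨b, (Finset.mem_sdiff.1 hbK).1⟩, ?_⟩
  rw [← Finset.sdiff_singleton_eq_erase, ← hb, Finset.sdiff_sdiff_eq_self he]

lemma bary_eq (K : T.Cell) (a : K.1) (x : E n) : T.bary K a x = (T.cellBasis K).coord a x := by
  rw [bary, dif_pos a.2]

lemma sum_erase_eq {M : Type*} [AddCommMonoid M] (K : T.Cell) (b : K.1) (f : E n → M) :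
    ∑ a ∈ K.1.erase b, f a = ∑ a ∈ (Finset.univ : Finset K.1).erase b, f a := by
  rw [← Finset.sum_image (g := fun a : K.1 => a.1) (f := f)
    (fun x _ y _ h => Subtype.ext h)]
  congr 1
  ext x
  simp only [Finset.mem_erase, Finset.mem_image, Finset.mem_univ, and_true, Subtype.exists,
    exists_and_right, exists_eq_right]
  constructor
  · rintro ⟨h1, h2⟩
    exact ⟨h2, fun h => h1 (congrArg Subtype.val h)⟩
  · rintro ⟨h1, h2⟩
    exact ⟨fun h => h2 (Subtype.ext h), h1⟩

lemma prod_erase_eq (K : T.Cell) (b : K.1) (f : E n → ℝ) :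
    ∏ a ∈ K.1.erase b, f a = ∏ a ∈ (Finset.univ : Finset K.1).erase b, f a := by
  exact T.sum_erase_eq (M := Additive ℝ) K b f

lemma facetLift_eq (K : T.Cell) (b : K.1) (q : MvPolynomial (Fin n) ℝ) :
    T.facetLift K (K.1.erase b) q = fun x => pval q x * lift (T.cellBasis K) b x := by
  funext x
  have h1 : (1 - ∑ a' ∈ K.1.erase b, T.bary K a' x) = (T.cellBasis K).coord b x := by
    rw [T.sum_erase_eq K b (fun a => T.bary K a x)]
    simp_rw [bary_eq]
    rw [← (T.cellBasis K).sum_coord_apply_eq_one x,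
      ← Finset.sum_erase_add Finset.univ _ (Finset.mem_univ b)]
    ring
  rw [facetLift, h1, T.prod_erase_eq K b
    (fun a => T.bary K a x / (T.bary K a x + (T.cellBasis K).coord b x))]
  simp_rw [bary_eq]
  rfl

lemma mem_facet_of_coord_eq_zero (K : T.Cell) (b : K.1) {x : E n} (hx : x ∈ T.hull K)
    (h0 : (T.cellBasis K).coord b x = 0) : x ∈ convexHull ℝ (K.1.erase b : Set (E n)) := by
  rw [hull_eq] at hx
  have h1 := (T.cellBasis K).linear_combination_coord_eq_self x
  have h2 := (T.cellBasis K).sum_coord_apply_eq_one x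
  rw [← Finset.sum_erase_add Finset.univ _ (Finset.mem_univ b), h0] at h1 h2
  rw [zero_smul, add_zero] at h1
  rw [add_zero] at h2
  rw [← h1]
  refine (convex_convexHull ℝ _).sum_mem (fun i _ => (mem_simplex _).1 hx i) h2 fun i hi => ?_
  refine subset_convexHull ℝ _ ?_
  rw [cellBasis_apply]
  simp only [Finset.coe_erase, Set.mem_sdiff, Finset.mem_coe, Set.mem_singleton_iff]
  exact ⟨i.2, fun h => Finset.ne_of_mem_erase hi (Subtype.ext h)⟩

lemma coord_eq_zero_of_mem_convexHull (K : T.Cell) (b : K.1) {s : Set (E n)} (hs : s ⊆ K.1)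
    (hb : b.1 ∉ s) {x : E n} (hx : x ∈ convexHull ℝ s) : (T.cellBasis K).coord b x = 0 := by
  have hconv : Convex ℝ ((T.cellBasis K).coord b ⁻¹' {0}) :=
    (convex_singleton (0:ℝ)).affine_preimage _
  refine convexHull_min (fun a ha => ?_) hconv hx
  have : (T.cellBasis K).coord b (T.cellBasis K ⟨a, hs ha⟩) = 0 := by
    rw [AffineBasis.coord_apply_ne]
    intro h
    exact hb (by rw [h]; exact ha)
  exact this

lemma mem_facet_iff (K : T.Cell) (b : K.1) {x : E n} :
    x ∈ convexHull ℝ (K.1.erase b : Set (E n)) ↔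
      x ∈ T.hull K ∧ (T.cellBasis K).coord b x = 0 := by
  refine ⟨fun hx => ⟨?_, ?_⟩, fun h => T.mem_facet_of_coord_eq_zero K b h.1 h.2⟩
  · exact convexHull_mono (Finset.coe_subset.2 (Finset.erase_subset _ _)) hx
  · exact T.coord_eq_zero_of_mem_convexHull K b (Finset.coe_subset.2 (Finset.erase_subset _ _))
      (by simp) hx

lemma openFacet_subset (K : T.Cell) (b : K.1) :
    openFacet (T.cellBasis K) b ⊆ convexHull ℝ (K.1.erase b : Set (E n)) := fun x hx =>
  (T.mem_facet_iff K b).2 ⟨by rw [hull_eq]; exact (generic_of_mem_openFacet hx).1, hx.1⟩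

/-! ### Integration over the triangulated domain -/

lemma hull_subset_space (K : T.Cell) : T.hull K ⊆ T.complex.space := fun _ hx =>
  Set.mem_biUnion K.2.1 hx

lemma interior_hull_subset_dom (K : T.Cell) : interior (T.hull K) ⊆ T.dom :=
  interior_mono (T.hull_subset_space K)

/-- The domain is an open set that contains the interior of each element but possibly not its
boundary, which is a null set. -/
lemma vol_restrict_hull (K : T.Cell) :
    T.vol.restrict (T.hull K) = volume.restrict (simplex (T.cellBasis K)) := by
  rw [vol, Measure.restrict_restrict (T.measurableSet_hull K), ← hull_eq]
  refine Measure.restrict_congr_set ?_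
  have h1 : interior (T.hull K) =ᵐ[volume] T.hull K := by
    rw [hull_eq]; exact simplex_ae_eq_interior _
  filter_upwards [h1] with x hx
  refine propext ⟨fun h => h.1, fun h => ⟨h, ?_⟩⟩
  have h2 : x ∈ interior (T.hull K) := (Iff.of_eq hx).2 h
  exact T.interior_hull_subset_dom K h2

lemma ae_vol_iff (K : T.Cell) {P : E n → Prop} :
    (∀ᵐ x ∂T.vol, x ∈ T.hull K → P x) ↔
      ∀ᵐ x ∂(volume.restrict (simplex (T.cellBasis K))), P x := by
  rw [← vol_restrict_hull, ae_restrict_iff' (T.measurableSet_hull K)]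

lemma inter_hull_subset {K K' : T.Cell} :
    T.hull K ∩ T.hull K' ⊆ convexHull ℝ ((K.1 : Set (E n)) ∩ K'.1) :=
  T.complex.inter_subset_convexHull K.2.1 K'.2.1

lemma exists_mem_notMem {K K' : T.Cell} (h : K ≠ K') : ∃ b : K.1, b.1 ∉ K'.1 := by
  by_contra hcon
  push Not at hcon
  have hsub : K.1 ⊆ K'.1 := fun x hx => hcon ⟨x, hx⟩
  exact h (Subtype.ext (Finset.eq_of_subset_of_card_le hsub (by rw [K.2.2, K'.2.2])))

/-- By conformity two elements meet in the hull of their common vertices, hence in the hyperplane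
`λ_b = 0` for a vertex `b` of `K` that is not a vertex of `K'`. -/
lemma aedisjoint_hull : Pairwise (Function.onFun (AEDisjoint volume) T.hull) := by
  intro K K' h
  obtain ⟨b, hb⟩ := T.exists_mem_notMem h
  refine measure_mono_null (fun x hx => ?_) (volume_coord_eq_zero (T.cellBasis K) b)
  exact T.coord_eq_zero_of_mem_convexHull K b Set.inter_subset_left (fun h => hb h.2)
    (T.inter_hull_subset hx)

lemma space_eq : T.complex.space = ⋃ K : T.Cell, T.hull K := by
  refine Set.Subset.antisymm (fun x hx => ?_) (Set.iUnion_subset T.hull_subset_space)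
  obtain ⟨s, hs, hxs⟩ := Set.mem_iUnion₂.1 hx
  obtain ⟨t, ht, hst, hc⟩ := T.pure s hs
  exact Set.mem_iUnion.2 ⟨⟨t, ht, hc⟩, convexHull_mono (Finset.coe_subset.2 hst) hxs⟩

lemma vol_eq : T.vol = volume.restrict (⋃ K : T.Cell, T.hull K) := by
  refine Measure.restrict_congr_set ?_
  have h1 : ∀ K : T.Cell, interior (T.hull K) =ᵐ[volume] T.hull K := fun K => by
    rw [hull_eq]; exact simplex_ae_eq_interior _
  filter_upwards [ae_all_iff.2 h1] with x hx
  refine propext ⟨fun h => ?_, fun h => ?_⟩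
  · have : x ∈ T.complex.space := interior_subset h
    rwa [space_eq] at this
  · obtain ⟨K, hK⟩ := Set.mem_iUnion.1 h
    have h2 : x ∈ interior (T.hull K) := (Iff.of_eq (hx K)).2 hK
    exact T.interior_hull_subset_dom K h2

lemma ae_mem_hull : ∀ᵐ x ∂T.vol, ∃ K : T.Cell, x ∈ T.hull K := by
  rw [vol_eq]
  filter_upwards [ae_restrict_mem (MeasurableSet.iUnion fun K => T.measurableSet_hull K)] with x hx
  exact Set.mem_iUnion.1 hx

lemma ae_vol_of_forall {P : E n → Prop}
    (h : ∀ K : T.Cell, ∀ᵐ x ∂(volume.restrict (simplex (T.cellBasis K))), P x) :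
    ∀ᵐ x ∂T.vol, P x := by
  have h1 : ∀ᵐ x ∂T.vol, ∀ K : T.Cell, x ∈ T.hull K → P x :=
    ae_all_iff.2 fun K => (T.ae_vol_iff K).2 (h K)
  filter_upwards [h1, T.ae_mem_hull] with x hx hK
  exact hx _ hK.choose_spec

lemma integral_vol {f : E n → ℝ} (hf : Integrable f T.vol) :
    ∫ x, f x ∂T.vol = ∑ K : T.Cell, ∫ x in simplex (T.cellBasis K), f x := by
  rw [vol_eq] at hf ⊢
  rw [integral_iUnion_ae (fun K => (T.measurableSet_hull K).nullMeasurableSet) T.aedisjoint_hull hf,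
    tsum_fintype]
  simp_rw [hull_eq]

lemma integrableOn_simplex {F : Type*} [NormedAddCommGroup F] {f : E n → F} (hf : Integrable f T.vol)
    (K : T.Cell) : IntegrableOn f (simplex (T.cellBasis K)) := by
  rw [IntegrableOn, ← vol_restrict_hull]
  exact hf.integrableOn

lemma memLp_simplex {F : Type*} [NormedAddCommGroup F] {f : E n → F} {p : ℝ≥0∞}
    (hf : MemLp f p T.vol) (K : T.Cell) :
    MemLp f p (volume.restrict (simplex (T.cellBasis K))) := by
  rw [← vol_restrict_hull]
  exact hf.restrict _

end Triangulation

end DiscreteFlow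

namespace DiscreteFlow

open scoped Classical

/-! ### Well-definedness and linearity of `u ↦ A_u`. -/

namespace Triangulation

variable {n : ℕ} {T : Triangulation n}

/-! ### The distributional divergence -/

lemma IsWeakDiv.unique {u : T.L2Vec} {c d : T.L2} (hc : T.IsWeakDiv u c) (hd : T.IsWeakDiv u d) :
    c = d := by
  have hi : ∀ f : T.L2, Integrable (fun x => f x) T.vol := fun f =>
    (Lp.memLp f).integrable (by norm_num)
  have hsub := (hi c).sub (hi d)
  have h0 : ∀ᵐ x ∂T.vol, x ∈ T.dom → c x - d x = 0 := by
    refine IsOpen.ae_eq_zero_of_integral_contDiff_smul_eq_zero isOpen_interior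
      (hsub.locallyIntegrable.locallyIntegrableOn _) fun φ h1 h2 h3 => ?_
    have e1 := hc φ h1 h2 h3
    have e2 := hd φ h1 h2 h3
    have := integral_sub (T.integrable_test u c h1 h2) (T.integrable_test u d h1 h2)
    rw [e1, e2, sub_zero] at this
    rw [← this]
    refine integral_congr_ae (Filter.Eventually.of_forall fun x => ?_)
    simp only [smul_eq_mul]
    ring
  refine Lp.ext ?_
  filter_upwards [h0, ae_restrict_mem isOpen_interior.measurableSet] with x hx hxd
  exact sub_eq_zero.1 (hx hxd)

lemma weakDiv_eq {u : T.L2Vec} {d : T.L2} (h : T.IsWeakDiv u d) : T.weakDiv u = d := by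
  have he : ∃ d : T.L2, T.IsWeakDiv u d := ⟨d, h⟩
  rw [weakDiv, dif_pos he]
  exact he.choose_spec.unique h

lemma isWeakDiv_weakDiv {u : T.L2Vec} (hu : u ∈ T.H0div) : T.IsWeakDiv u (T.weakDiv u) := by
  obtain ⟨d, hd, -⟩ := hu
  rwa [weakDiv_eq hd]

lemma normalTraceZero_weakDiv {u : T.L2Vec} (hu : u ∈ T.H0div) :
    T.NormalTraceZero u (T.weakDiv u) := by
  obtain ⟨d, hd, hd'⟩ := hu
  rwa [weakDiv_eq hd]

lemma weakDiv_add {u v : T.L2Vec} (hu : u ∈ T.H0div) (hv : v ∈ T.H0div) :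
    T.weakDiv (u + v) = T.weakDiv u + T.weakDiv v :=
  weakDiv_eq fun φ h1 h2 h3 => by
    rw [T.integral_test_add u v _ _ h1 h2, isWeakDiv_weakDiv hu φ h1 h2 h3,
      isWeakDiv_weakDiv hv φ h1 h2 h3, add_zero]

lemma weakDiv_smul (t : ℝ) {u : T.L2Vec} (hu : u ∈ T.H0div) :
    T.weakDiv (t • u) = t • T.weakDiv u :=
  weakDiv_eq fun φ h1 h2 h3 => by
    rw [T.integral_test_smul t u _ φ, isWeakDiv_weakDiv hu φ h1 h2 h3, mul_zero]

/-! ### Convergence of the facet integrals -/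

section Facet

variable (K : T.Cell) (b : K.1)

/-- The lift to the element `K` of the polynomial `q` on the facet opposite to `b`. -/
def wLift (q : MvPolynomial (Fin n) ℝ) (x : E n) : ℝ := pval q x * lift (T.cellBasis K) b x

lemma facetIntegral_eq (u : T.L2Vec) (q : MvPolynomial (Fin n) ℝ) :
    T.facetIntegral u K (K.1.erase b) q = ∫ x in simplex (T.cellBasis K),
      (fderiv ℝ (wLift K b q) x (u x) + T.weakDiv u x * wLift K b q x) := by
  rw [facetIntegral, vol_restrict_hull, facetLift_eq]
  rfl

lemma nice_wLift (q : MvPolynomial (Fin n) ℝ) : Nice (T.cellBasis K) (wLift K b q) :=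
  (nice_lift b).mul (contDiff_pval q)

lemma memLp_fderiv_wLift (q : MvPolynomial (Fin n) ℝ) {s : ℝ≥0∞} (hs0 : s ≠ 0) (hs : s < 2) :
    MemLp (fderiv ℝ (wLift K b q)) s (volume.restrict (simplex (T.cellBasis K))) := by
  obtain ⟨C, hC⟩ := (isCompact_simplex (T.cellBasis K)).exists_bound_of_continuousOn
    (continuous_pval q).continuousOn
  obtain ⟨C', hC'⟩ := (isCompact_simplex (T.cellBasis K)).exists_bound_of_continuousOn
    ((contDiff_pval q (m := 1)).continuous_fderiv (by simp)).continuousOn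
  have h1 := (memLp_fderiv_lift (β := T.cellBasis K) b hs0 hs).norm.const_mul C
  have h2 : MemLp (fun _ : E n => C') s (volume.restrict (simplex (T.cellBasis K))) :=
    memLp_const _
  refine (h1.add h2).mono' (nice_wLift K b q).integrable_fderiv.aestronglyMeasurable ?_
  filter_upwards [ae_restrict_mem (measurableSet_simplex (T.cellBasis K)),
    (nice_lift (β := T.cellBasis K) b).ae_differentiableAt] with x hx hd
  have hf : fderiv ℝ (wLift K b q) x = pval q x • fderiv ℝ (lift (T.cellBasis K) b) x +
      lift (T.cellBasis K) b x • fderiv ℝ (pval q) x :=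
    fderiv_fun_mul ((contDiff_pval q (m := 1)).differentiable (by simp) x) hd
  rw [hf]
  refine (norm_add_le _ _).trans ?_
  rw [norm_smul, norm_smul]
  have hl := lift_mem hx b
  refine add_le_add (mul_le_mul_of_nonneg_right (hC x hx) (norm_nonneg _)) ?_
  rw [Real.norm_of_nonneg hl.1]
  calc _ ≤ 1 * C' := mul_le_mul hl.2 (hC' x hx) (norm_nonneg _) zero_le_one
    _ = C' := one_mul _

/-- Hölder's inequality: for `p > 2` the conjugate exponent is below `2`, the range in which the
gradient of the lift is integrable. This is where the hypothesis on `p` enters. -/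
lemma integrable_fderiv_wLift {p : ℝ≥0∞} (hp : 2 < p) (q : MvPolynomial (Fin n) ℝ) {u : T.L2Vec}
    (hu : MemLp (fun x => u x) p T.vol) :
    IntegrableOn (fun x => fderiv ℝ (wLift K b q) x (u x)) (simplex (T.cellBasis K)) := by
  have hp1 : 1 ≤ p := le_trans (by norm_num) hp.le
  have hconj := ENNReal.HolderConjugate.conjExponent hp1
  have hs : ENNReal.conjExponent p < 2 := by
    rw [ENNReal.conjExponent]
    have h1 : (1:ℝ≥0∞) < p - 1 := by
      rw [lt_tsub_iff_right]
      norm_num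
      exact hp
    have h2 : (p - 1)⁻¹ < 1 := ENNReal.inv_lt_one.2 h1
    calc 1 + (p - 1)⁻¹ < 1 + 1 := (ENNReal.add_lt_add_iff_left (by simp)).2 h2
      _ = 2 := by norm_num
  have hs0 : ENNReal.conjExponent p ≠ 0 := by
    rw [ENNReal.conjExponent]; simp
  have hu' := memLp_simplex T hu K
  have hw := memLp_fderiv_wLift K b q hs0 hs
  have hprod := MemLp.integrable_mul hu'.norm hw.norm
  refine hprod.mono' ?_ (Filter.Eventually.of_forall fun x => ?_)
  · exact (ContinuousLinearMap.apply ℝ ℝ).aestronglyMeasurable_comp₂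
      hu'.aestronglyMeasurable hw.aestronglyMeasurable
  · rw [Pi.mul_apply, mul_comm]
    exact (fderiv ℝ (wLift K b q) x).le_opNorm _

lemma abs_wLift_le (q : MvPolynomial (Fin n) ℝ) :
    ∃ C, ∀ x ∈ simplex (T.cellBasis K), ‖wLift K b q x‖ ≤ C := by
  obtain ⟨C, hC⟩ := (isCompact_simplex (T.cellBasis K)).exists_bound_of_continuousOn
    (continuous_pval q).continuousOn
  refine ⟨C, fun x hx => ?_⟩
  have hl := lift_mem hx b
  rw [wLift, norm_mul, Real.norm_of_nonneg hl.1]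
  calc _ ≤ C * 1 := mul_le_mul (hC x hx) hl.2 hl.1 ((norm_nonneg _).trans (hC x hx))
    _ = C := mul_one _

lemma integrable_mul_wLift (d : T.L2) (q : MvPolynomial (Fin n) ℝ) :
    IntegrableOn (fun x => d x * wLift K b q x) (simplex (T.cellBasis K)) := by
  have hd : Integrable (fun x => d x) T.vol := (Lp.memLp d).integrable (by norm_num)
  obtain ⟨C, hC⟩ := abs_wLift_le K b q
  refine Integrable.mul_bdd (c := C) (integrableOn_simplex T hd K)
    (nice_wLift K b q).integrable.aestronglyMeasurable ?_
  filter_upwards [ae_restrict_mem (measurableSet_simplex (T.cellBasis K))] with x hx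
  exact hC x hx

lemma integrable_facet {p : ℝ≥0∞} (hp : 2 < p) (q : MvPolynomial (Fin n) ℝ) {u : T.L2Vec}
    (hu : MemLp (fun x => u x) p T.vol) (d : T.L2) :
    IntegrableOn (fun x => fderiv ℝ (wLift K b q) x (u x) + d x * wLift K b q x)
      (simplex (T.cellBasis K)) :=
  (integrable_fderiv_wLift K b hp q hu).add (integrable_mul_wLift K b d q)

lemma ae_simplex_of_ae_vol {P : E n → Prop} (h : ∀ᵐ x ∂T.vol, P x) :
    ∀ᵐ x ∂(volume.restrict (simplex (T.cellBasis K))), P x :=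
  (T.ae_vol_iff K).1 (h.mono fun _ hx _ => hx)

lemma facetIntegral_add_left {p : ℝ≥0∞} (hp : 2 < p) (q : MvPolynomial (Fin n) ℝ) {u v : T.L2Vec}
    (hu : u ∈ T.H0divLp p) (hv : v ∈ T.H0divLp p) :
    T.facetIntegral (u + v) K (K.1.erase b) q =
      T.facetIntegral u K (K.1.erase b) q + T.facetIntegral v K (K.1.erase b) q := by
  simp_rw [facetIntegral_eq]
  rw [← integral_add (integrable_facet K b hp q hu.2 _) (integrable_facet K b hp q hv.2 _)]
  refine integral_congr_ae ?_
  rw [weakDiv_add hu.1 hv.1]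
  filter_upwards [ae_simplex_of_ae_vol K (Lp.coeFn_add u v),
    ae_simplex_of_ae_vol K (Lp.coeFn_add (T.weakDiv u) (T.weakDiv v))] with x h1 h2
  rw [h1, h2, Pi.add_apply, Pi.add_apply, map_add]
  ring

lemma facetIntegral_smul_left (t : ℝ) (q : MvPolynomial (Fin n) ℝ) {u : T.L2Vec}
    (hu : u ∈ T.H0div) :
    T.facetIntegral (t • u) K (K.1.erase b) q = t * T.facetIntegral u K (K.1.erase b) q := by
  simp_rw [facetIntegral_eq]
  rw [← integral_const_mul]
  refine integral_congr_ae ?_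
  rw [weakDiv_smul t hu]
  filter_upwards [ae_simplex_of_ae_vol K (Lp.coeFn_smul t u),
    ae_simplex_of_ae_vol K (Lp.coeFn_smul t (T.weakDiv u))] with x h1 h2
  rw [h1, h2, Pi.smul_apply, Pi.smul_apply, map_smul, smul_eq_mul, smul_eq_mul]
  ring

lemma facetIntegral_add_right {p : ℝ≥0∞} (hp : 2 < p) (q q' : MvPolynomial (Fin n) ℝ)
    {u : T.L2Vec} (hu : u ∈ T.H0divLp p) :
    T.facetIntegral u K (K.1.erase b) (q + q') =
      T.facetIntegral u K (K.1.erase b) q + T.facetIntegral u K (K.1.erase b) q' := by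
  simp_rw [facetIntegral_eq]
  rw [← integral_add (integrable_facet K b hp q hu.2 _) (integrable_facet K b hp q' hu.2 _)]
  refine integral_congr_ae ?_
  filter_upwards [(nice_wLift K b q).ae_differentiableAt, (nice_wLift K b q').ae_differentiableAt]
    with x h1 h2
  have h3 : wLift K b (q + q') = fun x => wLift K b q x + wLift K b q' x := by
    funext x; simp [wLift, add_mul]
  rw [h3, fderiv_fun_add h1 h2, add_apply]
  ring

lemma facetIntegral_smul_right (t : ℝ) (q : MvPolynomial (Fin n) ℝ) (u : T.L2Vec) :
    T.facetIntegral u K (K.1.erase b) (t • q) = t * T.facetIntegral u K (K.1.erase b) q := by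
  simp_rw [facetIntegral_eq]
  rw [← integral_const_mul]
  refine integral_congr_ae ?_
  filter_upwards [(nice_wLift K b q).ae_differentiableAt] with x h1
  have h3 : wLift K b (t • q) = fun x => t * wLift K b q x := by
    funext x; simp [wLift, mul_assoc]
  rw [h3, fderiv_const_mul h1, smul_apply, smul_eq_mul]
  ring

end Facet

/-! ### Degrees of freedom as bilinear maps -/

lemma integrable_cellDof (u : T.L2Vec) (K : T.Cell) (P : Fin n → MvPolynomial (Fin n) ℝ) :
    IntegrableOn (fun x => ∑ i, u x i * pval (P i) x) (simplex (T.cellBasis K)) := by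
  have hu : Integrable (fun x => u x) T.vol := (Lp.memLp u).integrable (by norm_num)
  refine integrable_finsetSum _ fun i _ => ?_
  have h1 : IntegrableOn (fun x => u x i) (simplex (T.cellBasis K)) :=
    (EuclideanSpace.proj (𝕜 := ℝ) i : E n →L[ℝ] ℝ).integrable_comp (integrableOn_simplex T hu K)
  exact h1.mul_continuousOn (continuous_pval (P i)).continuousOn (isCompact_simplex _)

variable (T) in
/-- `(u, P) ↦ ∫_K u · P` as a bilinear map. -/
def cellDofL (K : T.Cell) : T.L2Vec →ₗ[ℝ] (Fin n → MvPolynomial (Fin n) ℝ) →ₗ[ℝ] ℝ :=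
  LinearMap.mk₂ ℝ (fun u P => T.cellDof u K P)
    (fun u v P => by
      simp_rw [cellDof, vol_restrict_hull]
      rw [← integral_add (integrable_cellDof u K P) (integrable_cellDof v K P)]
      refine integral_congr_ae ?_
      filter_upwards [ae_simplex_of_ae_vol K (Lp.coeFn_add u v)] with x h1
      rw [h1, ← Finset.sum_add_distrib]
      refine Finset.sum_congr rfl fun i _ => ?_
      rw [Pi.add_apply, PiLp.add_apply]; ring)
    (fun t u P => by
      simp_rw [cellDof, vol_restrict_hull]
      rw [smul_eq_mul, ← integral_const_mul]
      refine integral_congr_ae ?_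
      filter_upwards [ae_simplex_of_ae_vol K (Lp.coeFn_smul t u)] with x h1
      rw [h1, Finset.mul_sum]
      refine Finset.sum_congr rfl fun i _ => ?_
      rw [Pi.smul_apply, PiLp.smul_apply, smul_eq_mul]; ring)
    (fun u P Q => by
      simp_rw [cellDof, vol_restrict_hull]
      rw [← integral_add (integrable_cellDof u K P) (integrable_cellDof u K Q)]
      refine integral_congr_ae (Filter.Eventually.of_forall fun x => ?_)
      dsimp only
      rw [← Finset.sum_add_distrib]
      refine Finset.sum_congr rfl fun i _ => ?_
      rw [Pi.add_apply, pval_add]; ring)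
    (fun t u P => by
      simp_rw [cellDof, vol_restrict_hull]
      rw [smul_eq_mul, ← integral_const_mul]
      refine integral_congr_ae (Filter.Eventually.of_forall fun x => ?_)
      dsimp only
      rw [Finset.mul_sum]
      refine Finset.sum_congr rfl fun i _ => ?_
      rw [Pi.smul_apply, pval_smul]; ring)

lemma cellDofL_apply (K : T.Cell) (u : T.L2Vec) (P : Fin n → MvPolynomial (Fin n) ℝ) :
    T.cellDofL K u P = T.cellDof u K P := rfl

namespace Orientation

variable (o : T.Orientation)

lemma exists_opposite (e : T.IntFacet) : ∃ b : (o.K₁ e).1, e.1 = (o.K₁ e).1.erase b :=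
  T.exists_opposite _ (o.sub₁ e) e.2.2.1

/-- `(u, q) ↦ ∫_e (u · n) q` as a bilinear map. -/
def fluxL {p : ℝ≥0∞} (hp : 2 < p) (e : T.IntFacet) :
    T.H0divLp p →ₗ[ℝ] MvPolynomial (Fin n) ℝ →ₗ[ℝ] ℝ :=
  LinearMap.mk₂ ℝ (fun u q => o.flux (u : T.L2Vec) e q)
    (fun u v q => by
      obtain ⟨b, hb⟩ := o.exists_opposite e
      simp only [flux]
      rw [hb]; exact facetIntegral_add_left _ b hp q u.2 v.2)
    (fun t u q => by
      obtain ⟨b, hb⟩ := o.exists_opposite e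
      simp only [flux]
      rw [hb]; exact facetIntegral_smul_left _ b t q u.2.1)
    (fun u q q' => by
      obtain ⟨b, hb⟩ := o.exists_opposite e
      simp only [flux]
      rw [hb]; exact facetIntegral_add_right _ b hp q q' u.2)
    (fun t u q => by
      obtain ⟨b, hb⟩ := o.exists_opposite e
      simp only [flux]
      rw [hb]; exact facetIntegral_smul_right _ b t q u)

lemma fluxL_apply {p : ℝ≥0∞} (hp : 2 < p) (e : T.IntFacet) (u : T.H0divLp p)
    (q : MvPolynomial (Fin n) ℝ) : o.fluxL hp e u q = o.flux (u : T.L2Vec) e q := rfl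

end Orientation

/-! ### The spaces of discontinuous piecewise polynomials -/

lemma EqPolyOn.unique {f : T.L2} {K : T.Cell} {p q : MvPolynomial (Fin n) ℝ}
    (hp : T.EqPolyOn f K p) (hq : T.EqPolyOn f K q) : p = q := by
  rw [← sub_eq_zero]
  refine eq_zero_of_pval_eq_zero isOpen_interior
    (interior_simplex_nonempty (β := T.cellBasis K)) ?_
  have hae : pval (p - q) =ᵐ[volume.restrict (interior (simplex (T.cellBasis K)))] fun _ => (0:ℝ) := by
    refine ae_restrict_of_ae_restrict_of_subset interior_subset ?_
    filter_upwards [(T.ae_vol_iff K).1 hp, (T.ae_vol_iff K).1 hq] with x h1 h2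
    rw [pval_sub, ← h1, ← h2, sub_self]
  exact Measure.eqOn_open_of_ae_eq hae isOpen_interior (continuous_pval _).continuousOn
    continuousOn_const

variable {r : ℕ}

lemma loc_mem (f : T.V r) (K : T.Cell) : T.loc f K ∈ polyLE n r := (f.2 K).choose_spec.1

lemma eqPolyOn_loc (f : T.V r) (K : T.Cell) : T.EqPolyOn f K (T.loc f K) := (f.2 K).choose_spec.2

lemma loc_eq {f : T.V r} {K : T.Cell} {q : MvPolynomial (Fin n) ℝ} (h : T.EqPolyOn f K q) :
    T.loc f K = q := (eqPolyOn_loc f K).unique h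

lemma loc_add (f g : T.V r) (K : T.Cell) : T.loc (f + g) K = T.loc f K + T.loc g K := by
  refine loc_eq ?_
  filter_upwards [Lp.coeFn_add (f : T.L2) g, eqPolyOn_loc f K, eqPolyOn_loc g K] with x hx h1 h2 hK
  rw [Submodule.coe_add, hx, Pi.add_apply, h1 hK, h2 hK, pval_add]

lemma loc_smul (c : ℝ) (f : T.V r) (K : T.Cell) : T.loc (c • f) K = c • T.loc f K := by
  refine loc_eq ?_
  filter_upwards [Lp.coeFn_smul c (f : T.L2), eqPolyOn_loc f K] with x hx h1 hK
  rw [Submodule.coe_smul, hx, Pi.smul_apply, h1 hK, pval_smul, smul_eq_mul]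

lemma loc_one (K : T.Cell) : T.loc (T.one r) K = 1 := by
  refine loc_eq ?_
  filter_upwards [Lp.coeFn_const (p := 2) (μ := T.vol) (1 : ℝ)] with x hx _
  rw [pval_one]
  exact hx

variable (T) in
/-- Restriction to an element as a linear map. -/
def locL (r : ℕ) (K : T.Cell) : T.V r →ₗ[ℝ] MvPolynomial (Fin n) ℝ where
  toFun f := T.loc f K
  map_add' f g := loc_add f g K
  map_smul' c f := loc_smul c f K

instance (d : ℤ) : FiniteDimensional ℝ (polyLE n d) := by
  have hfin : {m : Fin n →₀ ℕ | (m.degree : ℤ) ≤ d}.Finite := by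
    refine (Finsupp.finite_of_degree_le d.toNat).subset fun m hm => ?_
    have : (m.degree : ℤ) ≤ d := hm
    change m.degree ≤ d.toNat
    omega
  have := hfin.to_subtype
  exact Module.Finite.of_basis (basisRestrictSupport ℝ {m : Fin n →₀ ℕ | (m.degree : ℤ) ≤ d})

instance : FiniteDimensional ℝ (T.V r) := by
  let L : T.V r →ₗ[ℝ] (T.Cell → polyLE n r) :=
    LinearMap.pi fun K => (T.locL r K).codRestrict _ fun f => loc_mem f K
  refine FiniteDimensional.of_injective L fun f g h => Subtype.ext (Lp.ext ?_)
  have hK : ∀ K, T.loc f K = T.loc g K := fun K => congrArg Subtype.val (congrFun h K)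
  refine T.ae_vol_of_forall fun K => ?_
  filter_upwards [(T.ae_vol_iff K).1 (eqPolyOn_loc f K), (T.ae_vol_iff K).1 (eqPolyOn_loc g K)]
    with x h1 h2
  rw [h1, h2, hK]

variable (o : T.Orientation)

namespace Orientation

lemma form_eq (u : T.L2Vec) (f g : T.V r) : o.form u f g =
    (∑ K, T.cellDof u K (fun i => pderiv i (T.loc f K) * T.loc g K)) -
      ∑ e, o.flux u e (o.jump f e * o.avg g e) := by
  rw [form]
  congr 1
  refine Finset.sum_congr rfl fun K _ => ?_
  rw [cellDof]
  congr 1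
  funext x
  rw [Finset.sum_mul]
  refine Finset.sum_congr rfl fun i _ => ?_
  rw [pval_mul]; ring

/-- `f ↦ ⟦f⟧ · n` as a linear map. -/
def jumpL (r : ℕ) (e : T.IntFacet) : T.V r →ₗ[ℝ] MvPolynomial (Fin n) ℝ :=
  T.locL r (o.K₁ e) - T.locL r (o.K₂ e)

/-- `g ↦ {g}` as a linear map. -/
def avgL (r : ℕ) (e : T.IntFacet) : T.V r →ₗ[ℝ] MvPolynomial (Fin n) ℝ :=
  (1 / 2 : ℝ) • (T.locL r (o.K₁ e) + T.locL r (o.K₂ e))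

lemma jumpL_apply (f : T.V r) (e : T.IntFacet) : o.jumpL r e f = o.jump f e := rfl

lemma form_eq_fluxL {p : ℝ≥0∞} (hp : 2 < p) (u : T.H0divLp p) (f g : T.V r) :
    o.form (u : T.L2Vec) f g =
    (∑ K, T.cellDofL K u (fun i => pderiv i (T.locL r K f) * T.locL r K g)) -
      ∑ e, o.fluxL hp e u (o.jumpL r e f * o.avgL r e g) := o.form_eq u f g

/-- The form defining `A_u` as a trilinear map. -/
def formL {p : ℝ≥0∞} (hp : 2 < p) (r : ℕ) :
    T.H0divLp p →ₗ[ℝ] T.V r →ₗ[ℝ] T.V r →ₗ[ℝ] ℝ where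
  toFun u := LinearMap.mk₂ ℝ (fun f g => o.form (u : T.L2Vec) f g)
    (fun f f' g => by
      have h : ∀ K, (fun i => pderiv i (T.locL r K (f + f')) * T.locL r K g) =
          (fun i => pderiv i (T.locL r K f) * T.locL r K g) +
          fun i => pderiv i (T.locL r K f') * T.locL r K g := fun K => by
        funext i; simp only [map_add, add_mul, Pi.add_apply]
      simp_rw [o.form_eq_fluxL hp, h, map_add, add_mul, map_add, Finset.sum_add_distrib]
      ring)
    (fun c f g => by
      have h : ∀ K, (fun i => pderiv i (T.locL r K (c • f)) * T.locL r K g) =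
          c • (fun i => pderiv i (T.locL r K f) * T.locL r K g) := fun K => by
        funext i; simp only [map_smul, Derivation.map_smul, smul_mul_assoc, Pi.smul_apply]
      simp_rw [o.form_eq_fluxL hp, h, map_smul, smul_mul_assoc, map_smul, ← Finset.smul_sum,
        smul_sub])
    (fun f g g' => by
      have h : ∀ K, (fun i => pderiv i (T.locL r K f) * T.locL r K (g + g')) =
          (fun i => pderiv i (T.locL r K f) * T.locL r K g) +
          fun i => pderiv i (T.locL r K f) * T.locL r K g' := fun K => by
        funext i; simp only [map_add, mul_add, Pi.add_apply]
      simp_rw [o.form_eq_fluxL hp, h, map_add, mul_add, map_add, Finset.sum_add_distrib]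
      ring)
    (fun c f g => by
      have h : ∀ K, (fun i => pderiv i (T.locL r K f) * T.locL r K (c • g)) =
          c • (fun i => pderiv i (T.locL r K f) * T.locL r K g) := fun K => by
        funext i; simp only [map_smul, mul_smul_comm, Pi.smul_apply]
      simp_rw [o.form_eq_fluxL hp, h, map_smul, mul_smul_comm, map_smul, ← Finset.smul_sum,
        smul_sub])
  map_add' u v := by
    ext f g
    change o.form ((u + v : T.H0divLp p) : T.L2Vec) f g = o.form u f g + o.form v f g
    simp_rw [o.form_eq_fluxL hp]
    simp only [Submodule.coe_add, map_add, LinearMap.add_apply, Finset.sum_add_distrib]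
    ring
  map_smul' c u := by
    ext f g
    change o.form ((c • u : T.H0divLp p) : T.L2Vec) f g = c • o.form u f g
    simp_rw [o.form_eq_fluxL hp]
    simp only [Submodule.coe_smul, map_smul, LinearMap.smul_apply, ← Finset.smul_sum, smul_sub]

lemma formL_apply {p : ℝ≥0∞} (hp : 2 < p) (u : T.H0divLp p) (f g : T.V r) :
    o.formL hp r u f g = o.form (u : T.L2Vec) f g := rfl

/-- Riesz representation of `g ↦ form u f g` in the finite-dimensional space `V_h^r`. -/
lemma isDerivation_derivation {p : ℝ≥0∞} (hp : 2 < p) {u : T.L2Vec} (hu : u ∈ T.H0divLp p) :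
    o.IsDerivation u (o.derivation r u) := by
  have hex : ∃ A : Module.End ℝ (T.V r), o.IsDerivation u A := by
    have : CompleteSpace (T.V r) := FiniteDimensional.complete ℝ _
    let B := o.formL hp r ⟨u, hu⟩
    let A : Module.End ℝ (T.V r) :=
      { toFun := fun f => (InnerProductSpace.toDual ℝ (T.V r)).symm
          (LinearMap.toContinuousLinearMap (B f))
        map_add' := fun f g => by rw [map_add, map_add, map_add]
        map_smul' := fun c f => by rw [map_smul, map_smul]; simp }
    refine ⟨A, fun f g => ?_⟩
    exact InnerProductSpace.toDual_symm_apply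
  rw [derivation, dif_pos hex]
  exact hex.choose_spec

lemma IsDerivation.unique {u : T.L2Vec} {A B : Module.End ℝ (T.V r)} (hA : o.IsDerivation u A)
    (hB : o.IsDerivation u B) : A = B := by
  refine LinearMap.ext fun f => ?_
  refine ext_inner_right ℝ fun g => ?_
  rw [hA f g, hB f g]

/-- `u ↦ A_u` as a linear map. -/
def derivationL {p : ℝ≥0∞} (hp : 2 < p) (r : ℕ) : T.H0divLp p →ₗ[ℝ] Module.End ℝ (T.V r) where
  toFun u := o.derivation r u
  map_add' u v := by
    refine IsDerivation.unique o (o.isDerivation_derivation hp (u + v).2) fun f g => ?_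
    rw [LinearMap.add_apply, inner_add_left, o.isDerivation_derivation hp u.2 f g,
      o.isDerivation_derivation hp v.2 f g]
    simp only [← o.formL_apply hp, map_add, LinearMap.add_apply]
  map_smul' c u := by
    refine IsDerivation.unique o (o.isDerivation_derivation hp (c • u).2) fun f g => ?_
    rw [RingHom.id_apply, LinearMap.smul_apply, real_inner_smul_left,
      o.isDerivation_derivation hp u.2 f g]
    simp only [← o.formL_apply hp, map_smul, LinearMap.smul_apply, smul_eq_mul]

/-- The constant function has neither gradient nor jumps. -/
lemma derivation_mem_𝔤 {p : ℝ≥0∞} (hp : 2 < p) {u : T.L2Vec} (hu : u ∈ T.H0divLp p) :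
    o.derivation r u ∈ T.𝔤 r := by
  change o.derivation r u (T.one r) = 0
  refine ext_inner_right ℝ fun g => ?_
  rw [o.isDerivation_derivation hp hu, inner_zero_left, form_eq]
  have h1 : ∀ e, o.jump (T.one r) e = 0 := fun e => by
    rw [jump, loc_one, loc_one, sub_self]
  have h2 : ∀ e, o.flux u e 0 = 0 := fun e => by
    rw [← o.fluxL_apply hp e ⟨u, hu⟩, map_zero]
  simp_rw [h1, zero_mul, h2, loc_one, pderiv_one, zero_mul]
  have h3 : ∀ K, T.cellDof u K (fun _ => 0) = 0 := fun K => by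
    have := (T.cellDofL K u).map_zero
    rwa [cellDofL_apply] at this
  simp [h3]

end Orientation

end Triangulation

end DiscreteFlow

namespace DiscreteFlow

/-! ### Green's formula for rough fields and functions vanishing at the boundary. -/

section Cutoff

variable {n : ℕ} {ι : Type*} [Fintype ι] [DecidableEq ι] {β : AffineBasis ι ℝ (E n)}

lemma exists_bound_deriv_smoothTransition : ∃ M, 0 ≤ M ∧ ∀ t, |deriv Real.smoothTransition t| ≤ M := by
  have hc : Continuous (deriv Real.smoothTransition) :=
    (Real.smoothTransition.contDiff (n := 1)).continuous_deriv le_rfl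
  obtain ⟨M, hM⟩ := (isCompact_Icc (a := (0:ℝ)) (b := 1)).exists_bound_of_continuousOn hc.continuousOn
  have h0M : 0 ≤ M := (norm_nonneg _).trans (hM 0 (by simp))
  refine ⟨M, h0M, fun t => ?_⟩
  by_cases ht : t ∈ Set.Icc (0:ℝ) 1
  · exact hM t ht
  · have : deriv Real.smoothTransition t = 0 := by
      rcases lt_or_ge t 0 with h | h
      · have : Real.smoothTransition =ᶠ[nhds t] fun _ => 0 := by
          filter_upwards [Iio_mem_nhds h] with s hs
          exact Real.smoothTransition.zero_of_nonpos (le_of_lt hs)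
        rw [this.deriv_eq, deriv_const]
      · have h1 : 1 < t := by
          by_contra h'
          exact ht ⟨h, not_lt.1 h'⟩
        have : Real.smoothTransition =ᶠ[nhds t] fun _ => 1 := by
          filter_upwards [Ioi_mem_nhds h1] with s hs
          exact Real.smoothTransition.one_of_one_le (le_of_lt hs)
        rw [this.deriv_eq, deriv_const]
    rw [this, abs_zero]
    exact h0M

lemma deriv_smoothTransition_of_one_lt {t : ℝ} (h1 : 1 < t) : deriv Real.smoothTransition t = 0 := by
  have : Real.smoothTransition =ᶠ[nhds t] fun _ => 1 := by
    filter_upwards [Ioi_mem_nhds h1] with s hs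
    exact Real.smoothTransition.one_of_one_le (le_of_lt hs)
  rw [this.deriv_eq, deriv_const]

variable (β) in
/-- The product of the barycentric coordinates. -/
def coordProd (x : E n) : ℝ := ∏ i, β.coord i x

omit [DecidableEq ι] in
lemma contDiff_coordProd {m : WithTop ℕ∞} : ContDiff ℝ m (coordProd β) :=
  contDiff_prod fun i _ => contDiff_coord β i

/-- Differentiating the product removes one factor `λ_i`, and the bound on `w` puts it back. This
compensates the growth of the gradient of the cutoff. -/
lemma norm_smul_fderiv_coordProd_le {x : E n} (hx : x ∈ simplex β) {w C : ℝ}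
    (hw : ∀ i, |w| ≤ C * β.coord i x) :
    ‖w • fderiv ℝ (coordProd β) x‖ ≤ C * coordProd β x * ∑ i, ‖dcoord β i‖ := by
  have h1 : fderiv ℝ (coordProd β) x =
      ∑ i, (∏ j ∈ Finset.univ.erase i, β.coord j x) • dcoord β i := by
    have := fderiv_finsetProd (𝕜 := ℝ) (u := Finset.univ) (g := fun i x => β.coord i x) (x := x)
      (fun i _ => (hasFDerivAt_coord β i x).differentiableAt)
    refine this.trans (Finset.sum_congr rfl fun i _ => ?_)
    rw [fderiv_coord]
  rw [h1, Finset.smul_sum, Finset.mul_sum]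
  refine (norm_sum_le _ _).trans (Finset.sum_le_sum fun i _ => ?_)
  rw [norm_smul, norm_smul, ← mul_assoc]
  refine mul_le_mul_of_nonneg_right ?_ (norm_nonneg _)
  have hnn : 0 ≤ ∏ j ∈ Finset.univ.erase i, β.coord j x :=
    Finset.prod_nonneg fun j _ => (mem_simplex β).1 hx j
  rw [Real.norm_of_nonneg hnn, Real.norm_eq_abs, coordProd,
    ← Finset.mul_prod_erase Finset.univ _ (Finset.mem_univ i), ← mul_assoc]
  exact mul_le_mul_of_nonneg_right (hw i) hnn

variable (β) in
/-- The function `w` cut off near the boundary of the simplex. -/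
def cutoff (w : E n → ℝ) (k : ℕ) : E n → ℝ :=
  (interior (simplex β)).indicator fun x => Real.smoothTransition (k * coordProd β x - 1) * w x

omit [DecidableEq ι] in
lemma support_cutoff_subset (w : E n → ℝ) (k : ℕ) :
    Function.support (cutoff β w k) ⊆ simplex β ∩ {x | 1 ≤ k * coordProd β x} := by
  intro x hx
  have hxi : x ∈ interior (simplex β) := by
    by_contra h
    exact hx (Set.indicator_of_notMem h _)
  refine ⟨interior_subset hxi, ?_⟩
  by_contra h
  apply hx
  rw [cutoff, Set.indicator_of_mem hxi, Real.smoothTransition.zero_of_nonpos, zero_mul]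
  have : ¬(1 ≤ k * coordProd β x) := h
  linarith

omit [DecidableEq ι] in
lemma isCompact_cutoff_set (k : ℕ) : IsCompact (simplex β ∩ {x | 1 ≤ k * coordProd β x}) := by
  refine (isCompact_simplex β).inter_right (isClosed_le continuous_const ?_)
  exact continuous_const.mul (contDiff_coordProd (m := 0)).continuous

omit [DecidableEq ι] in
lemma cutoff_set_subset (k : ℕ) :
    simplex β ∩ {x | 1 ≤ k * coordProd β x} ⊆ interior (simplex β) := by
  rintro x ⟨hx, h⟩
  rw [mem_interior_simplex]
  intro i
  refine lt_of_le_of_ne ((mem_simplex β).1 hx i) fun h0 => ?_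
  have : coordProd β x = 0 := Finset.prod_eq_zero (Finset.mem_univ i) h0.symm
  have h' : 1 ≤ k * coordProd β x := h
  rw [this, mul_zero] at h'
  linarith

omit [DecidableEq ι] in
lemma tsupport_cutoff_subset (w : E n → ℝ) (k : ℕ) :
    tsupport (cutoff β w k) ⊆ simplex β ∩ {x | 1 ≤ k * coordProd β x} :=
  closure_minimal (support_cutoff_subset w k) (isCompact_cutoff_set k).isClosed

omit [DecidableEq ι] in
lemma contDiff_cutoff {w : E n → ℝ} (hw : ∀ x ∈ interior (simplex β), ContDiffAt ℝ ∞ w x) (k : ℕ) :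
    ContDiff ℝ ∞ (cutoff β w k) := by
  rw [contDiff_iff_contDiffAt]
  intro x
  by_cases hx : x ∈ interior (simplex β)
  · have h1 : ContDiffAt ℝ ∞ (fun x => Real.smoothTransition (k * coordProd β x - 1) * w x) x := by
      refine ContDiffAt.mul ?_ (hw x hx)
      refine Real.smoothTransition.contDiffAt.comp x ?_
      exact (contDiffAt_const.mul contDiff_coordProd.contDiffAt).sub contDiffAt_const
    refine h1.congr_of_eventuallyEq ?_
    filter_upwards [isOpen_interior.mem_nhds hx] with y hy
    exact Set.indicator_of_mem hy _
  · have h1 : cutoff β w k =ᶠ[nhds x] fun _ => 0 := by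
      have hx' : x ∈ (tsupport (cutoff β w k))ᶜ := fun h =>
        hx (cutoff_set_subset k (tsupport_cutoff_subset w k h))
      filter_upwards [(isClosed_tsupport _).isOpen_compl.mem_nhds hx'] with y hy
      exact image_eq_zero_of_notMem_tsupport hy
    exact contDiffAt_const.congr_of_eventuallyEq h1

/-- Green's formula for a Lipschitz function vanishing on the boundary of the simplex and a field
with integrable weak divergence. -/
lemma integral_eq_zero_of_le_coord {u : E n → E n} {d : E n → ℝ}
    (hu : IntegrableOn u (simplex β)) (hd : IntegrableOn d (simplex β))
    (hud : ∀ φ : E n → ℝ, ContDiff ℝ ∞ φ → HasCompactSupport φ → tsupport φ ⊆ interior (simplex β) →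
      ∫ x in simplex β, (fderiv ℝ φ x (u x) + d x * φ x) = 0)
    {w : E n → ℝ} (hw : ∀ x ∈ interior (simplex β), ContDiffAt ℝ ∞ w x) {C C' : ℝ}
    (hC : ∀ x ∈ interior (simplex β), ∀ i, |w x| ≤ C * β.coord i x)
    (hC' : ∀ x ∈ interior (simplex β), ‖fderiv ℝ w x‖ ≤ C') :
    ∫ x in simplex β, (fderiv ℝ w x (u x) + d x * w x) = 0 := by
  obtain ⟨M, hM0, hM⟩ := exists_bound_deriv_smoothTransition
  obtain ⟨x₀, hx₀⟩ := interior_simplex_nonempty (β := β)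
  have hn : Nonempty ι := β.nonempty
  obtain ⟨i₀⟩ := hn
  have hC0 : 0 ≤ C := by
    have h1 := (abs_nonneg _).trans (hC x₀ hx₀ i₀)
    have h2 := (mem_interior_simplex β).1 hx₀ i₀
    exact nonneg_of_mul_nonneg_left h1 h2
  have hzero : ∀ k : ℕ, ∫ x in simplex β,
      (fderiv ℝ (cutoff β w k) x (u x) + d x * cutoff β w k x) = 0 := fun k =>
    hud _ (contDiff_cutoff hw k)
      ((isCompact_cutoff_set k).of_isClosed_subset (isClosed_tsupport _) (tsupport_cutoff_subset w k))
      ((tsupport_cutoff_subset w k).trans (cutoff_set_subset k))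
  set S : ℝ := ∑ i, ‖dcoord β i‖ with hS
  have hS0 : 0 ≤ S := Finset.sum_nonneg fun _ _ => norm_nonneg _
  have hlim : Filter.Tendsto (fun k : ℕ => ∫ x in simplex β,
      (fderiv ℝ (cutoff β w k) x (u x) + d x * cutoff β w k x)) Filter.atTop
      (nhds (∫ x in simplex β, (fderiv ℝ w x (u x) + d x * w x))) := by
    refine tendsto_integral_of_dominated_convergence
      -- A bound uniform in `k`: `C'` comes from the gradient of `w`, and `2 C S M` from the
      -- gradient of the cutoff multiplied by `w`.
      (fun x => (C' + 2 * C * S * M) * ‖u x‖ + ‖d x‖ * C) (fun k => ?_) ?_ (fun k => ?_) ?_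
    · refine AEStronglyMeasurable.add ?_ ?_
      · exact (ContinuousLinearMap.apply ℝ ℝ).aestronglyMeasurable_comp₂ hu.aestronglyMeasurable
          ((contDiff_cutoff hw k).continuous_fderiv (by simp)).aestronglyMeasurable
      · exact hd.aestronglyMeasurable.mul (contDiff_cutoff hw k).continuous.aestronglyMeasurable
    · exact (hu.norm.const_mul _).add (hd.norm.mul_const _)
    · filter_upwards [ae_simplex_interior (β := β)] with x hx
      have hxs := interior_subset hx
      have hwx : |w x| ≤ C := by
        refine (hC x hx i₀).trans ?_
        calc C * β.coord i₀ x ≤ C * 1 := mul_le_mul_of_nonneg_left (coord_le_one β hxs i₀) hC0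
          _ = C := mul_one C
      have hm0 : 0 ≤ coordProd β x := Finset.prod_nonneg fun j _ => (mem_simplex β).1 hxs j
      have hcut : ‖cutoff β w k x‖ ≤ C := by
        rw [cutoff, Set.indicator_of_mem hx, norm_mul,
          Real.norm_of_nonneg (Real.smoothTransition.nonneg _)]
        calc _ ≤ 1 * C := mul_le_mul (Real.smoothTransition.le_one _) hwx (abs_nonneg _) zero_le_one
          _ = C := one_mul C
      have hfd : fderiv ℝ (cutoff β w k) x =
          Real.smoothTransition (k * coordProd β x - 1) • fderiv ℝ w x +
          w x • (deriv Real.smoothTransition (k * coordProd β x - 1) • ((k:ℝ) • fderiv ℝ (coordProd β) x)) := by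
        have he : cutoff β w k =ᶠ[nhds x]
            fun x => Real.smoothTransition (k * coordProd β x - 1) * w x := by
          filter_upwards [isOpen_interior.mem_nhds hx] with y hy
          exact Set.indicator_of_mem hy _
        rw [he.fderiv_eq]
        have h1 : HasFDerivAt (fun x => (k:ℝ) * coordProd β x - 1) ((k:ℝ) • fderiv ℝ (coordProd β) x) x :=
          (((contDiff_coordProd (β := β) (m := 1)).differentiable (by simp) x).hasFDerivAt.const_mul
            (k:ℝ)).sub_const 1
        have h2 : HasDerivAt Real.smoothTransition
            (deriv Real.smoothTransition (k * coordProd β x - 1)) (k * coordProd β x - 1) :=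
          ((Real.smoothTransition.contDiff (n := 1)).differentiable (by simp) _).hasDerivAt
        have h3 := (h2.comp_hasFDerivAt x h1).mul
          ((hw x hx).differentiableAt (by simp)).hasFDerivAt
        exact h3.fderiv
      have hfdn : ‖fderiv ℝ (cutoff β w k) x‖ ≤ C' + 2 * C * S * M := by
        rw [hfd]
        refine (norm_add_le _ _).trans (add_le_add ?_ ?_)
        · rw [norm_smul, Real.norm_of_nonneg (Real.smoothTransition.nonneg _)]
          calc _ ≤ 1 * C' := mul_le_mul (Real.smoothTransition.le_one _) (hC' x hx) (norm_nonneg _)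
                zero_le_one
            _ = C' := one_mul _
        -- The cutoff varies only where `k ∏ λ_i ≤ 2`; there the factor `k` from the chain rule is
        -- absorbed by the product.
        · by_cases hk : 1 < k * coordProd β x - 1
          · rw [deriv_smoothTransition_of_one_lt hk, zero_smul, smul_zero, norm_zero]
            positivity
          · have h4 : k * coordProd β x ≤ 2 := by linarith
            have h5 := norm_smul_fderiv_coordProd_le hxs (hC x hx)
            have h6 : w x • (deriv Real.smoothTransition (k * coordProd β x - 1) •
                ((k:ℝ) • fderiv ℝ (coordProd β) x)) =
                ((k:ℝ) * deriv Real.smoothTransition (k * coordProd β x - 1)) •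
                (w x • fderiv ℝ (coordProd β) x) := by
              rw [smul_smul, smul_smul, smul_smul]
              congr 1; ring
            rw [h6, norm_smul, norm_mul, Real.norm_natCast]
            calc (k:ℝ) * ‖deriv Real.smoothTransition (k * coordProd β x - 1)‖ *
                  ‖w x • fderiv ℝ (coordProd β) x‖
                ≤ k * M * (C * coordProd β x * S) := by
                  refine mul_le_mul ?_ h5 (norm_nonneg _) (by positivity)
                  exact mul_le_mul_of_nonneg_left (hM _) (by positivity)
              _ = (k * coordProd β x) * (C * S * M) := by ring
              _ ≤ 2 * (C * S * M) := mul_le_mul_of_nonneg_right h4 (by positivity)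
              _ = 2 * C * S * M := by ring
      refine (norm_add_le _ _).trans (add_le_add ?_ ?_)
      · exact ((fderiv ℝ (cutoff β w k) x).le_opNorm _).trans
          (mul_le_mul_of_nonneg_right hfdn (norm_nonneg _))
      · rw [norm_mul]
        exact mul_le_mul_of_nonneg_left hcut (norm_nonneg _)
    · filter_upwards [ae_simplex_interior (β := β)] with x hx
      have hm : 0 < coordProd β x := Finset.prod_pos fun j _ => (mem_interior_simplex β).1 hx j
      refine tendsto_const_nhds.congr' ?_
      obtain ⟨N, hN⟩ := exists_nat_gt (2 / coordProd β x)
      filter_upwards [Filter.eventually_ge_atTop N] with k hk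
      have hkm : 2 < k * coordProd β x := by
        have : (N:ℝ) ≤ k := by exact_mod_cast hk
        have h2 := (div_lt_iff₀ hm).1 (hN.trans_le this)
        exact h2
      have he : cutoff β w k =ᶠ[nhds x] w := by
        have ho : IsOpen {y | 2 < k * coordProd β y} :=
          isOpen_lt continuous_const (continuous_const.mul (contDiff_coordProd (m := 0)).continuous)
        filter_upwards [isOpen_interior.mem_nhds hx, ho.mem_nhds hkm] with y hy hy2
        have hy2' : 2 < k * coordProd β y := hy2
        rw [cutoff, Set.indicator_of_mem hy, Real.smoothTransition.one_of_one_le (by linarith),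
          one_mul]
      rw [he.fderiv_eq, he.eq_of_nhds]
  simp_rw [hzero] at hlim
  exact (tendsto_nhds_unique hlim tendsto_const_nhds)

end Cutoff

/-! ### Independence of the facet integral from the polynomial extension. -/

namespace Triangulation

open scoped Classical

variable {n : ℕ} {T : Triangulation n}

lemma fderiv_apply_eq_zero_of_notMem_tsupport {φ : E n → ℝ} {x : E n} (hx : x ∉ tsupport φ) (v : E n) :
    fderiv ℝ φ x v = 0 := by
  have h1 : φ =ᶠ[nhds x] fun _ => 0 := notMem_tsupport_iff_eventuallyEq.1 hx
  rw [h1.fderiv_eq, fderiv_fun_const]; rfl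

/-- The definition of the weak divergence, for test functions supported in an element. -/
lemma IsWeakDiv.integral_simplex {u : T.L2Vec} {d : T.L2} (h : T.IsWeakDiv u d) (K : T.Cell)
    {φ : E n → ℝ} (h1 : ContDiff ℝ ∞ φ) (h2 : HasCompactSupport φ)
    (h3 : tsupport φ ⊆ interior (simplex (T.cellBasis K))) :
    ∫ x in simplex (T.cellBasis K), (fderiv ℝ φ x (u x) + d x * φ x) = 0 := by
  have h3' : tsupport φ ⊆ interior (T.hull K) := by rwa [hull_eq]
  have := h φ h1 h2 (h3'.trans (T.interior_hull_subset_dom K))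
  rw [← vol_restrict_hull, setIntegral_eq_integral_of_forall_compl_eq_zero, this]
  intro x hx
  have hx' : x ∉ tsupport φ := fun hxt => hx (interior_subset (h3' hxt))
  rw [fderiv_apply_eq_zero_of_notMem_tsupport hx', image_eq_zero_of_notMem_tsupport hx', mul_zero,
    add_zero]

/-- The facet integral of a polynomial vanishing on the facet is zero. -/
lemma facetIntegral_coordPoly_mul (K : T.Cell) (b : K.1) {u : T.L2Vec} (hu : u ∈ T.H0div)
    (q : MvPolynomial (Fin n) ℝ) :
    T.facetIntegral u K (K.1.erase b) (coordPoly (T.cellBasis K) b * q) = 0 := by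
  rw [facetIntegral_eq]
  set β := T.cellBasis K with hβ
  have hui : Integrable (fun x => u x) T.vol := (Lp.memLp u).integrable (by norm_num)
  have hdi : Integrable (fun x => T.weakDiv u x) T.vol := (Lp.memLp _).integrable (by norm_num)
  obtain ⟨C, hC⟩ := (isCompact_simplex β).exists_bound_of_continuousOn
    (continuous_pval q).continuousOn
  have hψ : ContDiff ℝ 1 (pval (coordPoly β b * q)) := contDiff_pval _
  obtain ⟨C', hC'⟩ := (isCompact_simplex β).exists_bound_of_continuousOn
    (hψ.continuous_fderiv (by simp)).continuousOn
  -- The factor `λ_b` removes the singularity of the lift: `λ_b / (λ_a + λ_b) ≤ 1` bounds the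
  -- gradient, and `λ_b` times the lift is at most every `λ_i`, so the function vanishes linearly on
  -- the whole boundary.
  refine integral_eq_zero_of_le_coord (integrableOn_simplex T hui K) (integrableOn_simplex T hdi K)
    (fun φ h1 h2 h3 => (isWeakDiv_weakDiv hu).integral_simplex K h1 h2 h3)
    (C := C) (C' := C * (∑ a ∈ Finset.univ.erase b, (‖dcoord β a‖ + ‖dcoord β b‖)) + C')
    (fun x hx => (contDiff_pval _).contDiffAt.mul (contDiffAt_lift (generic_of_mem_interior hx)))
    (fun x hx i => ?_) (fun x hx => ?_)
  · have hxs := interior_subset hx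
    have hpos := (mem_interior_simplex β).1 hx
    have hl := lift_mem hxs b
    have hbl : β.coord b x * lift β b x ≤ β.coord i x := by
      by_cases hib : i = b
      · rw [hib]
        calc _ ≤ β.coord b x * 1 := mul_le_mul_of_nonneg_left hl.2 (hpos b).le
          _ = _ := mul_one _
      · have h1 : lift β b x ≤ β.coord i x / (β.coord i x + β.coord b x) := by
          rw [lift, ← Finset.mul_prod_erase _ _ (Finset.mem_erase.2 ⟨hib, Finset.mem_univ i⟩)]
          refine mul_le_of_le_one_right (ratio_mem hxs i b).1 ?_
          exact Finset.prod_le_one (fun c _ => (ratio_mem hxs c b).1) fun c _ => (ratio_mem hxs c b).2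
        have hi := hpos i
        have hb := hpos b
        calc _ ≤ β.coord b x * (β.coord i x / (β.coord i x + β.coord b x)) :=
              mul_le_mul_of_nonneg_left h1 hb.le
          _ = β.coord i x * (β.coord b x / (β.coord i x + β.coord b x)) := by ring
          _ ≤ β.coord i x * 1 := by
              refine mul_le_mul_of_nonneg_left ?_ hi.le
              exact div_le_one_of_le₀ (by linarith) (by linarith)
          _ = _ := mul_one _
    rw [wLift, pval_mul, pval_coordPoly, ← hβ]
    have h2 : β.coord b x * pval q x * lift β b x = pval q x * (β.coord b x * lift β b x) := by ring
    rw [h2, abs_mul, abs_of_nonneg (mul_nonneg (hpos b).le hl.1)]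
    exact mul_le_mul (hC x hxs) hbl (mul_nonneg (hpos b).le hl.1) ((norm_nonneg _).trans (hC x hxs))
  · have hxs := interior_subset hx
    have hg := generic_of_mem_interior hx
    have hpos := (mem_interior_simplex β).1 hx
    have hl := lift_mem hxs b
    have hf : fderiv ℝ (wLift K b (coordPoly β b * q)) x =
        pval (coordPoly β b * q) x • fderiv ℝ (lift β b) x +
        lift β b x • fderiv ℝ (pval (coordPoly β b * q)) x :=
      fderiv_fun_mul (hψ.differentiable (by simp) x)
        ((contDiffAt_lift hg (m := 1)).differentiableAt (by simp))
    rw [hf]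
    refine (norm_add_le _ _).trans (add_le_add ?_ ?_)
    · rw [norm_smul, pval_mul, pval_coordPoly, norm_mul, Real.norm_of_nonneg (hpos b).le]
      have h1 : β.coord b x * ‖fderiv ℝ (lift β b) x‖ ≤
          ∑ a ∈ Finset.univ.erase b, (‖dcoord β a‖ + ‖dcoord β b‖) := by
        refine (mul_le_mul_of_nonneg_left (norm_fderiv_lift_le hg b) (hpos b).le).trans ?_
        rw [Finset.mul_sum]
        refine Finset.sum_le_sum fun a _ => ?_
        have ha := hpos a
        have hb := hpos b
        calc β.coord b x * ((‖dcoord β a‖ + ‖dcoord β b‖) * (β.coord a x + β.coord b x)⁻¹)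
            = (‖dcoord β a‖ + ‖dcoord β b‖) * (β.coord b x / (β.coord a x + β.coord b x)) := by ring
          _ ≤ (‖dcoord β a‖ + ‖dcoord β b‖) * 1 := by
              refine mul_le_mul_of_nonneg_left ?_ (by positivity)
              exact div_le_one_of_le₀ (by linarith) (by linarith)
          _ = _ := mul_one _
      calc β.coord b x * ‖pval q x‖ * ‖fderiv ℝ (lift β b) x‖
          = ‖pval q x‖ * (β.coord b x * ‖fderiv ℝ (lift β b) x‖) := by ring
        _ ≤ _ := mul_le_mul (hC x hxs) h1 (mul_nonneg (hpos b).le (norm_nonneg _))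
            ((norm_nonneg _).trans (hC x hxs))
    · rw [norm_smul, Real.norm_of_nonneg hl.1]
      calc _ ≤ 1 * C' := mul_le_mul hl.2 (hC' x hxs) (norm_nonneg _) zero_le_one
        _ = C' := one_mul _

/-- The facet integral depends only on the values of the polynomial on the facet. -/
lemma facetIntegral_congr [NeZero n] (K : T.Cell) (b : K.1) {p : ℝ≥0∞} (hp : 2 < p) {u : T.L2Vec}
    (hu : u ∈ T.H0divLp p) {q q' : MvPolynomial (Fin n) ℝ}
    (h : ∀ x ∈ openFacet (T.cellBasis K) b, pval q x = pval q' x) :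
    T.facetIntegral u K (K.1.erase b) q = T.facetIntegral u K (K.1.erase b) q' := by
  -- Any degree bound would do; only divisibility by `λ_b` is needed.
  have hd : q - q' ∈ polyLE n ((q - q').totalDegree : ℤ) := by
    rw [mem_polyLE]
    intro m hm
    have := le_totalDegree hm
    exact_mod_cast this
  obtain ⟨w, -, hw⟩ := exists_eq_coordPoly_mul b hd (fun x hx => by
    rw [pval_sub, h x hx, sub_self])
  have h1 : q = q' + coordPoly (T.cellBasis K) b * w := by rw [← hw]; ring
  rw [h1, facetIntegral_add_right K b hp _ _ hu, facetIntegral_coordPoly_mul K b hu.1, add_zero]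

namespace Orientation

lemma flux_congr [NeZero n] (o : T.Orientation) {p : ℝ≥0∞} (hp : 2 < p) {u : T.L2Vec}
    (hu : u ∈ T.H0divLp p) (e : T.IntFacet) {q q' : MvPolynomial (Fin n) ℝ}
    (h : restrictTo e.1 q = restrictTo e.1 q') : o.flux u e q = o.flux u e q' := by
  obtain ⟨b, hb⟩ := o.exists_opposite e
  rw [flux, flux, hb]
  refine facetIntegral_congr _ b hp hu fun x hx => ?_
  have hx' := T.openFacet_subset _ b hx
  rw [← hb] at hx'
  exact congrFun h ⟨x, hx'⟩

end Orientation

end Triangulation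

end DiscreteFlow

namespace DiscreteFlow

/-! ### Raviart-Thomas fields, bubbles and radial fields on single simplices. -/

section LocalRT

variable {n : ℕ} {ι : Type*} [Fintype ι] {β : AffineBasis ι ℝ (E n)}

lemma greenInt_sub {U : E n → E n} (hU : ContDiff ℝ 1 U) {w v : E n → ℝ} (hw : Nice β w)
    (hv : Nice β v) : greenInt β U (fun x => w x - v x) = greenInt β U w - greenInt β U v := by
  rw [greenInt, greenInt, greenInt, ← integral_sub (hw.integrable_green hU) (hv.integrable_green hU)]
  refine integral_congr_ae ?_
  filter_upwards [hw.ae_differentiableAt, hv.ae_differentiableAt] with x h1 h2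
  rw [fderiv_fun_sub h1 h2, sub_apply]
  ring

lemma divB_add {U V : E n → E n} (hU : ContDiff ℝ 1 U) (hV : ContDiff ℝ 1 V) (x : E n) :
    divB β (fun x => U x + V x) x = divB β U x + divB β V x := by
  simp_rw [divB]
  rw [← Finset.sum_add_distrib]
  refine Finset.sum_congr rfl fun i _ => ?_
  rw [fderiv_fun_add (hU.differentiable (by simp) x) (hV.differentiable (by simp) x), add_apply,
    map_add]

lemma divB_const_smul (c : ℝ) {U : E n → E n} (hU : ContDiff ℝ 1 U) (x : E n) :
    divB β (fun x => c • U x) x = c * divB β U x := by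
  simp_rw [divB]
  rw [Finset.mul_sum]
  refine Finset.sum_congr rfl fun i _ => ?_
  rw [fderiv_fun_const_smul (hU.differentiable (by simp) x), smul_apply, map_smul, smul_eq_mul]

lemma greenInt_add_field {U V : E n → E n} (hU : ContDiff ℝ 1 U) (hV : ContDiff ℝ 1 V) {w : E n → ℝ}
    (hw : Nice β w) :
    greenInt β (fun x => U x + V x) w = greenInt β U w + greenInt β V w := by
  rw [greenInt, greenInt, greenInt, ← integral_add (hw.integrable_green hU) (hw.integrable_green hV)]
  congr 1
  funext x
  rw [divB_add hU hV, map_add]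
  ring

lemma greenInt_const_smul (c : ℝ) {U : E n → E n} (hU : ContDiff ℝ 1 U) (w : E n → ℝ) :
    greenInt β (fun x => c • U x) w = c * greenInt β U w := by
  rw [greenInt, greenInt, ← integral_const_mul]
  congr 1
  funext x
  rw [divB_const_smul c hU, map_smul, smul_eq_mul]
  ring

lemma greenInt_zero_field (w : E n → ℝ) : greenInt β (fun _ => (0 : E n)) w = 0 := by
  have := greenInt_const_smul (β := β) 0 (U := fun _ => (0 : E n)) contDiff_const w
  simpa using this

/-- A scalar factor can be moved from the field to the test function. -/
lemma greenInt_smul_field {U : E n → E n} (hU : ContDiff ℝ 1 U) {s : E n → ℝ} (hs : ContDiff ℝ 1 s)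
    {w : E n → ℝ} (hw : Nice β w) :
    greenInt β (fun x => s x • U x) w = greenInt β U (fun x => s x * w x) := by
  rw [greenInt, greenInt]
  refine integral_congr_ae ?_
  filter_upwards [hw.ae_differentiableAt] with x hx
  have hsd := hs.differentiable (by simp) x
  have hUd := hU.differentiable (by simp) x
  have h1 : divB β (fun x => s x • U x) x = s x * divB β U x + fderiv ℝ s x (U x) := by
    simp_rw [divB]
    have h2 : ∀ i, dcoord β i (fderiv ℝ (fun x => s x • U x) x (β i)) =
        s x * dcoord β i (fderiv ℝ U x (β i)) + dcoord β i (U x) * fderiv ℝ s x (β i) := by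
      intro i
      rw [fderiv_fun_smul hsd hUd]
      simp [mul_comm]
    simp_rw [h2]
    rw [Finset.sum_add_distrib, Finset.mul_sum]
    congr 1
    conv_rhs => rw [← sum_dcoord_smul β (U x), map_sum]
    simp
  rw [h1, fderiv_fun_mul hsd hx]
  simp only [map_smul, add_apply, smul_apply, smul_eq_mul]
  ring

omit [Fintype ι] in
lemma dcoord_sub_vertex (i b : ι) (x : E n) (hib : i ≠ b) : dcoord β i (x - β b) = β.coord i x := by
  rw [dcoord_sub, β.coord_apply_ne hib, sub_zero]

omit [Fintype ι] in
lemma dcoord_sub_self (b : ι) (x : E n) : dcoord β b (x - β b) = β.coord b x - 1 := by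
  rw [dcoord_sub, β.coord_apply_eq]

lemma contDiff_sub_vertex (c : E n) {m : WithTop ℕ∞} : ContDiff ℝ m (fun x : E n => x - c) :=
  contDiff_id.sub contDiff_const

/-- If the flux of `U` through the facet opposite to `b` vanishes when weighted with `s ψ`, where `s`
is the normal component of `U` and `ψ ≥ 0`, then `s² ψ` vanishes on the facet. -/
lemma sq_mul_eq_zero_of_greenInt [Nontrivial ι] (b : ι) {U : E n → E n} (hU : ContDiff ℝ 1 U)
    {s ψ : E n → ℝ} (hs : ContDiff ℝ 1 s) (hψ : Nice β ψ) (hψ0 : ∀ x ∈ openFacet β b, 0 ≤ ψ x)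
    (hψz : ∀ i, i ≠ b → ∀ x ∈ openFacet β i, ψ x = 0)
    (hsU : ∀ x ∈ openFacet β b, dcoord β b (U x) = s x)
    (hz : greenInt β U (fun x => s x * ψ x) = 0) :
    ∀ x ∈ openFacet β b, s x * (s x * ψ x) = 0 := by
  -- On the facet `b` the radial field satisfies `dλ_b(x - β b) = -1`, so `U + s (x - β b)` has zero
  -- normal trace there, and `ψ` removes the other facets. Hence `U` may be exchanged for the radial
  -- field, whose density becomes the nonnegative `s² ψ`.
  have hV : ContDiff ℝ 1 (fun x : E n => s x • (x - β b)) := hs.smul (contDiff_sub_vertex _)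
  have hsψ : Nice β (fun x => s x * ψ x) := hψ.mul hs
  have h0 : greenInt β (fun x => U x + s x • (x - β b)) (fun x => s x * ψ x) = 0 := by
    refine greenInt_eq_zero (hU.add hV) hsψ fun i x hx => ?_
    by_cases hib : i = b
    · subst hib
      rw [map_add, map_smul, hsU x hx, dcoord_sub_self, hx.1, smul_eq_mul]
      ring
    · rw [hψz i hib x hx]; ring
  rw [greenInt_add_field hU hV hsψ, hz, zero_add,
    greenInt_smul_field (contDiff_sub_vertex _) hs hsψ] at h0
  refine eq_zero_of_greenInt_eq_zero b (hsψ.mul hs) (fun x hx => ?_) h0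
  rw [← mul_assoc]
  exact mul_nonneg (mul_self_nonneg _) (hψ0 x hx)

lemma openFacet_nonempty [Nontrivial ι] (b : ι) : (openFacet β b).Nonempty := by
  obtain ⟨a, hab⟩ := exists_ne b
  obtain ⟨x, hx⟩ := interior_simplex_nonempty (β := β)
  have hx' := (mem_interior_simplex β).1 hx
  exact ⟨_, line_end_mem hab (fun k _ _ => hx' k) (add_pos (hx' a) (hx' b))⟩

lemma dcoord_sum_smul [DecidableEq ι] {f : ι → ℝ} (hf : ∑ i, f i = 0) (j : ι) :
    dcoord β j (∑ i, f i • β i) = f j := by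
  have h1 : ∀ i, dcoord β j (β i) = (if j = i then 1 else 0) - β.coord j 0 := fun i => by
    have := coord_eq β j (β i)
    rw [β.coord_apply] at this
    linarith
  rw [map_sum]
  simp_rw [map_smul, h1, smul_eq_mul, mul_sub]
  rw [Finset.sum_sub_distrib, ← Finset.sum_mul, hf]
  simp

lemma eqOn_zero_of_integral_eq_zero {f : E n → ℝ} (hf : Continuous f)
    (h0 : ∀ x ∈ simplex β, 0 ≤ f x) (hz : ∫ x in simplex β, f x = 0) :
    ∀ x ∈ interior (simplex β), f x = 0 := by
  have hi : IntegrableOn f (simplex β) := hf.continuousOn.integrableOn_compact (isCompact_simplex β)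
  have h1 := (setIntegral_eq_zero_iff_of_nonneg_ae (by
    filter_upwards [ae_restrict_mem (measurableSet_simplex β)] with x hx using h0 x hx) hi).1 hz
  exact Measure.eqOn_open_of_ae_eq (ae_restrict_of_ae_restrict_of_subset interior_subset h1)
    isOpen_interior hf.continuousOn continuousOn_const

/-- The components of the Raviart-Thomas field `a + x b`. -/
def rtPoly (a : Fin n → MvPolynomial (Fin n) ℝ) (b : MvPolynomial (Fin n) ℝ) :
    Fin n → MvPolynomial (Fin n) ℝ := fun i => a i + X i * b

lemma fieldOf_rtPoly (a : Fin n → MvPolynomial (Fin n) ℝ) (b : MvPolynomial (Fin n) ℝ) (x : E n) :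
    fieldOf (rtPoly a b) x = fieldOf a x + pval b x • x := by
  ext i
  simp [fieldOf_apply, rtPoly, mul_comm]

variable (β) in
/-- A polynomial equal to the normal component of the Raviart-Thomas field `a + x b` on the facet
opposite to the vertex `i`. -/
def tracePoly (a : Fin n → MvPolynomial (Fin n) ℝ) (b : MvPolynomial (Fin n) ℝ) (i : ι) :
    MvPolynomial (Fin n) ℝ :=
  (∑ k, C (dcoord β i (EuclideanSpace.single k 1)) * a k) - C (β.coord i 0) * b

omit [Fintype ι] in
lemma tracePoly_mem {a : Fin n → MvPolynomial (Fin n) ℝ} {b : MvPolynomial (Fin n) ℝ} {d : ℤ}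
    (ha : a ∈ vecPolyLE n d) (hb : b ∈ polyLE n d) (i : ι) : tracePoly β a b i ∈ polyLE n d :=
  Submodule.sub_mem _ (Submodule.sum_mem _ fun k _ => C_mul_mem_polyLE _ (ha k trivial))
    (C_mul_mem_polyLE _ hb)

omit [Fintype ι] in
lemma dcoord_rtPoly (a : Fin n → MvPolynomial (Fin n) ℝ) (b : MvPolynomial (Fin n) ℝ) (i : ι)
    (x : E n) : dcoord β i (fieldOf (rtPoly a b) x) =
      pval (tracePoly β a b i) x + β.coord i x * pval b x := by
  rw [fieldOf_rtPoly, map_add, clm_fieldOf, map_smul, tracePoly, pval_sub, pval_mul, pval_C,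
    coord_eq β i x, smul_eq_mul]
  ring

/-- A Raviart-Thomas field with zero normal trace and zero moments against `P_{k-1}` vanishes. -/
lemma rtField_eq_zero [Nontrivial ι] {a : Fin n → MvPolynomial (Fin n) ℝ}
    {b : MvPolynomial (Fin n) ℝ} {d : ℤ} (ha : a ∈ vecPolyLE n d) (hb : b ∈ polyLE n d)
    (htr : ∀ i, ∀ x ∈ openFacet β i, dcoord β i (fieldOf (rtPoly a b) x) = 0)
    (hmom : ∀ P ∈ vecPolyLE n (d - 1),
      ∫ x in simplex β, ∑ k, fieldOf (rtPoly a b) x k * pval (P k) x = 0) :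
    ∀ x ∈ interior (simplex β), fieldOf (rtPoly a b) x = 0 := by
  -- A trace polynomial vanishing on its facet is divisible by `λ_i`, and therefore `dλ_i(U) = λ_i
  -- (v_i + b)`.
  have hs : ∀ i, ∃ w ∈ polyLE n (d - 1), tracePoly β a b i = coordPoly β i * w := fun i =>
    exists_eq_coordPoly_mul i (tracePoly_mem ha hb i) fun x hx => by
      have := htr i x hx
      rw [dcoord_rtPoly, hx.1] at this
      linarith
  choose v hv hsv using hs
  set U := fieldOf (rtPoly a b) with hU
  have hUi : ∀ i x, dcoord β i (U x) = β.coord i x * (pval (v i) x + pval b x) := fun i x => by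
    rw [hU, dcoord_rtPoly, hsv, pval_mul, pval_coordPoly]; ring
  -- The field `∑ v_i ∇λ_i` has the admissible degree `d - 1`, and `U · P = ∑ v_i dλ_i(U)`. Adding
  -- `b ∑ dλ_i(U) = 0` turns this into `∑ λ_i (v_i + b)²`.
  let P : Fin n → MvPolynomial (Fin n) ℝ := fun k =>
    ∑ i, C (dcoord β i (EuclideanSpace.single k 1)) * v i
  have hP : P ∈ vecPolyLE n (d - 1) := fun k _ =>
    Submodule.sum_mem _ fun i _ => C_mul_mem_polyLE _ (hv i)
  have hUP : ∀ x, ∑ k, U x k * pval (P k) x =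
      ∑ i, β.coord i x * (pval (v i) x + pval b x) ^ 2 := by
    intro x
    have h1 : ∑ k, U x k * pval (P k) x = ∑ i, pval (v i) x * dcoord β i (U x) := by
      simp_rw [P, pval_sum, pval_mul, pval_C, Finset.mul_sum]
      rw [Finset.sum_comm]
      refine Finset.sum_congr rfl fun i _ => ?_
      rw [← sum_apply_single (dcoord β i), Finset.mul_sum]
      refine Finset.sum_congr rfl fun k _ => ?_
      ring
    have h2 : ∑ i, pval b x * dcoord β i (U x) = 0 := by
      rw [← Finset.mul_sum, sum_dcoord, mul_zero]
    rw [h1, ← add_zero (∑ i, pval (v i) x * dcoord β i (U x)), ← h2, ← Finset.sum_add_distrib]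
    refine Finset.sum_congr rfl fun i _ => ?_
    rw [hUi]; ring
  have hz := hmom P hP
  simp_rw [hUP] at hz
  have hcont : Continuous fun x => ∑ i, β.coord i x * (pval (v i) x + pval b x) ^ 2 :=
    continuous_finsetSum _ fun i _ => (continuous_coord β i).mul
      (((continuous_pval _).add (continuous_pval _)).pow 2)
  have hzero := eqOn_zero_of_integral_eq_zero hcont (fun x hx => Finset.sum_nonneg fun i _ =>
    mul_nonneg ((mem_simplex β).1 hx i) (sq_nonneg _)) hz
  intro x hx
  have hx' := (mem_interior_simplex β).1 hx
  have h3 := (Finset.sum_eq_zero_iff_of_nonneg fun i _ =>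
    mul_nonneg (hx' i).le (sq_nonneg (pval (v i) x + pval b x))).1 (hzero x hx)
  rw [← sum_dcoord_smul β (U x)]
  refine Finset.sum_eq_zero fun i hi => ?_
  have h4 := (mul_eq_zero.1 (h3 i hi)).resolve_left (hx' i).ne'
  rw [hUi, pow_eq_zero_iff two_ne_zero |>.1 h4, mul_zero, zero_smul]

/-! ### Bubble fields -/

variable (β) in
/-- The polynomial `P · β i`. -/
def vertexPoly (P : Fin n → MvPolynomial (Fin n) ℝ) (i : ι) : MvPolynomial (Fin n) ℝ :=
  ∑ k, C (β i k) * P k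

/-- The polynomial `P · x`. -/
def radialPoly (P : Fin n → MvPolynomial (Fin n) ℝ) : MvPolynomial (Fin n) ℝ := ∑ k, X k * P k

variable (β) in
/-- The first part of the bubble field `∑ λ_i (P · (β i - x)) β i`. -/
def bubblePoly (P : Fin n → MvPolynomial (Fin n) ℝ) : Fin n → MvPolynomial (Fin n) ℝ := fun k =>
  ∑ i, C (β i k) * (coordPoly β i * vertexPoly β P i)

lemma bubblePoly_mem {P : Fin n → MvPolynomial (Fin n) ℝ} {d : ℤ} (hP : P ∈ vecPolyLE n (d - 1)) :
    bubblePoly β P ∈ vecPolyLE n d := fun _ _ =>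
  Submodule.sum_mem _ fun i _ => C_mul_mem_polyLE _ (mul_mem_polyLE (coordPoly_mem β i)
    (Submodule.sum_mem _ fun l _ => C_mul_mem_polyLE _ (hP l trivial)) (by linarith))

lemma radialPoly_mem {P : Fin n → MvPolynomial (Fin n) ℝ} {d : ℤ} (hP : P ∈ vecPolyLE n (d - 1)) :
    -radialPoly P ∈ polyLE n d :=
  Submodule.neg_mem _ (Submodule.sum_mem _ fun k _ =>
    mul_mem_polyLE (X_mem_polyLE k le_rfl) (hP k trivial) (by linarith))

lemma sum_coord_mul_vertexPoly (P : Fin n → MvPolynomial (Fin n) ℝ) (x : E n) :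
    ∑ i, β.coord i x * pval (vertexPoly β P i) x = pval (radialPoly P) x := by
  have hx : ∀ k, x k = ∑ i, β.coord i x * β i k := by
    intro k
    have := congrArg (EuclideanSpace.proj (𝕜 := ℝ) k) (β.linear_combination_coord_eq_self x)
    rw [map_sum] at this
    exact this.symm
  simp_rw [vertexPoly, radialPoly, pval_sum, pval_mul, pval_C, pval_X, Finset.mul_sum]
  rw [Finset.sum_comm]
  refine Finset.sum_congr rfl fun k _ => ?_
  rw [hx k, Finset.sum_mul]
  refine Finset.sum_congr rfl fun i _ => ?_
  ring

variable (β) in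
/-- The bubble field of `P`. -/
def bubble (P : Fin n → MvPolynomial (Fin n) ℝ) : E n → E n :=
  fieldOf (rtPoly (bubblePoly β P) (-radialPoly P))

/-- In this form the coefficients of the vertices sum to zero, so they are the components `dλ_i` of
the field. Each contains `λ_i`, which gives the zero normal trace. -/
lemma bubble_eq (P : Fin n → MvPolynomial (Fin n) ℝ) (x : E n) :
    bubble β P x =
      ∑ i, (β.coord i x * (pval (vertexPoly β P i) x - pval (radialPoly P) x)) • β i := by
  have h1 : fieldOf (bubblePoly β P) x = ∑ i, (β.coord i x * pval (vertexPoly β P i) x) • β i := by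
    ext k
    rw [fieldOf_apply, bubblePoly, pval_sum]
    simp [pval_coordPoly]
    refine Finset.sum_congr rfl fun i _ => ?_
    ring
  rw [bubble, fieldOf_rtPoly, h1, pval_neg]
  simp_rw [mul_sub, sub_smul]
  rw [Finset.sum_sub_distrib]
  conv_lhs => rw [← β.linear_combination_coord_eq_self x]
  rw [neg_smul, ← sub_eq_add_neg, Finset.smul_sum]
  congr 1
  · rw [β.linear_combination_coord_eq_self x]
  · refine Finset.sum_congr rfl fun i _ => ?_
    rw [smul_smul, mul_comm, β.linear_combination_coord_eq_self x]

lemma sum_bubble_coeff (P : Fin n → MvPolynomial (Fin n) ℝ) (x : E n) :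
    ∑ i, β.coord i x * (pval (vertexPoly β P i) x - pval (radialPoly P) x) = 0 := by
  simp_rw [mul_sub]
  rw [Finset.sum_sub_distrib, sum_coord_mul_vertexPoly, ← Finset.sum_mul,
    β.sum_coord_apply_eq_one, one_mul, sub_self]

lemma dcoord_bubble (P : Fin n → MvPolynomial (Fin n) ℝ) (x : E n) (i : ι) :
    dcoord β i (bubble β P x) =
      β.coord i x * (pval (vertexPoly β P i) x - pval (radialPoly P) x) := by
  classical
  rw [bubble_eq, dcoord_sum_smul (sum_bubble_coeff P x)]

lemma contDiff_bubble (P : Fin n → MvPolynomial (Fin n) ℝ) {m : WithTop ℕ∞} :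
    ContDiff ℝ m (bubble β P) := contDiff_fieldOf _

lemma greenInt_bubble (P : Fin n → MvPolynomial (Fin n) ℝ) {w : E n → ℝ} (hw : Nice β w) :
    greenInt β (bubble β P) w = 0 :=
  greenInt_eq_zero (contDiff_bubble P) hw fun i x hx => by
    rw [dcoord_bubble, hx.1]; ring

/-- With weights `λ_i(x)` the mean of the numbers `P · β i` is `P · x`, and the right-hand side is
their variance. It vanishes at an interior point only if `P` is orthogonal to all edges, that is, if
`P = 0` there. -/
lemma bubble_inner (P : Fin n → MvPolynomial (Fin n) ℝ) (x : E n) :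
    ∑ k, bubble β P x k * pval (P k) x =
      ∑ i, β.coord i x * (pval (vertexPoly β P i) x - pval (radialPoly P) x) ^ 2 := by
  have h1 : ∑ k, bubble β P x k * pval (P k) x =
      ∑ i, β.coord i x * (pval (vertexPoly β P i) x - pval (radialPoly P) x) *
        pval (vertexPoly β P i) x := by
    have h2 : ∀ k, bubble β P x k =
        ∑ i, β.coord i x * (pval (vertexPoly β P i) x - pval (radialPoly P) x) * β i k := by
      intro k; rw [bubble_eq]; simp
    have h3 : ∀ i, pval (vertexPoly β P i) x = ∑ k, β i k * pval (P k) x := by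
      intro i; rw [vertexPoly, pval_sum]; simp
    simp_rw [h2, Finset.sum_mul]
    rw [Finset.sum_comm]
    refine Finset.sum_congr rfl fun i _ => ?_
    rw [h3 i, Finset.mul_sum]
    refine Finset.sum_congr rfl fun k _ => ?_
    ring
  have h4 := sum_bubble_coeff (β := β) P x
  rw [h1, ← sub_zero (∑ i, β.coord i x * _ * _), ← mul_zero (pval (radialPoly P) x), ← h4,
    Finset.mul_sum, ← Finset.sum_sub_distrib]
  refine Finset.sum_congr rfl fun i _ => ?_
  ring

/-- The bubble fields detect `P`. -/
lemma eq_zero_of_integral_bubble {P : Fin n → MvPolynomial (Fin n) ℝ}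
    (hz : ∫ x in simplex β, ∑ k, bubble β P x k * pval (P k) x = 0) : P = 0 := by
  simp_rw [bubble_inner] at hz
  have hcont : Continuous fun x => ∑ i, β.coord i x *
      (pval (vertexPoly β P i) x - pval (radialPoly P) x) ^ 2 :=
    continuous_finsetSum _ fun i _ => (continuous_coord β i).mul
      (((continuous_pval _).sub (continuous_pval _)).pow 2)
  have hzero := eqOn_zero_of_integral_eq_zero hcont (fun x hx => Finset.sum_nonneg fun i _ =>
    mul_nonneg ((mem_simplex β).1 hx i) (sq_nonneg _)) hz
  funext k
  refine eq_zero_of_pval_eq_zero isOpen_interior (interior_simplex_nonempty (β := β)) fun x hx => ?_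
  have hx' := (mem_interior_simplex β).1 hx
  have h3 := (Finset.sum_eq_zero_iff_of_nonneg fun i _ =>
    mul_nonneg (hx' i).le (sq_nonneg (pval (vertexPoly β P i) x - pval (radialPoly P) x))).1
    (hzero x hx)
  have h4 : ∀ i, ∑ l, β i l * pval (P l) x = pval (radialPoly P) x := fun i => by
    have := (mul_eq_zero.1 (h3 i (Finset.mem_univ i))).resolve_left (hx' i).ne'
    have h5 := sub_eq_zero.1 ((pow_eq_zero_iff two_ne_zero).1 this)
    rw [← h5, vertexPoly, pval_sum]; simp
  have h6 : ∀ v : E n, ∑ l, v l * pval (P l) x = 0 := fun v => by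
    have hv : ∀ l, v l = ∑ i, dcoord β i v * β i l := fun l => by
      conv_lhs => rw [← sum_dcoord_smul β v]
      simp
    simp_rw [hv, Finset.sum_mul]
    rw [Finset.sum_comm]
    simp_rw [mul_assoc, ← Finset.mul_sum, h4]
    rw [← Finset.sum_mul, sum_dcoord, zero_mul]
  have := h6 (EuclideanSpace.single k 1)
  simpa using this

/-! ### Transfer of facet integrals between adjacent elements -/

/-- Fluxes of the radial fields of two simplices with a common facet are proportional. -/
lemma exists_greenInt_transfer [DecidableEq ι] {ι' : Type*} [Fintype ι'] {β' : AffineBasis ι' ℝ (E n)}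
    (σ : ι ≃ ι') (b : ι) (hσ : ∀ i, i ≠ b → β i = β' (σ i)) :
    ∃ c : ℝ, 0 < c ∧ ∀ g : E n → ℝ, ContDiff ℝ 1 g →
      greenInt β' (fun x => x - β' (σ b)) g = c * greenInt β (fun x => x - β b) g := by
  classical
  let L : E n →L[ℝ] E n := ∑ i, (dcoord β i).smulRight (β' (σ i))
  have hL : ∀ v, L v = ∑ i, dcoord β i v • β' (σ i) := fun v => by
    simp [L]
  have hLc : ∀ i v, dcoord β' (σ i) (L v) = dcoord β i v := fun i v => by
    have h1 : L v = ∑ j, dcoord β (σ.symm j) v • β' j := by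
      rw [hL, ← Equiv.sum_comp σ]
      simp
    have h2 : ∑ j, dcoord β (σ.symm j) v = 0 := by
      rw [Equiv.sum_comp σ.symm (fun i => dcoord β i v), sum_dcoord]
    rw [h1, dcoord_sum_smul h2]
    simp
  have hLinj : Function.Injective L := by
    intro v w hvw
    rw [← sum_dcoord_smul β v, ← sum_dcoord_smul β w]
    refine Finset.sum_congr rfl fun i _ => ?_
    rw [← hLc, ← hLc, hvw]
  -- The affine map carrying each vertex `β i` to `β' (σ i)`. It fixes the common facet pointwise
  -- and sends one radial field to the other; the constant is the Jacobian.
  let Ψ : E n → E n := fun y => L (y - β b) + β' (σ b)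
  have hΨc : ∀ i y, β'.coord (σ i) (Ψ y) = β.coord i y := fun i y => by
    have h1 : Ψ y = β' (σ b) + L (y - β b) := add_comm _ _
    rw [h1, coord_add_vec, hLc, dcoord_sub, β.coord_apply, β'.coord_apply]
    simp
  have hΨd : ∀ y, HasFDerivAt Ψ L y := fun y =>
    (L.hasFDerivAt.comp y ((hasFDerivAt_id y).sub_const (β b))).add_const _
  have hΨs : ContDiff ℝ 1 Ψ := (L.contDiff.comp (contDiff_sub_vertex _)).add contDiff_const
  have hΨim : Ψ '' simplex β = simplex β' := by
    ext x
    constructor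
    · rintro ⟨y, hy, rfl⟩
      rw [mem_simplex] at hy ⊢
      intro j
      have := hy (σ.symm j)
      rwa [← hΨc, Equiv.apply_symm_apply] at this
    · intro hx
      obtain ⟨v, hv⟩ := L.toLinearMap.injective_iff_surjective.1 hLinj (x - β' (σ b))
      have hy : Ψ (v + β b) = x := by
        have hv' : L v = x - β' (σ b) := hv
        simp [Ψ, hv']
      refine ⟨v + β b, (mem_simplex β).2 fun i => ?_, hy⟩
      rw [← hΨc, hy]
      exact (mem_simplex β').1 hx _
  have hΨinj : Set.InjOn Ψ (simplex β) := fun y _ z _ h => by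
    have := hLinj (add_right_cancel h)
    exact sub_left_injective this
  have hdet : L.det ≠ 0 := by
    have hu : IsUnit L.toLinearMap :=
      (LinearMap.isUnit_iff_ker_eq_bot _).2 (LinearMap.ker_eq_bot.2 hLinj)
    exact (LinearMap.isUnit_det _ hu).ne_zero
  refine ⟨|L.det|, abs_pos.2 hdet, fun g hg => ?_⟩
  have hgΨ : ContDiff ℝ 1 (fun y => g (Ψ y)) := hg.comp hΨs
  have hcard : Fintype.card ι' = Fintype.card ι := (Fintype.card_congr σ).symm
  have h1 : greenInt β' (fun x => x - β' (σ b)) g =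
      |L.det| * greenInt β (fun x => x - β b) (fun y => g (Ψ y)) := by
    rw [greenInt, ← hΨim, integral_image_eq_integral_abs_det_fderiv_smul volume
      (measurableSet_simplex β) (fun y _ => (hΨd y).hasFDerivWithinAt) hΨinj, greenInt,
      ← integral_const_mul]
    congr 1
    funext y
    rw [divB_sub_const, divB_sub_const, hcard, smul_eq_mul]
    have h2 : fderiv ℝ (fun y => g (Ψ y)) y = (fderiv ℝ g (Ψ y)).comp L :=
      ((hg.differentiable (by simp) _).hasFDerivAt.comp y (hΨd y)).fderiv
    rw [h2, ContinuousLinearMap.comp_apply]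
    simp [Ψ]
  -- The difference vanishes on the common facet, and the radial field is tangent to all the other
  -- facets.
  have h3 : greenInt β (fun x => x - β b) (fun y => g (Ψ y) - g y) = 0 := by
    refine greenInt_eq_zero (contDiff_sub_vertex _) (ContDiff.nice (hgΨ.sub hg)) fun i x hx => ?_
    by_cases hib : i = b
    · subst hib
      have : Ψ x = x := by
        rw [← β'.linear_combination_coord_eq_self (Ψ x), ← Equiv.sum_comp σ]
        simp_rw [hΨc]
        conv_rhs => rw [← β.linear_combination_coord_eq_self x]
        refine Finset.sum_congr rfl fun j _ => ?_
        by_cases hj : j = i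
        · rw [hj, hx.1, zero_smul, zero_smul]
        · rw [hσ j hj]
      rw [this, sub_self, zero_mul]
    · rw [dcoord_sub_vertex i b x hib, hx.1, mul_zero]
  rw [greenInt_sub (contDiff_sub_vertex _) (ContDiff.nice hgΨ) (ContDiff.nice hg)] at h3
  rw [h1, sub_eq_zero.1 h3]

end LocalRT

end DiscreteFlow

namespace DiscreteFlow

/-! ### Gluing of piecewise smooth fields, and the Raviart-Thomas space. -/

namespace Triangulation

open scoped Classical

variable {n : ℕ} {T : Triangulation n}

/-! ### Piecewise continuous functions -/

variable (T) in
lemma ae_notMem_hull (K : T.Cell) :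
    ∀ᵐ x ∂(volume.restrict (simplex (T.cellBasis K))), ∀ K', K' ≠ K → x ∉ T.hull K' := by
  rw [ae_all_iff]
  intro K'
  by_cases h : K' = K
  · exact Filter.Eventually.of_forall fun _ h' => absurd h h'
  · rw [← hull_eq, ae_restrict_iff' (T.measurableSet_hull K)]
    have h0 : volume (T.hull K' ∩ T.hull K) = 0 := T.aedisjoint_hull h
    filter_upwards [measure_eq_zero_iff_ae_notMem.1 h0] with x hx hK _ hK'
    exact hx ⟨hK', hK⟩

/-- Continuous functions on the elements can be glued to a function in `L²(Ω)`. -/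
lemma exists_piecewise {F : Type*} [NormedAddCommGroup F] {f : T.Cell → E n → F}
    (hf : ∀ K, Continuous (f K)) : ∃ g : Lp F 2 T.vol,
    ∀ K, ∀ᵐ x ∂(volume.restrict (simplex (T.cellBasis K))), g x = f K x := by
  have hmem : MemLp (fun x => ∑ K, (T.hull K).indicator (f K) x) 2 T.vol := by
    refine memLp_finsetSum _ fun K _ => ?_
    rw [memLp_indicator_iff_restrict (T.measurableSet_hull K), vol_restrict_hull]
    obtain ⟨C, hC⟩ := (isCompact_simplex (T.cellBasis K)).exists_bound_of_continuousOn
      (hf K).continuousOn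
    refine MemLp.of_bound ((hf K).continuousOn.aestronglyMeasurable_of_isCompact
      (isCompact_simplex _) (measurableSet_simplex _)) C ?_
    filter_upwards [ae_restrict_mem (measurableSet_simplex (T.cellBasis K))] with x hx using hC x hx
  refine ⟨hmem.toLp, fun K => ?_⟩
  filter_upwards [ae_simplex_of_ae_vol K hmem.coeFn_toLp, T.ae_notMem_hull K,
    ae_restrict_mem (measurableSet_simplex (T.cellBasis K))] with x h1 h2 h3
  rw [h1, Finset.sum_eq_single K (fun K' _ h => Set.indicator_of_notMem (h2 K' h) _) (by simp),
    Set.indicator_of_mem]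
  rwa [hull_eq]

/-! ### Piecewise smooth fields -/

/-- The field `u` coincides with `U K` on each element `K`. -/
def IsLocal (u : T.L2Vec) (U : T.Cell → E n → E n) : Prop :=
  ∀ K, ∀ᵐ x ∂(volume.restrict (simplex (T.cellBasis K))), u x = U K x

lemma coord_ne_zero_of_mem_interior {K : T.Cell} {x : E n}
    (hx : x ∈ interior (simplex (T.cellBasis K))) (i : K.1) : (T.cellBasis K).coord i x ≠ 0 :=
  ((mem_interior_simplex _).1 hx i).ne'

/-- The weak divergence of a piecewise smooth field is its piecewise divergence. -/
lemma IsWeakDiv.eq_divB {u : T.L2Vec} {d : T.L2} (h : T.IsWeakDiv u d) {U : T.Cell → E n → E n}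
    (hu : IsLocal u U) (hU : ∀ K, ContDiff ℝ 1 (U K)) (K : T.Cell) :
    ∀ᵐ x ∂(volume.restrict (simplex (T.cellBasis K))), d x = divB (T.cellBasis K) (U K) x := by
  have hd : Integrable (fun x => d x) T.vol := (Lp.memLp d).integrable (by norm_num)
  have hd' := integrableOn_simplex T hd K
  have hB : IntegrableOn (divB (T.cellBasis K) (U K)) (simplex (T.cellBasis K)) :=
    (continuous_divB (hU K)).continuousOn.integrableOn_compact (isCompact_simplex _)
  have hsub := hd'.sub hB
  have h0 : ∀ᵐ x ∂(volume.restrict (simplex (T.cellBasis K))),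
      x ∈ interior (simplex (T.cellBasis K)) → d x - divB (T.cellBasis K) (U K) x = 0 := by
    refine IsOpen.ae_eq_zero_of_integral_contDiff_smul_eq_zero isOpen_interior
      (hsub.locallyIntegrable.locallyIntegrableOn _) fun φ h1 h2 h3 => ?_
    have e1 := h.integral_simplex K h1 h2 h3
    have hφ1 : ContDiff ℝ 1 φ := h1.of_le (by simp)
    have e2 : greenInt (T.cellBasis K) (U K) φ = 0 :=
      greenInt_eq_zero (hU K) (ContDiff.nice hφ1) fun i x hx => by
        have hxt : x ∉ tsupport φ := fun hxt => coord_ne_zero_of_mem_interior (h3 hxt) i hx.1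
        rw [image_eq_zero_of_notMem_tsupport hxt, zero_mul]
    have e3 : (∫ x in simplex (T.cellBasis K), (fderiv ℝ φ x (u x) + d x * φ x)) -
        greenInt (T.cellBasis K) (U K) φ = 0 := by rw [e1, e2, sub_zero]
    have i1 : IntegrableOn (fun x => fderiv ℝ φ x (u x) + d x * φ x)
      (simplex (T.cellBasis K)) := integrableOn_simplex T (T.integrable_test u d h1 h2) K
    rw [greenInt, ← integral_sub i1 ((ContDiff.nice hφ1).integrable_green (hU K))] at e3
    rw [← e3]
    refine integral_congr_ae ?_
    filter_upwards [hu K] with x hx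
    rw [hx, smul_eq_mul]
    ring
  filter_upwards [h0, ae_simplex_interior (β := T.cellBasis K)] with x h1 h2
  exact sub_eq_zero.1 (h1 h2)

lemma integral_eq_greenInt {u : T.L2Vec} {d : T.L2} (h : T.IsWeakDiv u d) {U : T.Cell → E n → E n}
    (hu : IsLocal u U) (hU : ∀ K, ContDiff ℝ 1 (U K)) (K : T.Cell) (w : E n → ℝ) :
    ∫ x in simplex (T.cellBasis K), (fderiv ℝ w x (u x) + d x * w x) =
      greenInt (T.cellBasis K) (U K) w := by
  rw [greenInt]
  refine integral_congr_ae ?_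
  filter_upwards [hu K, h.eq_divB hu hU K] with x h1 h2
  rw [h1, h2]

lemma facetIntegral_eq_greenInt {u : T.L2Vec} (h : u ∈ T.H0div) {U : T.Cell → E n → E n}
    (hu : IsLocal u U) (hU : ∀ K, ContDiff ℝ 1 (U K)) (K : T.Cell) (b : K.1)
    (q : MvPolynomial (Fin n) ℝ) :
    T.facetIntegral u K (K.1.erase b) q = greenInt (T.cellBasis K) (U K) (wLift K b q) := by
  rw [facetIntegral_eq, integral_eq_greenInt (isWeakDiv_weakDiv h) hu hU]

/-- The test functions need not vanish on the boundary of the domain, so this single identity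
encodes both the matching of normal traces across interior facets and the boundary condition. -/
lemma sum_greenInt_eq_zero {u : T.L2Vec} (h : u ∈ T.H0div) {U : T.Cell → E n → E n}
    (hu : IsLocal u U) (hU : ∀ K, ContDiff ℝ 1 (U K)) {φ : E n → ℝ} (h1 : ContDiff ℝ ∞ φ)
    (h2 : HasCompactSupport φ) : ∑ K, greenInt (T.cellBasis K) (U K) φ = 0 := by
  rw [← normalTraceZero_weakDiv h φ h1 h2, T.integral_vol (T.integrable_test u _ h1 h2)]
  exact Finset.sum_congr rfl fun K _ => (integral_eq_greenInt (isWeakDiv_weakDiv h) hu hU K φ).symm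

/-- Piecewise smooth fields with matching normal components can be glued. -/
lemma exists_mem_H0div {U : T.Cell → E n → E n} (hU : ∀ K, ContDiff ℝ 1 (U K))
    (h : ∀ φ : E n → ℝ, ContDiff ℝ 1 φ → ∑ K, greenInt (T.cellBasis K) (U K) φ = 0) :
    ∃ u ∈ T.H0div, IsLocal u U := by
  obtain ⟨u, hu⟩ := exists_piecewise (T := T) fun K => (hU K).continuous
  obtain ⟨d, hd⟩ := exists_piecewise (T := T) fun K => continuous_divB (β := T.cellBasis K) (hU K)
  have h0 : T.NormalTraceZero u d := fun φ h1 h2 => by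
    rw [T.integral_vol (T.integrable_test u _ h1 h2), ← h φ (h1.of_le (by simp))]
    refine Finset.sum_congr rfl fun K _ => ?_
    rw [greenInt]
    refine integral_congr_ae ?_
    filter_upwards [hu K, hd K] with x h1 h2
    rw [h1, h2]
  exact ⟨u, ⟨d, fun φ h1 h2 _ => h0 φ h1 h2, h0⟩, hu⟩

lemma cellDof_eq {u : T.L2Vec} {U : T.Cell → E n → E n} (hu : IsLocal u U) (K : T.Cell)
    (P : Fin n → MvPolynomial (Fin n) ℝ) :
    T.cellDof u K P = ∫ x in simplex (T.cellBasis K), ∑ i, U K x i * pval (P i) x := by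
  rw [cellDof, vol_restrict_hull]
  refine integral_congr_ae ?_
  filter_upwards [hu K] with x h1
  rw [h1]

/-! ### The Raviart-Thomas space -/

lemma eqFieldOn_iff {u : T.L2Vec} {K : T.Cell} {a : Fin n → MvPolynomial (Fin n) ℝ}
    {b : MvPolynomial (Fin n) ℝ} : T.EqFieldOn u K a b ↔
      ∀ᵐ x ∂(volume.restrict (simplex (T.cellBasis K))), u x = fieldOf (rtPoly a b) x := by
  rw [EqFieldOn, ae_vol_iff]
  refine Filter.eventually_congr (Filter.Eventually.of_forall fun x => ?_)
  constructor
  · intro h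
    ext i
    rw [h i, fieldOf_apply, rtPoly, pval_add, pval_mul, pval_X]
  · intro h i
    rw [h, fieldOf_apply, rtPoly, pval_add, pval_mul, pval_X]

lemma exists_isLocal_of_mem_RT {k : ℕ} {u : T.L2Vec} (hu : u ∈ T.RT k) :
    ∃ (a : T.Cell → Fin n → MvPolynomial (Fin n) ℝ) (b : T.Cell → MvPolynomial (Fin n) ℝ),
      (∀ K, a K ∈ vecPolyLE n k) ∧ (∀ K, b K ∈ polyLE n k) ∧
      IsLocal u fun K => fieldOf (rtPoly (a K) (b K)) := by
  choose a ha b hb h using hu.2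
  exact ⟨a, b, ha, hb, fun K => eqFieldOn_iff.1 (h K)⟩

lemma mem_RT_of_isLocal {k : ℕ} {u : T.L2Vec} (hu : u ∈ T.H0div)
    {a : T.Cell → Fin n → MvPolynomial (Fin n) ℝ} {b : T.Cell → MvPolynomial (Fin n) ℝ}
    (ha : ∀ K, a K ∈ vecPolyLE n k) (hb : ∀ K, b K ∈ polyLE n k)
    (h : IsLocal u fun K => fieldOf (rtPoly (a K) (b K))) : u ∈ T.RT k :=
  ⟨hu, fun K => ⟨a K, ha K, b K, hb K, eqFieldOn_iff.2 (h K)⟩⟩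

-- The fields are polynomial on finitely many compact elements, hence bounded.
variable (T) in
lemma RT_le_H0divLp (k : ℕ) (p : ℝ≥0∞) : T.RT k ≤ T.H0divLp p := by
  intro u hu
  obtain ⟨a, b, -, -, hloc⟩ := exists_isLocal_of_mem_RT hu
  have hC : ∀ K : T.Cell, ∃ C, ∀ x ∈ simplex (T.cellBasis K),
      ‖fieldOf (rtPoly (a K) (b K)) x‖ ≤ C := fun K =>
    (isCompact_simplex (T.cellBasis K)).exists_bound_of_continuousOn
      (contDiff_fieldOf _ (m := 0)).continuous.continuousOn
  choose C hC using hC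
  refine ⟨hu.1, MemLp.of_bound (Lp.memLp u).aestronglyMeasurable (∑ K, |C K|) ?_⟩
  refine T.ae_vol_of_forall fun K => ?_
  filter_upwards [hloc K, ae_restrict_mem (measurableSet_simplex (T.cellBasis K))] with x h1 h2
  rw [h1]
  exact (hC K x h2).trans ((le_abs_self _).trans
    (Finset.single_le_sum (f := fun K => |C K|) (fun _ _ => abs_nonneg _) (Finset.mem_univ K)))

end Triangulation

end DiscreteFlow

namespace DiscreteFlow

/-- Change of barycentric coordinates. -/
lemma coord_eq_sum {n : ℕ} {ι ι' : Type*} [Fintype ι] (β : AffineBasis ι ℝ (E n))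
    (β' : AffineBasis ι' ℝ (E n)) (j : ι') (x : E n) :
    β'.coord j x = ∑ i, β.coord i x * β'.coord j (β i) := by
  have h1 : ∀ i, β'.coord j (β i) = β'.coord j 0 + dcoord β' j (β i) := fun i => coord_eq β' j _
  simp_rw [h1, mul_add]
  rw [Finset.sum_add_distrib, ← Finset.sum_mul, β.sum_coord_apply_eq_one, one_mul, coord_eq β' j x]
  congr 1
  have h2 := congrArg (dcoord β' j) (β.linear_combination_coord_eq_self x)
  rw [map_sum] at h2
  simp_rw [map_smul, smul_eq_mul] at h2
  exact h2.symm

/-! ### Adjacent elements and injectivity of the degrees of freedom. -/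

namespace Triangulation

open scoped Classical

variable {n : ℕ} {T : Triangulation n}

/-! ### Elements sharing a facet -/

lemma coord_vertex_eq_zero {K : T.Cell} (a : K.1) {x : E n} (hx : x ∈ K.1) (h : x ≠ a.1) :
    (T.cellBasis K).coord a x = 0 := by
  have : (T.cellBasis K).coord a (T.cellBasis K ⟨x, hx⟩) = 0 := by
    rw [AffineBasis.coord_apply_ne]
    exact fun h' => h (congrArg Subtype.val h').symm
  exact this

lemma coord_vertex_self {K : T.Cell} (a : K.1) : (T.cellBasis K).coord a a.1 = 1 :=
  (T.cellBasis K).coord_apply_eq a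

/-- Barycentric coordinates of points on a common facet. -/
lemma coord_eq_of_facet {K K' : T.Cell} {b : K.1} (he : K.1.erase b ⊆ K'.1) {x : E n}
    (hx : (T.cellBasis K).coord b x = 0) (a : K.1) (a' : K'.1) (haa : a'.1 = a.1) :
    (T.cellBasis K').coord a' x = (T.cellBasis K).coord a x := by
  rw [coord_eq_sum (T.cellBasis K), Finset.sum_eq_single a]
  · rw [cellBasis_apply, ← haa, coord_vertex_self, mul_one]
  · intro c _ hca
    by_cases hcb : c = b
    · rw [hcb, hx, zero_mul]
    · rw [cellBasis_apply, coord_vertex_eq_zero a'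
        (he (Finset.mem_erase.2 ⟨fun h => hcb (Subtype.ext h), c.2⟩))
        (haa ▸ fun h => hca (Subtype.ext h)), mul_zero]
  · simp

/-- The affine function `λ_b` of `K` vanishes at all vertices of `K'` except `b'`, so it is a
multiple of the coordinate of `b'`. -/
lemma coord_eq_mul_of_facet {K K' : T.Cell} {b : K.1} {b' : K'.1}
    (he : K'.1.erase b' = K.1.erase b) (x : E n) :
    (T.cellBasis K).coord b x =
      (T.cellBasis K').coord b' x * (T.cellBasis K).coord b b'.1 := by
  rw [coord_eq_sum (T.cellBasis K'), Finset.sum_eq_single b']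
  · rfl
  · intro c _ hcb
    have hc : c.1 ∈ K.1.erase b := by
      rw [← he]; exact Finset.mem_erase.2 ⟨fun h => hcb (Subtype.ext h), c.2⟩
    rw [cellBasis_apply, coord_vertex_eq_zero b (Finset.mem_of_mem_erase hc)
      (Finset.ne_of_mem_erase hc), mul_zero]
  · simp

/-- By conformity `x` lies in the hull of the common vertices. A facet vertex missing from `K'`
would have coordinate zero at `x`, against `x` being in the open facet. -/
lemma facet_subset_of_mem_hull {K K' : T.Cell} {b : K.1} {x : E n}
    (hx : x ∈ openFacet (T.cellBasis K) b) (hx' : x ∈ T.hull K') : K.1.erase b ⊆ K'.1 := by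
  intro a ha
  by_contra haK
  have hK : x ∈ T.hull K := by rw [hull_eq]; exact (generic_of_mem_openFacet hx).1
  have h0 := T.coord_eq_zero_of_mem_convexHull K ⟨a, Finset.mem_of_mem_erase ha⟩
    Set.inter_subset_left (fun h => haK h.2) (T.inter_hull_subset ⟨hK, hx'⟩)
  exact (hx.2 ⟨a, Finset.mem_of_mem_erase ha⟩
    fun h => Finset.ne_of_mem_erase ha (congrArg Subtype.val h)).ne' h0

/-- Two elements with a common facet lie on different sides of it. -/
lemma coord_neg_of_facet [NeZero n] {K K' : T.Cell} (hne : K ≠ K') {b : K.1} {b' : K'.1}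
    (he : K'.1.erase b' = K.1.erase b) : (T.cellBasis K).coord b b'.1 < 0 := by
  have hbK' : b.1 ∉ K'.1 := by
    intro hb
    obtain ⟨c, hc⟩ := T.exists_mem_notMem hne
    by_cases hcb : c = b
    · exact hc (hcb ▸ hb)
    · have : c.1 ∈ K'.1.erase b' := by
        rw [he]; exact Finset.mem_erase.2 ⟨fun h => hcb (Subtype.ext h), c.2⟩
      exact hc (Finset.mem_of_mem_erase this)
  have hne0 : (T.cellBasis K).coord b b'.1 ≠ 0 := fun h0 => by
    have := coord_eq_mul_of_facet he b.1
    rw [coord_vertex_self, h0, mul_zero] at this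
    exact one_ne_zero this
  by_contra hcon
  -- If `b'` were on the same side as `b`, a point slightly off the open facet towards `b'` would
  -- lie in both elements with `λ_b > 0`. Conformity forbids this, as `b` is not a common vertex.
  have hpos : 0 < (T.cellBasis K).coord b b'.1 := lt_of_le_of_ne (not_lt.1 hcon) hne0.symm
  obtain ⟨x₀, hx₀⟩ := openFacet_nonempty (β := T.cellBasis K) b
  have hline : ∀ t : ℝ, x₀ + t • (b'.1 - x₀) = AffineMap.lineMap x₀ b'.1 t := fun t => by
    rw [AffineMap.lineMap_apply, vsub_eq_sub, vadd_eq_add, add_comm]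
  have hc : ∀ (L : T.Cell) (a : L.1) (t : ℝ), (T.cellBasis L).coord a (x₀ + t • (b'.1 - x₀)) =
      (1 - t) * (T.cellBasis L).coord a x₀ + t * (T.cellBasis L).coord a b'.1 := fun L a t => by
    rw [coord_add_vec, map_smul, dcoord_sub, smul_eq_mul]; ring
  have hev : ∀ᶠ t : ℝ in nhdsWithin 0 (Set.Ioi 0), ∀ a : K.1,
      0 < (T.cellBasis K).coord a (x₀ + t • (b'.1 - x₀)) := by
    rw [Filter.eventually_all]
    intro a
    by_cases hab : a = b
    · filter_upwards [self_mem_nhdsWithin] with t ht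
      rw [hc, hab, hx₀.1, mul_zero, zero_add]
      exact mul_pos ht hpos
    · refine Filter.Eventually.filter_mono nhdsWithin_le_nhds ?_
      have hcont : Continuous fun t : ℝ => (T.cellBasis K).coord a (x₀ + t • (b'.1 - x₀)) :=
        (continuous_coord _ a).comp (by fun_prop)
      refine hcont.continuousAt.eventually (lt_mem_nhds ?_)
      simpa using hx₀.2 a hab
  have hlt : ∀ᶠ t : ℝ in nhdsWithin 0 (Set.Ioi 0), t < 1 :=
    Filter.Eventually.filter_mono nhdsWithin_le_nhds (gt_mem_nhds one_pos)
  obtain ⟨t, ht, ht1, ht0⟩ := (hev.and (hlt.and self_mem_nhdsWithin)).exists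
  have ht0' : 0 < t := ht0
  have hyK : x₀ + t • (b'.1 - x₀) ∈ T.hull K := by
    rw [hull_eq]; exact (mem_simplex _).2 fun a => (ht a).le
  have hx₀K' : x₀ ∈ T.hull K' := by
    have h1 := T.openFacet_subset K b hx₀
    have h2 : (K.1.erase b : Set (E n)) ⊆ K'.1 := by
      rw [← he]; exact Finset.coe_subset.2 (Finset.erase_subset _ _)
    exact convexHull_mono h2 h1
  have hyK' : x₀ + t • (b'.1 - x₀) ∈ T.hull K' := by
    rw [hline]
    exact (convex_convexHull ℝ _).lineMap_mem hx₀K' (subset_convexHull ℝ _ b'.2) ⟨ht0'.le, ht1.le⟩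
  exact (ht b).ne' (T.coord_eq_zero_of_mem_convexHull K b Set.inter_subset_left
    (fun h => hbK' h.2) (T.inter_hull_subset ⟨hyK, hyK'⟩))

/-- Three distinct elements would have to lie pairwise on opposite sides of the facet, but the
product of two negative coordinates is positive. -/
lemma eq_or_eq_of_facet [NeZero n] {K₁ K₂ K₃ : T.Cell} {b₁ : K₁.1} {b₂ : K₂.1} {b₃ : K₃.1}
    (h₁₂ : K₁ ≠ K₂) (h2 : K₂.1.erase b₂ = K₁.1.erase b₁) (h3 : K₃.1.erase b₃ = K₁.1.erase b₁) :
    K₃ = K₁ ∨ K₃ = K₂ := by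
  by_contra hcon
  push Not at hcon
  have h12 := coord_neg_of_facet h₁₂ h2
  have h13 := coord_neg_of_facet hcon.1.symm h3
  have h23 := coord_neg_of_facet hcon.2.symm (h3.trans h2.symm)
  rw [coord_eq_mul_of_facet h2 b₃.1] at h13
  exact absurd h13 (not_lt.2 (mul_nonneg_of_nonpos_of_nonpos h23.le h12.le))

namespace Orientation

variable (o : T.Orientation)

lemma exists_opposite₂ (e : T.IntFacet) : ∃ b : (o.K₂ e).1, e.1 = (o.K₂ e).1.erase b :=
  T.exists_opposite _ (o.sub₂ e) e.2.2.1

lemma eq_or_eq [NeZero n] (e : T.IntFacet) {K : T.Cell} (h : e.1 ⊆ K.1) :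
    K = o.K₁ e ∨ K = o.K₂ e := by
  obtain ⟨b₁, hb₁⟩ := o.exists_opposite e
  obtain ⟨b₂, hb₂⟩ := o.exists_opposite₂ e
  obtain ⟨b, hb⟩ := T.exists_opposite K h e.2.2.1
  exact eq_or_eq_of_facet (o.ne e) (hb₂.symm.trans hb₁) (hb.symm.trans hb₁)

end Orientation

/-- A facet shared by two elements, as an interior facet. -/
def mkIntFacet [NeZero n] {K K' : T.Cell} (hne : K ≠ K') (b : K.1) (h : K.1.erase b ⊆ K'.1) :
    T.IntFacet :=
  ⟨K.1.erase b, by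
    have hcard : (K.1.erase b).card = n := by rw [Finset.card_erase_of_mem b.2, K.2.2]; rfl
    refine ⟨T.complex.down_closed K.2.1 (Finset.erase_subset _ _) ?_, hcard, K, K', hne,
      Finset.erase_subset _ _, h⟩
    rw [← Finset.card_pos, hcard]
    exact NeZero.pos n⟩

/-! ### Unisolvence of the degrees of freedom: injectivity -/

/-- If the normal traces from the other sides of a facet vanish, then so does the normal trace from
the given side. -/
lemma trace_eq_zero_of_neighbours [NeZero n] {U : T.Cell → E n → E n}
    (hU : ∀ K, ContDiff ℝ 1 (U K))
    (hsum : ∀ φ : E n → ℝ, ContDiff ℝ ∞ φ → HasCompactSupport φ →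
      ∑ K, greenInt (T.cellBasis K) (U K) φ = 0)
    {K : T.Cell} {b : K.1} {s : E n → ℝ} (hs : ContDiff ℝ ∞ s)
    (hsU : ∀ x ∈ openFacet (T.cellBasis K) b, dcoord (T.cellBasis K) b (U K x) = s x)
    (hnb : ∀ K' : T.Cell, K' ≠ K → ∀ b' : K'.1, K'.1.erase b' = K.1.erase b →
      ∀ x ∈ openFacet (T.cellBasis K') b', dcoord (T.cellBasis K') b' (U K' x) = 0) :
    ∀ x ∈ openFacet (T.cellBasis K) b, s x = 0 := by
  intro x₀ hx₀
  -- A neighbourhood of `x₀` that meets only the elements containing `x₀` and, in each of them, only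
  -- the facet hyperplanes through `x₀`.
  let W : Set (E n) := {x | ∀ K' : T.Cell, (x₀ ∉ T.hull K' → x ∉ T.hull K') ∧
    ∀ a : K'.1, (T.cellBasis K').coord a x₀ ≠ 0 → (T.cellBasis K').coord a x ≠ 0}
  have hW : W ∈ nhds x₀ := by
    change ∀ᶠ x in nhds x₀, ∀ K' : T.Cell, (x₀ ∉ T.hull K' → x ∉ T.hull K') ∧
      ∀ a : K'.1, (T.cellBasis K').coord a x₀ ≠ 0 → (T.cellBasis K').coord a x ≠ 0
    rw [Filter.eventually_all]
    intro K'
    refine Filter.Eventually.and ?_ (Filter.eventually_all.2 fun a => ?_)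
    · by_cases h : x₀ ∈ T.hull K'
      · exact Filter.Eventually.of_forall fun _ h' => absurd h h'
      · filter_upwards [(T.isClosed_hull K').isOpen_compl.mem_nhds h] with x hx _ using hx
    · by_cases h : (T.cellBasis K').coord a x₀ = 0
      · exact Filter.Eventually.of_forall fun _ h' => absurd h h'
      · filter_upwards [(continuous_coord _ a).continuousAt.eventually_ne h] with x hx _ using hx
  obtain ⟨χ, hχs, hχc, hχd, hχr, hχ1⟩ := exists_contDiff_tsupport_subset (n := ⊤) hW
  have hχW : ∀ x, x ∉ W → χ x = 0 := fun x hx => image_eq_zero_of_notMem_tsupport fun h => hx (hχs h)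
  have hχd' : ContDiff ℝ ∞ χ := hχd
  have hφ : ContDiff ℝ ∞ (fun x => s x * χ x) := hs.mul hχd'
  -- Testing with the normal component times a bump function makes the flux density `s² χ`; by
  -- hypothesis the other elements contribute nothing.
  have hφc : HasCompactSupport (fun x => s x * χ x) := hχc.mul_left
  have hzero : ∀ K', K' ≠ K → greenInt (T.cellBasis K') (U K') (fun x => s x * χ x) = 0 := by
    intro K' hK'
    refine greenInt_eq_zero (hU K') (ContDiff.nice (hφ.of_le (by simp))) fun i x hx => ?_
    by_cases hxW : x ∈ W
    · have hi0 : (T.cellBasis K').coord i x₀ = 0 := by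
        by_contra h
        exact (hxW K').2 i h hx.1
      have hx₀K' : x₀ ∈ T.hull K' := by
        by_contra h
        refine (hxW K').1 h ?_
        rw [hull_eq]; exact (generic_of_mem_openFacet hx).1
      have hsub := facet_subset_of_mem_hull hx₀ hx₀K'
      have hcard : (K.1.erase b).card = n := by rw [Finset.card_erase_of_mem b.2, K.2.2]; rfl
      obtain ⟨b', hb'⟩ := T.exists_opposite K' hsub hcard
      have hib : i = b' := by
        by_contra hib
        have hiK : i.1 ∈ K.1.erase b := by
          rw [hb']; exact Finset.mem_erase.2 ⟨fun h => hib (Subtype.ext h), i.2⟩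
        have hne : (⟨i.1, Finset.mem_of_mem_erase hiK⟩ : K.1) ≠ b := fun h =>
          Finset.ne_of_mem_erase hiK (congrArg Subtype.val h)
        rw [coord_eq_of_facet hsub hx₀.1 ⟨i.1, Finset.mem_of_mem_erase hiK⟩ i rfl] at hi0
        exact (hx₀.2 _ hne).ne' hi0
      rw [hib, hnb K' hK' b' hb'.symm x (hib ▸ hx), mul_zero]
    · rw [hχW x hxW, mul_zero, zero_mul]
  have hK : greenInt (T.cellBasis K) (U K) (fun x => s x * χ x) = 0 := by
    rw [← hsum _ hφ hφc, Finset.sum_eq_single K (fun K' _ h => hzero K' h) (by simp)]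
  have := sq_mul_eq_zero_of_greenInt b (hU K) (hs.of_le (by simp))
    (ContDiff.nice (β := T.cellBasis K) (hχd'.of_le (by simp)))
    (fun x _ => (hχr ⟨x, rfl⟩).1) (fun i hib x hx => hχW x fun hxW =>
      (hxW K).2 i (hx₀.2 i hib).ne' hx.1) hsU hK x₀ hx₀
  rw [hχ1, mul_one] at this
  exact mul_self_eq_zero.1 this

/-- A Raviart-Thomas field with vanishing degrees of freedom is zero. -/
lemma RT_eq_zero [NeZero n] (o : T.Orientation) {k : ℕ} {u : T.L2Vec} (hu : u ∈ T.RT k)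
    (hcell : ∀ K, ∀ P ∈ vecPolyLE n ((k : ℤ) - 1), T.cellDof u K P = 0)
    (hflux : ∀ e, ∀ q ∈ polyLE n k, o.flux u e q = 0) : u = 0 := by
  obtain ⟨a, b, ha, hb, hloc⟩ := exists_isLocal_of_mem_RT hu
  have hU : ∀ K, ContDiff ℝ 1 (fieldOf (rtPoly (a K) (b K))) := fun K => contDiff_fieldOf _
  have hs : ∀ (K : T.Cell) (c : K.1), ∀ x ∈ openFacet (T.cellBasis K) c,
      dcoord (T.cellBasis K) c (fieldOf (rtPoly (a K) (b K)) x) =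
        pval (tracePoly (T.cellBasis K) (a K) (b K) c) x := fun K c x hx => by
    rw [dcoord_rtPoly, hx.1, zero_mul, add_zero]
  have h1 : ∀ (e : T.IntFacet) (c : (o.K₁ e).1), e.1 = (o.K₁ e).1.erase c →
      ∀ x ∈ openFacet (T.cellBasis (o.K₁ e)) c, dcoord (T.cellBasis (o.K₁ e)) c
        (fieldOf (rtPoly (a (o.K₁ e)) (b (o.K₁ e))) x) = 0 := by
    intro e c hc x hx
    -- The normal trace is itself a polynomial of degree at most `k` on the facet, hence an
    -- admissible weight.
    have hz := hflux e _ (tracePoly_mem (β := T.cellBasis (o.K₁ e)) (ha (o.K₁ e)) (hb (o.K₁ e)) c)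
    rw [Orientation.flux, hc, facetIntegral_eq_greenInt hu.1 hloc hU] at hz
    have := sq_mul_eq_zero_of_greenInt c (hU _) (contDiff_pval _) (nice_lift c)
      (fun y hy => (lift_mem (generic_of_mem_openFacet hy).1 c).1)
      (fun i hi y hy => lift_eq_zero hi hy.1) (hs (o.K₁ e) c) hz x hx
    rw [lift_eq_one hx, mul_one] at this
    rw [hs _ _ x hx]
    exact mul_self_eq_zero.1 this
  have h2 : ∀ (K : T.Cell) (c : K.1), ∀ x ∈ openFacet (T.cellBasis K) c,
      dcoord (T.cellBasis K) c (fieldOf (rtPoly (a K) (b K)) x) = 0 := by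
    intro K c
    -- The facet moments are computed from the side of `K₁`. On any other facet, either the only
    -- neighbour is a `K₁` already treated, or the facet lies on the boundary and there is no
    -- neighbour.
    by_cases hK : ∃ e : T.IntFacet, e.1 = K.1.erase c ∧ o.K₁ e = K
    · obtain ⟨e, he, rfl⟩ := hK
      exact h1 e c he
    · intro x hx
      rw [hs K c x hx]
      refine trace_eq_zero_of_neighbours hU
        (fun φ h1 h2 => sum_greenInt_eq_zero hu.1 hloc hU h1 h2) (contDiff_pval _) (hs K c)
        (fun K' hK' c' hc' => ?_) x hx
      obtain ⟨e, he⟩ : ∃ e : T.IntFacet, e.1 = K.1.erase c :=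
        ⟨mkIntFacet hK'.symm c (hc' ▸ Finset.erase_subset _ _), rfl⟩
      have hK₂ : K = o.K₂ e := (o.eq_or_eq e (he ▸ Finset.erase_subset _ _)).resolve_left
        fun h => hK ⟨e, he, h.symm⟩
      have hK₁ : K' = o.K₁ e := (o.eq_or_eq e (by
        rw [he, ← hc']; exact Finset.erase_subset _ _)).resolve_right fun h => hK' (h.trans hK₂.symm)
      subst hK₁
      exact h1 e c' (he.trans hc'.symm)
  refine Lp.ext (T.ae_vol_of_forall fun K => ?_)
  have h3 := rtField_eq_zero (ha K) (hb K) (h2 K) fun P hP => by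
    rw [← cellDof_eq hloc K P]; exact hcell K P hP
  filter_upwards [hloc K, ae_simplex_interior (β := T.cellBasis K),
    ae_simplex_of_ae_vol K (Lp.coeFn_zero (E n) 2 T.vol)] with x e1 e2 e3
  rw [e1, e3, h3 x e2]
  rfl

end Triangulation

end DiscreteFlow

namespace DiscreteFlow

lemma fieldOf_rtPoly_radial {n : ℕ} (v : E n) (q : MvPolynomial (Fin n) ℝ) :
    fieldOf (rtPoly (fun i => -(C (v i) * q)) q) = fun x => pval q x • (x - v) := by
  funext x
  ext i
  simp [fieldOf_apply, rtPoly]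
  ring

lemma contDiff_radial {n : ℕ} (v : E n) (q : MvPolynomial (Fin n) ℝ) :
    ContDiff ℝ 1 fun x : E n => pval q x • (x - v) := (contDiff_pval q).smul (contDiff_sub_vertex v)

lemma rtPoly_zero {n : ℕ} : fieldOf (rtPoly (0 : Fin n → MvPolynomial (Fin n) ℝ) 0) =
    fun _ => (0 : E n) := by
  funext x
  ext i
  simp [fieldOf_apply, rtPoly]

lemma radial_mem_vecPolyLE {n : ℕ} (v : E n) {d : ℤ} {q : MvPolynomial (Fin n) ℝ}
    (hq : q ∈ polyLE n d) : (fun i => -(C (v i) * q)) ∈ vecPolyLE n d := fun _ _ =>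
  Submodule.neg_mem _ (C_mul_mem_polyLE _ hq)

namespace Triangulation

open scoped Classical

variable {n : ℕ} {T : Triangulation n}

/-! ### Unisolvence of the degrees of freedom: surjectivity -/

/-- A Raviart-Thomas field supported in one element with zero normal trace. -/
lemma exists_bubble (o : T.Orientation) {k : ℕ} (K : T.Cell) {P : Fin n → MvPolynomial (Fin n) ℝ}
    (hP : P ∈ vecPolyLE n ((k : ℤ) - 1)) : ∃ u ∈ T.RT k,
      (∀ K', K' ≠ K → ∀ P', T.cellDof u K' P' = 0) ∧ (∀ e q, o.flux u e q = 0) ∧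
      (T.cellDof u K P = 0 → P = 0) := by
  let a : T.Cell → Fin n → MvPolynomial (Fin n) ℝ := fun K' =>
    if K' = K then bubblePoly (T.cellBasis K') P else 0
  let b : T.Cell → MvPolynomial (Fin n) ℝ := fun K' => if K' = K then -radialPoly P else 0
  have hK : fieldOf (rtPoly (a K) (b K)) = bubble (T.cellBasis K) P := by
    simp only [a, b, if_true]; rfl
  have hK' : ∀ K', K' ≠ K → fieldOf (rtPoly (a K') (b K')) = fun _ => 0 := fun K' h => by
    simp only [a, b, if_neg h]; exact rtPoly_zero
  have hU : ∀ K, ContDiff ℝ 1 (fieldOf (rtPoly (a K) (b K))) := fun K => contDiff_fieldOf _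
  have hz : ∀ (K' : T.Cell) (w : E n → ℝ), Nice (T.cellBasis K') w →
      greenInt (T.cellBasis K') (fieldOf (rtPoly (a K') (b K'))) w = 0 := fun K' w hw => by
    by_cases h : K' = K
    · subst h; rw [hK, greenInt_bubble P hw]
    · rw [hK' K' h, greenInt_zero_field]
  obtain ⟨u, hu, hloc⟩ := exists_mem_H0div hU fun φ hφ =>
    Finset.sum_eq_zero fun K' _ => hz K' φ (ContDiff.nice hφ)
  refine ⟨u, mem_RT_of_isLocal hu (fun K' => ?_) (fun K' => ?_) hloc, fun K' h P' => ?_,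
    fun e q => ?_, fun h => ?_⟩
  · by_cases h : K' = K
    · simp only [a, if_pos h]; exact bubblePoly_mem hP
    · simp only [a, if_neg h]; exact Submodule.zero_mem _
  · by_cases h : K' = K
    · simp only [b, if_pos h]; exact radialPoly_mem hP
    · simp only [b, if_neg h]; exact Submodule.zero_mem _
  · rw [cellDof_eq hloc, hK' K' h]
    simp
  · obtain ⟨c, hc⟩ := o.exists_opposite e
    rw [Orientation.flux, hc, facetIntegral_eq_greenInt hu hloc hU, hz _ _ (nice_wLift _ c q)]
  · rw [cellDof_eq hloc, hK] at h
    exact eq_zero_of_integral_bubble h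

/-- The radial field is tangent to every facet through `b`, and the lift from `b'` vanishes on the
remaining one. -/
lemma greenInt_radial_wLift {K : T.Cell} {b b' : K.1} (hb : b' ≠ b) (q q' : MvPolynomial (Fin n) ℝ) :
    greenInt (T.cellBasis K) (fun x => pval q x • (x - b.1)) (wLift K b' q') = 0 := by
  refine greenInt_eq_zero (contDiff_radial _ _) (nice_wLift K b' q')
    fun i x hx => ?_
  by_cases hi : i = b
  · subst hi
    rw [wLift, lift_eq_zero hb.symm hx.1, mul_zero, zero_mul]
  · have h1 := dcoord_sub_vertex (β := T.cellBasis K) i b x hi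
    rw [cellBasis_apply] at h1
    rw [map_smul, h1, hx.1, smul_zero, mul_zero]

/-- The vertices of two elements with a common facet correspond. -/
lemma exists_vertex_equiv {K K' : T.Cell} (b : K.1) (b' : K'.1)
    (he : K'.1.erase b' = K.1.erase b) :
    ∃ σ : K.1 ≃ K'.1, σ b = b' ∧ ∀ i, i ≠ b → i.1 = (σ i).1 := by
  have h1 : ∀ i : K.1, i ≠ b → i.1 ∈ K'.1.erase b' := fun i hi => by
    rw [he]; exact Finset.mem_erase.2 ⟨fun h => hi (Subtype.ext h), i.2⟩
  let f : K.1 → K'.1 := fun i => if h : i = b then b' else ⟨i.1, Finset.mem_of_mem_erase (h1 i h)⟩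
  have hf : ∀ i, i ≠ b → i.1 = (f i).1 := fun i hi => by simp only [f, dif_neg hi]
  have hb : f b = b' := by simp only [f, dif_pos]
  have hinj : Function.Injective f := by
    intro i j hij
    by_cases hi : i = b <;> by_cases hj : j = b
    · rw [hi, hj]
    · rw [hi, hb] at hij
      exact absurd ((hf j hj).trans (congrArg Subtype.val hij).symm)
        (Finset.ne_of_mem_erase (h1 j hj))
    · rw [hj, hb] at hij
      exact absurd ((hf i hi).trans (congrArg Subtype.val hij)) (Finset.ne_of_mem_erase (h1 i hi))
    · exact Subtype.ext ((hf i hi).trans ((congrArg Subtype.val hij).trans (hf j hj).symm))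
  have hcard : Fintype.card K.1 = Fintype.card K'.1 := by
    rw [Fintype.card_coe, Fintype.card_coe, K.2.2, K'.2.2]
  exact ⟨Equiv.ofBijective f ((Fintype.bijective_iff_injective_and_card f).2 ⟨hinj, hcard⟩), hb, hf⟩

/-- A Raviart-Thomas field with zero normal trace on all facets but one. -/
lemma exists_facetField [NeZero n] (o : T.Orientation) {k : ℕ} (e : T.IntFacet)
    {q : MvPolynomial (Fin n) ℝ} (hq : q ∈ polyLE n k) : ∃ u ∈ T.RT k,
      (∀ e', e' ≠ e → ∀ q', o.flux u e' q' = 0) ∧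
      (o.flux u e q = 0 → restrictTo e.1 q = 0) := by
  obtain ⟨b₁, hb₁⟩ := o.exists_opposite e
  obtain ⟨b₂, hb₂⟩ := o.exists_opposite₂ e
  obtain ⟨σ, hσb, hσ⟩ := exists_vertex_equiv b₁ b₂ (hb₂.symm.trans hb₁)
  obtain ⟨c, hc0, hc⟩ := exists_greenInt_transfer (β := T.cellBasis (o.K₁ e))
    (β' := T.cellBasis (o.K₂ e)) σ b₁ hσ
  rw [hσb] at hc
  -- The field is `c q (x - b₁)` on `K₁`, `-q (x - b₂)` on `K₂` and zero elsewhere. Each half has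
  -- flux only through `e`, and the transfer constant `c` makes the two fluxes cancel.
  let v : T.Cell → E n := fun K => if K = o.K₁ e then b₁.1 else b₂.1
  let b : T.Cell → MvPolynomial (Fin n) ℝ := fun K =>
    if K = o.K₁ e then C c * q else if K = o.K₂ e then -q else 0
  let a : T.Cell → Fin n → MvPolynomial (Fin n) ℝ := fun K i => -(C (v K i) * b K)
  have hUK : ∀ K, fieldOf (rtPoly (a K) (b K)) = fun x => pval (b K) x • (x - v K) := fun K =>
    fieldOf_rtPoly_radial (v K) (b K)
  have hU : ∀ K, ContDiff ℝ 1 (fieldOf (rtPoly (a K) (b K))) := fun K => contDiff_fieldOf _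
  have hv₁ : v (o.K₁ e) = b₁.1 := if_pos rfl
  have hv₂ : v (o.K₂ e) = b₂.1 := if_neg (o.ne e).symm
  have hp₁ : b (o.K₁ e) = C c * q := if_pos rfl
  have hp₂ : b (o.K₂ e) = -q := by simp only [b, if_neg (o.ne e).symm, if_true]
  have hp₃ : ∀ K, K ≠ o.K₁ e → K ≠ o.K₂ e → b K = 0 := fun K h1 h2 => by
    simp only [b, if_neg h1, if_neg h2]
  have hb : ∀ K, b K ∈ polyLE n k := fun K => by
    by_cases h1 : K = o.K₁ e
    · rw [h1, hp₁]; exact C_mul_mem_polyLE _ hq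
    · by_cases h2 : K = o.K₂ e
      · rw [h2, hp₂]; exact Submodule.neg_mem _ hq
      · rw [hp₃ K h1 h2]; exact Submodule.zero_mem _
  have hg0 : ∀ K, K ≠ o.K₁ e → K ≠ o.K₂ e → ∀ w : E n → ℝ,
      greenInt (T.cellBasis K) (fieldOf (rtPoly (a K) (b K))) w = 0 := fun K h1 h2 w => by
    have : (fun x => pval (b K) x • (x - v K)) = fun _ => 0 := by
      funext x; rw [hp₃ K h1 h2, pval_zero, zero_smul]
    rw [hUK, this, greenInt_zero_field]
  obtain ⟨u, hu, hloc⟩ := exists_mem_H0div hU fun φ hφ => by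
    have hqφ : ContDiff ℝ 1 (fun x => pval q x * φ x) := (contDiff_pval q).mul hφ
    rw [Finset.sum_eq_add (o.K₁ e) (o.K₂ e) (o.ne e) (fun K _ h => hg0 K h.1 h.2 φ) (by simp)
      (by simp), hUK, hUK, hv₁, hv₂, hp₁, hp₂]
    have e1 : (fun x => pval (C c * q) x • (x - b₁.1)) = fun x => c • (pval q x • (x - b₁.1)) := by
      funext x; rw [pval_mul, pval_C, mul_smul]
    have e2 : (fun x => pval (-q) x • (x - b₂.1)) =
        fun x => (-1 : ℝ) • (pval q x • (x - b₂.1)) := by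
      funext x; rw [pval_neg, neg_smul, neg_one_smul]
    rw [e1, e2, greenInt_const_smul _ (contDiff_radial _ _),
      greenInt_const_smul _ (contDiff_radial _ _),
      greenInt_smul_field (contDiff_sub_vertex _) (contDiff_pval _) (ContDiff.nice hφ),
      greenInt_smul_field (contDiff_sub_vertex _) (contDiff_pval _) (ContDiff.nice hφ)]
    have h3 := hc _ hqφ
    rw [cellBasis_apply, cellBasis_apply] at h3
    rw [h3]
    ring
  refine ⟨u, mem_RT_of_isLocal hu (fun K => radial_mem_vecPolyLE (v K) (hb K)) hb hloc,
    fun e' he' q' => ?_, fun h => ?_⟩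
  · obtain ⟨b', hb'⟩ := o.exists_opposite e'
    rw [Orientation.flux, hb', facetIntegral_eq_greenInt hu hloc hU]
    have hopp : ∀ (K : T.Cell) (c : K.1) (c' : K.1), e.1 = K.1.erase c → e'.1 = K.1.erase c' →
        c' ≠ c := fun K c c' h1 h2 h => he' (Subtype.ext (h2.trans (h ▸ h1.symm)))
    by_cases h1 : o.K₁ e' = o.K₁ e
    · rw [hUK]
      revert b'
      rw [h1, hv₁]
      intro b' hb'
      exact greenInt_radial_wLift (hopp _ _ _ hb₁ hb') _ _
    · by_cases h2 : o.K₁ e' = o.K₂ e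
      · rw [hUK]
        revert b'
        rw [h2, hv₂]
        intro b' hb'
        exact greenInt_radial_wLift (hopp _ _ _ hb₂ hb') _ _
      · exact hg0 _ h1 h2 _
  · rw [Orientation.flux, hb₁, facetIntegral_eq_greenInt hu hloc hU, hUK, hv₁, hp₁] at h
    have e1 : (fun x => pval (C c * q) x • (x - b₁.1)) = fun x => c • (pval q x • (x - b₁.1)) := by
      funext x; rw [pval_mul, pval_C, mul_smul]
    rw [e1, greenInt_const_smul _ (contDiff_radial _ _),
      greenInt_smul_field (contDiff_sub_vertex _) (contDiff_pval _) (nice_wLift _ _ _)] at h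
    have h1 := (mul_eq_zero.1 h).resolve_left hc0.ne'
    have h2 : ∀ x, pval q x * wLift (o.K₁ e) b₁ q x =
        pval q x * pval q x * lift (T.cellBasis (o.K₁ e)) b₁ x := fun x => by
      rw [wLift, mul_assoc]
    -- Weighted with `q` itself, the flux has the nonnegative density `q²` on the facet.
    have h3 := eq_zero_of_greenInt_eq_zero b₁ ((nice_wLift (o.K₁ e) b₁ q).mul (contDiff_pval q))
      (fun x hx => by
        rw [h2, lift_eq_one hx, mul_one]; exact mul_self_nonneg _) h1
    obtain ⟨w, -, hw⟩ := exists_eq_coordPoly_mul b₁ hq fun x hx => by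
      have := h3 x hx
      rw [h2, lift_eq_one hx, mul_one] at this
      exact mul_self_eq_zero.1 this
    have hconv : convexHull ℝ (e.1 : Set (E n)) =
        convexHull ℝ ((o.K₁ e).1.erase b₁ : Set (E n)) := by rw [hb₁]
    funext x
    change pval q x.1 = 0
    rw [hw, pval_mul, pval_coordPoly, ((T.mem_facet_iff _ b₁).1 (hconv.subset x.2)).2, zero_mul]

/-- The degrees of freedom are linearly independent on the Raviart-Thomas space. -/
lemma eq_zero_of_forall_dof_eq_zero [NeZero n] (o : T.Orientation) {k : ℕ}
    {P : T.Cell → Fin n → MvPolynomial (Fin n) ℝ} (hP : ∀ K, P K ∈ vecPolyLE n ((k : ℤ) - 1))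
    {q : T.IntFacet → MvPolynomial (Fin n) ℝ} (hq : ∀ e, q e ∈ polyLE n k)
    (h : ∀ u ∈ T.RT k, ∑ K, T.cellDof u K (P K) + ∑ e, o.flux u e (q e) = 0) :
    (∀ K, P K = 0) ∧ ∀ e, restrictTo e.1 (q e) = 0 := by
  have h1 : ∀ K, P K = 0 := fun K => by
    obtain ⟨u, hu, hu1, hu2, hu3⟩ := exists_bubble o K (hP K)
    refine hu3 ?_
    rw [← h u hu, Finset.sum_eq_single K (fun K' _ h' => hu1 K' h' _) (by simp)]
    simp [hu2]
  refine ⟨h1, fun e => ?_⟩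
  -- The facet field may have nonzero interior moments, which are harmless now that all `P K` are
  -- known to vanish.
  obtain ⟨u, hu, hu1, hu2⟩ := exists_facetField o e (hq e)
  refine hu2 ?_
  have h2 : ∀ K, T.cellDof u K (P K) = 0 := fun K => by
    rw [h1, ← cellDofL_apply, map_zero]
  rw [← h u hu, Finset.sum_eq_zero fun K _ => h2 K, zero_add,
    Finset.sum_eq_single e (fun e' _ h' => hu1 e' h' _) (by simp)]

end Triangulation

end DiscreteFlow

namespace DiscreteFlow

/-! ### Products and gradients of polynomials -/

section Products

variable {n : ℕ}

lemma exists_add_degree_le {m : Fin n →₀ ℕ} {a b : ℕ} (h : m.degree ≤ a + b) :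
    ∃ m₁ m₂ : Fin n →₀ ℕ, m = m₁ + m₂ ∧ m₁.degree ≤ a ∧ m₂.degree ≤ b := by
  by_cases ha : m.degree ≤ a
  · exact ⟨m, 0, (add_zero m).symm, ha, by simp⟩
  · obtain ⟨m₁, hle, hd⟩ := Finsupp.exists_le_degree_eq m a (by omega)
    refine ⟨m₁, m - m₁, (add_tsub_cancel_of_le hle).symm, hd.le, ?_⟩
    have := congrArg Finsupp.degree (add_tsub_cancel_of_le hle)
    rw [map_add] at this
    omega

lemma pderiv_mem_polyLE {d : ℤ} {q : MvPolynomial (Fin n) ℝ} (hq : q ∈ polyLE n d) (i : Fin n) :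
    pderiv i q ∈ polyLE n (d - 1) := by
  have : polyLE n d ≤ (polyLE n (d - 1)).comap (pderiv i).toLinearMap := by
    refine polyLE_induction fun m hm => ?_
    change pderiv i (monomial m 1) ∈ polyLE n (d - 1)
    rw [pderiv_monomial]
    by_cases h0 : m i = 0
    · rw [h0, Nat.cast_zero, mul_zero, monomial_zero]
      exact Submodule.zero_mem _
    · refine monomial_mem_polyLE ?_ _
      have hle : Finsupp.single i 1 ≤ m := by
        rw [Finsupp.single_le_iff]; omega
      have := congrArg Finsupp.degree (tsub_add_cancel_of_le hle)
      rw [map_add, Finsupp.degree_single] at this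
      omega
  exact this hq

/-- Products of two polynomials of degree at most `r` span the polynomials of degree at most
`2r`. -/
lemma polyLE_two_mul_le (r : ℕ) {W : Submodule ℝ (MvPolynomial (Fin n) ℝ)}
    (h : ∀ f ∈ polyLE n r, ∀ g ∈ polyLE n r, f * g ∈ W) : polyLE n (2 * r) ≤ W := by
  refine polyLE_induction fun m hm => ?_
  obtain ⟨m₁, m₂, rfl, h1, h2⟩ := exists_add_degree_le (m := m) (a := r) (b := r) (by omega)
  rw [← one_mul (1 : ℝ), ← monomial_mul]
  exact h _ (monomial_mem_polyLE (by omega) _) _ (monomial_mem_polyLE (by omega) _)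

/-- The field `(∇f) g`. -/
def gradMul (f g : MvPolynomial (Fin n) ℝ) : Fin n → MvPolynomial (Fin n) ℝ :=
  fun i => pderiv i f * g

/-- For `h = u v` this is the antisymmetrization `∇(x_j u) x_i v - ∇(x_i u) x_j v`, in which the
terms containing `∇u` cancel. -/
lemma rotation_mem {r : ℕ} {W : Submodule ℝ (Fin n → MvPolynomial (Fin n) ℝ)}
    (hW : ∀ f ∈ polyLE n r, ∀ g ∈ polyLE n r, gradMul f g ∈ W) (i j : Fin n)
    {h : MvPolynomial (Fin n) ℝ} (hh : h ∈ polyLE n (2 * (r : ℤ) - 2)) :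
    Pi.single j (h * X i) - Pi.single i (h * X j) ∈ W := by
  let L : MvPolynomial (Fin n) ℝ →ₗ[ℝ] (Fin n → MvPolynomial (Fin n) ℝ) :=
    LinearMap.single ℝ (fun _ => MvPolynomial (Fin n) ℝ) j ∘ₗ LinearMap.mulRight ℝ (X i) -
    LinearMap.single ℝ (fun _ => MvPolynomial (Fin n) ℝ) i ∘ₗ LinearMap.mulRight ℝ (X j)
  have hL : ∀ h, L h = Pi.single j (h * X i) - Pi.single i (h * X j) := fun h => rfl
  rw [← hL]
  have : polyLE n (2 * (r : ℤ) - 2) ≤ W.comap L := by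
    refine polyLE_induction fun m hm => ?_
    -- For `r = 0` the degree bound is negative and there is no monomial to treat.
    have hr : 1 ≤ r := by
      have : (0 : ℤ) ≤ m.degree := by positivity
      omega
    obtain ⟨m₁, m₂, rfl, h1, h2⟩ := exists_add_degree_le (m := m) (a := r - 1) (b := r - 1)
      (by omega)
    have hm₁ : monomial m₁ (1 : ℝ) ∈ polyLE n ((r : ℤ) - 1) := monomial_mem_polyLE (by omega) _
    have hm₂ : monomial m₂ (1 : ℝ) ∈ polyLE n ((r : ℤ) - 1) := monomial_mem_polyLE (by omega) _
    change L _ ∈ W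
    have key : ∀ u v : MvPolynomial (Fin n) ℝ, L (u * v) =
        gradMul (X j * u) (X i * v) - gradMul (X i * u) (X j * v) := fun u v => by
      rw [hL]
      funext l
      have hX : ∀ c : Fin n, (Pi.single l 1 : Fin n → MvPolynomial (Fin n) ℝ) c =
          if l = c then 1 else 0 := fun c => by rw [Pi.single_apply]; simp only [eq_comm]
      simp only [gradMul, Pi.sub_apply, Derivation.leibniz, smul_eq_mul, pderiv_X, hX]
      simp only [Pi.single_apply]
      split_ifs <;> ring
    rw [← one_mul (1 : ℝ), ← monomial_mul, key]
    have hX : ∀ (c : Fin n) {q}, q ∈ polyLE n ((r : ℤ) - 1) → X c * q ∈ polyLE n r := fun c q hq =>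
      mul_mem_polyLE (X_mem_polyLE c le_rfl) hq (by omega)
    exact Submodule.sub_mem _ (hW _ (hX _ hm₁) _ (hX _ hm₂)) (hW _ (hX _ hm₁) _ (hX _ hm₂))
  exact this hh

/-- The fields `(∇f) g` with `f` and `g` of degree at most `r` span the polynomial fields of degree
at most `2r - 1`. -/
lemma vecPolyLE_le {r : ℕ} {W : Submodule ℝ (Fin n → MvPolynomial (Fin n) ℝ)}
    (hW : ∀ f ∈ polyLE n r, ∀ g ∈ polyLE n r, gradMul f g ∈ W) :
    vecPolyLE n (2 * (r : ℤ) - 1) ≤ W := by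
  have hmon : ∀ i, polyLE n (2 * (r : ℤ) - 1) ≤
      W.comap (LinearMap.single ℝ (fun _ => MvPolynomial (Fin n) ℝ) i) := fun i => by
    refine polyLE_induction fun m hm => ?_
    have hr : 1 ≤ r := by
      have : (0 : ℤ) ≤ m.degree := by positivity
      omega
    obtain ⟨m₁, m₂, rfl, h1, h2⟩ := exists_add_degree_le (m := m) (a := r - 1) (b := r) (by omega)
    set u : MvPolynomial (Fin n) ℝ := monomial m₁ 1 with hu
    set v : MvPolynomial (Fin n) ℝ := monomial m₂ 1 with hv
    have huP : u ∈ polyLE n ((r : ℤ) - 1) := monomial_mem_polyLE (by omega) _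
    have hvP : v ∈ polyLE n r := monomial_mem_polyLE (by omega) _
    have huv : monomial (m₁ + m₂) (1 : ℝ) = u * v := by rw [hu, hv, monomial_mul, one_mul]
    change Pi.single i (monomial (m₁ + m₂) (1 : ℝ)) ∈ W
    rw [huv]
    have heuler : ∑ j, X j * pderiv j u = (m₁.degree : ℝ) • u := by
      rw [hu]
      simp_rw [X_mul_pderiv_monomial]
      rw [← Finset.sum_smul, Finsupp.degree_eq_sum, Nat.cast_smul_eq_nsmul]
    -- `∇(x_i u) v` equals `u v e_i + x_i v ∇u`. Modulo rotation fields the last term becomes `v (x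
    -- · ∇u) e_i`, which is `deg u` times `u v e_i` by Euler's identity.
    have key : (1 + (m₁.degree : ℝ)) • (Pi.single i (u * v) : Fin n → MvPolynomial (Fin n) ℝ) =
        gradMul (X i * u) v -
          ∑ j, (Pi.single j ((v * pderiv j u) * X i) - Pi.single i ((v * pderiv j u) * X j)) := by
      have h3 : ∑ j, (Pi.single i ((v * pderiv j u) * X j) : Fin n → MvPolynomial (Fin n) ℝ) =
          Pi.single i ((m₁.degree : ℝ) • (u * v)) := by
        have := map_sum (LinearMap.single ℝ (fun _ : Fin n => MvPolynomial (Fin n) ℝ) i)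
          (fun j => (v * pderiv j u) * X j) Finset.univ
        refine this.symm.trans ?_
        rw [LinearMap.coe_single]
        congr 1
        rw [← smul_mul_assoc, ← heuler, Finset.sum_mul]
        exact Finset.sum_congr rfl fun j _ => by ring
      rw [Finset.sum_sub_distrib, h3, add_smul, one_smul, ← Pi.single_smul]
      have h4 : ∑ j, (Pi.single j ((v * pderiv j u) * X i) : Fin n → MvPolynomial (Fin n) ℝ) =
          fun j => (v * pderiv j u) * X i := by
        rw [Finset.univ_sum_single]
      have h5 : gradMul (X i * u) v = Pi.single i (u * v) + fun j => (v * pderiv j u) * X i := by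
        funext l
        simp only [gradMul, Pi.add_apply, Derivation.leibniz, smul_eq_mul, pderiv_X]
        by_cases hi : l = i
        · subst hi; simp; ring
        · simp [hi, Ne.symm hi]; ring
      rw [h4, h5]
      abel
    have hpos : (1 + (m₁.degree : ℝ)) ≠ 0 := by positivity
    refine (Submodule.smul_mem_iff _ hpos).1 (key ▸ Submodule.sub_mem _
      (hW _ (mul_mem_polyLE (X_mem_polyLE i le_rfl) huP (by omega)) _ hvP)
      (Submodule.sum_mem _ fun j _ => rotation_mem hW i j ?_))
    exact mul_mem_polyLE hvP (pderiv_mem_polyLE huP j) (by omega)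
  intro P hP
  rw [← Finset.univ_sum_single P]
  exact Submodule.sum_mem _ fun i _ => hmon i (hP i trivial)

end Products

namespace Triangulation

open scoped Classical

variable {n : ℕ} {T : Triangulation n} {r : ℕ}

/-! ### Tensors of discontinuous piecewise polynomials -/

/-- There are functions in `V_h^r` with any given polynomials on the elements. -/
lemma exists_loc_eq (f : T.Cell → MvPolynomial (Fin n) ℝ) (hf : ∀ K, f K ∈ polyLE n r) :
    ∃ F : T.V r, ∀ K, T.loc F K = f K := by
  obtain ⟨F, hF⟩ := exists_piecewise (T := T) fun K => continuous_pval (f K)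
  have h : ∀ K, T.EqPolyOn F K (f K) := fun K => (T.ae_vol_iff K).2 (hF K)
  exact ⟨⟨F, fun K => ⟨f K, hf K, h K⟩⟩, fun K => loc_eq (h K)⟩

lemma exists_loc_single (K : T.Cell) {f : MvPolynomial (Fin n) ℝ} (hf : f ∈ polyLE n r) :
    ∃ F : T.V r, T.loc F K = f ∧ ∀ K', K' ≠ K → T.loc F K' = 0 := by
  obtain ⟨F, hF⟩ := exists_loc_eq (T := T) (r := r) (Pi.single K f) fun K' => by
    by_cases h : K' = K
    · subst h; rwa [Pi.single_eq_same]
    · rw [Pi.single_eq_of_ne h]; exact Submodule.zero_mem _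
  exact ⟨F, by rw [hF, Pi.single_eq_same], fun K' h => by rw [hF, Pi.single_eq_of_ne h]⟩

namespace Orientation

variable (o : T.Orientation)

/-- The image of `f ⊗ g`. -/
def tensorImage (f g : T.V r) : (T.Cell → Fin n → MvPolynomial (Fin n) ℝ) ×
    (∀ e : T.IntFacet, convexHull ℝ (e.1 : Set (E n)) → ℝ) :=
  (fun K => gradMul (T.loc f K) (T.loc g K),
    fun e => restrictTo e.1 (-(o.jump f e * o.avg g e)))

lemma tensorImage_smul (c : ℝ) (f g : T.V r) : o.tensorImage (c • f) g = c • o.tensorImage f g := by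
  refine Prod.ext ?_ ?_
  · funext K i
    simp [tensorImage, gradMul, loc_smul]
  · funext e
    simp only [tensorImage, Prod.smul_snd, Pi.smul_apply]
    rw [← map_smul, ← o.jumpL_apply, map_smul, o.jumpL_apply, smul_mul_assoc, smul_neg]

lemma sum_tensorImage {N : ℕ} (f g : Fin N → T.V r) :
    ∑ j, o.tensorImage (f j) (g j) = (cellImage f g, o.facetImage f g) := by
  refine Prod.ext ?_ ?_
  · funext K i
    simp [tensorImage, gradMul, cellImage, Prod.fst_sum]
  · funext e
    simp only [tensorImage, facetImage, Prod.snd_sum, Finset.sum_apply]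
    rw [← map_sum, Finset.sum_neg_distrib]

variable (r) in
/-- The image of `V_h^r ⊗ V_h^r`. -/
def imageSpan : Submodule ℝ ((T.Cell → Fin n → MvPolynomial (Fin n) ℝ) ×
    (∀ e : T.IntFacet, convexHull ℝ (e.1 : Set (E n)) → ℝ)) :=
  Submodule.span ℝ (Set.range fun fg : T.V r × T.V r => o.tensorImage fg.1 fg.2)

lemma tensorImage_mem (f g : T.V r) : o.tensorImage f g ∈ o.imageSpan r :=
  Submodule.subset_span ⟨(f, g), rfl⟩

/-- Scalars are absorbed into the first factors, and sums become concatenated families. -/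
lemma exists_sum_tensorImage {z} (hz : z ∈ o.imageSpan r) :
    ∃ (N : ℕ) (f g : Fin N → T.V r), (cellImage f g, o.facetImage f g) = z := by
  simp_rw [← o.sum_tensorImage]
  refine Submodule.span_induction ?_ ?_ ?_ ?_ hz
  · rintro _ ⟨⟨f, g⟩, rfl⟩
    exact ⟨1, fun _ => f, fun _ => g, by simp⟩
  · exact ⟨0, Fin.elim0, Fin.elim0, by simp⟩
  · rintro x y - - ⟨N, f, g, rfl⟩ ⟨N', f', g', rfl⟩
    exact ⟨N + N', Fin.append f f', Fin.append g g', by simp [Fin.sum_univ_add]⟩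
  · rintro c x - ⟨N, f, g, rfl⟩
    exact ⟨N, fun j => c • f j, g, by simp_rw [tensorImage_smul, Finset.smul_sum]⟩

/-- Distinct facets are not shared by the same elements. -/
lemma facet_eq_of_subset (e e' : T.IntFacet) (h1 : e'.1 ⊆ (o.K₁ e).1) (h2 : e'.1 ⊆ (o.K₂ e).1) :
    e' = e := by
  have hcard : ((o.K₁ e).1 ∩ (o.K₂ e).1).card ≤ n := by
    obtain ⟨b, hb⟩ := T.exists_mem_notMem (o.ne e)
    have hsub : (o.K₁ e).1 ∩ (o.K₂ e).1 ⊆ (o.K₁ e).1.erase b := fun x hx =>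
      Finset.mem_erase.2 ⟨fun h => hb (h ▸ (Finset.mem_inter.1 hx).2), (Finset.mem_inter.1 hx).1⟩
    refine (Finset.card_le_card hsub).trans ?_
    rw [Finset.card_erase_of_mem b.2, (o.K₁ e).2.2]; rfl
  have h3 : ∀ ε : T.IntFacet, ε.1 ⊆ (o.K₁ e).1 → ε.1 ⊆ (o.K₂ e).1 →
      ε.1 = (o.K₁ e).1 ∩ (o.K₂ e).1 := fun ε h h' =>
    Finset.eq_of_subset_of_card_le (Finset.subset_inter h h') (by rw [ε.2.2.1]; exact hcard)
  exact Subtype.ext ((h3 e' h1 h2).trans (h3 e (o.sub₁ e) (o.sub₂ e)).symm)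

/-- Take `F` supported in `K₁` and `G` in `K₂`. Then `(∇F) G` vanishes on every element, and a facet
sees both functions only if it borders both elements, that is, only if it is `e`. -/
lemma single_facet_mem (e : T.IntFacet) {q : convexHull ℝ (e.1 : Set (E n)) → ℝ}
    (hq : q ∈ facetPoly e.1 (2 * (r : ℤ))) : (0, Pi.single e q) ∈ o.imageSpan r := by
  let L : MvPolynomial (Fin n) ℝ →ₗ[ℝ] (T.Cell → Fin n → MvPolynomial (Fin n) ℝ) ×
      (∀ e : T.IntFacet, convexHull ℝ (e.1 : Set (E n)) → ℝ) :=
    LinearMap.inr ℝ _ _ ∘ₗ LinearMap.single ℝ _ e ∘ₗ restrictTo e.1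
  obtain ⟨p, hp, rfl⟩ := hq
  have h : polyLE n (2 * (r : ℤ)) ≤ (o.imageSpan r).comap L := by
    refine polyLE_two_mul_le r fun f hf g hg => ?_
    obtain ⟨F, hF, hF'⟩ := exists_loc_single (r := r) (o.K₁ e) hf
    obtain ⟨G, hG, hG'⟩ := exists_loc_single (r := r) (o.K₂ e) hg
    -- On `e` the jump of `F` is `f` and the average of `G` is `g / 2`; the sign is the one in the
    -- facet component.
    have key : L (f * g) = (-2 : ℝ) • o.tensorImage F G := by
      refine Prod.ext ?_ ?_
      · funext K i
        change (0 : MvPolynomial (Fin n) ℝ) = (-2 : ℝ) • (pderiv i (T.loc F K) * T.loc G K)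
        by_cases h : K = o.K₁ e
        · rw [h, hG' _ (o.ne e), mul_zero, smul_zero]
        · rw [hF' K h, map_zero, zero_mul, smul_zero]
      · funext e'
        change (Pi.single e (restrictTo e.1 (f * g)) :
          ∀ e : T.IntFacet, convexHull ℝ (e.1 : Set (E n)) → ℝ) e' =
          (-2 : ℝ) • restrictTo e'.1 (-(o.jump F e' * o.avg G e'))
        rw [← map_smul]
        by_cases he : e' = e
        · subst he
          rw [Pi.single_eq_same, jump, avg, hF, hG, hF' _ (o.ne e').symm, hG' _ (o.ne e'), zero_add,
            sub_zero, mul_smul_comm, ← smul_neg, smul_smul, smul_neg, ← neg_smul]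
          norm_num
        · rw [Pi.single_eq_of_ne he]
          by_cases hA : o.K₁ e' ≠ o.K₁ e ∧ o.K₂ e' ≠ o.K₁ e
          · rw [jump, hF' _ hA.1, hF' _ hA.2]; simp
          · by_cases hB : o.K₁ e' ≠ o.K₂ e ∧ o.K₂ e' ≠ o.K₂ e
            · rw [avg, hG' _ hB.1, hG' _ hB.2]; simp
            · have hor : ∀ K : T.Cell, ¬(o.K₁ e' ≠ K ∧ o.K₂ e' ≠ K) → e'.1 ⊆ K.1 := fun K h => by
                by_cases h1 : o.K₁ e' = K
                · exact h1 ▸ o.sub₁ e'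
                · by_cases h2 : o.K₂ e' = K
                  · exact h2 ▸ o.sub₂ e'
                  · exact absurd ⟨h1, h2⟩ h
              exact absurd (o.facet_eq_of_subset e e' (hor _ hA) (hor _ hB)) he
    change L (f * g) ∈ o.imageSpan r
    rw [key]
    exact Submodule.smul_mem _ _ (o.tensorImage_mem F G)
  exact h hp

lemma facet_mem {q : ∀ e : T.IntFacet, convexHull ℝ (e.1 : Set (E n)) → ℝ}
    (hq : ∀ e, q e ∈ facetPoly e.1 (2 * (r : ℤ))) : (0, q) ∈ o.imageSpan r := by
  have h : ((0, q) : (T.Cell → Fin n → MvPolynomial (Fin n) ℝ) ×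
      (∀ e : T.IntFacet, convexHull ℝ (e.1 : Set (E n)) → ℝ)) = ∑ e, (0, Pi.single e (q e)) := by
    refine Prod.ext ?_ ?_
    · simp [Prod.fst_sum]
    · rw [Prod.snd_sum, Finset.univ_sum_single]
  rw [h]
  exact Submodule.sum_mem _ fun e _ => o.single_facet_mem e (hq e)

lemma jump_mem (f : T.V r) (e : T.IntFacet) : o.jump f e ∈ polyLE n r :=
  Submodule.sub_mem _ (loc_mem f _) (loc_mem f _)

lemma avg_mem (f : T.V r) (e : T.IntFacet) : o.avg f e ∈ polyLE n r :=
  Submodule.smul_mem _ _ (Submodule.add_mem _ (loc_mem f _) (loc_mem f _))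

/-- Functions supported in `K` give `(∇f) g` there, together with facet terms of degree at most
`2r`, which `facet_mem` allows to be subtracted. -/
lemma single_cell_mem (K : T.Cell) {P : Fin n → MvPolynomial (Fin n) ℝ}
    (hP : P ∈ vecPolyLE n (2 * (r : ℤ) - 1)) : (Pi.single K P, 0) ∈ o.imageSpan r := by
  let L : (Fin n → MvPolynomial (Fin n) ℝ) →ₗ[ℝ] (T.Cell → Fin n → MvPolynomial (Fin n) ℝ) ×
      (∀ e : T.IntFacet, convexHull ℝ (e.1 : Set (E n)) → ℝ) :=
    LinearMap.inl ℝ _ _ ∘ₗ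
      LinearMap.single ℝ (fun _ : T.Cell => Fin n → MvPolynomial (Fin n) ℝ) K
  have h : vecPolyLE n (2 * (r : ℤ) - 1) ≤ (o.imageSpan r).comap L := by
    refine vecPolyLE_le fun f hf g hg => ?_
    obtain ⟨F, hF, hF'⟩ := exists_loc_single (r := r) K hf
    obtain ⟨G, hG, -⟩ := exists_loc_single (r := r) K hg
    have key : L (gradMul f g) = o.tensorImage F G - (0, (o.tensorImage F G).2) := by
      refine Prod.ext ?_ ?_
      · funext K'
        change (Pi.single K (gradMul f g) : T.Cell → Fin n → MvPolynomial (Fin n) ℝ) K' =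
          gradMul (T.loc F K') (T.loc G K') - 0
        by_cases h : K' = K
        · subst h; rw [Pi.single_eq_same, hF, hG, sub_zero]
        · rw [Pi.single_eq_of_ne h, hF' _ h]
          funext i; simp [gradMul]
      · exact (sub_self _).symm
    change L (gradMul f g) ∈ o.imageSpan r
    rw [key]
    refine Submodule.sub_mem _ (o.tensorImage_mem F G) (o.facet_mem fun e => ⟨_, ?_, rfl⟩)
    exact Submodule.neg_mem _ (mul_mem_polyLE (o.jump_mem F e) (o.avg_mem G e) (by omega))
  exact h hP

lemma exists_imageIsCell (K : T.Cell) {P : Fin n → MvPolynomial (Fin n) ℝ}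
    (hP : P ∈ vecPolyLE n (2 * (r : ℤ) - 1)) :
    ∃ (N : ℕ) (f g : Fin N → T.V r), o.ImageIsCell f g K P := by
  obtain ⟨N, f, g, h⟩ := o.exists_sum_tensorImage (o.single_cell_mem K hP)
  have h1 : cellImage f g = Pi.single K P := congrArg Prod.fst h
  have h2 : o.facetImage f g = 0 := congrArg Prod.snd h
  refine ⟨N, f, g, ?_, fun K' hK' => ?_, fun e => congrFun h2 e⟩
  · rw [h1, Pi.single_eq_same]
  · rw [h1, Pi.single_eq_of_ne hK']

lemma exists_imageIsFacet (e : T.IntFacet) {q : convexHull ℝ (e.1 : Set (E n)) → ℝ}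
    (hq : q ∈ facetPoly e.1 (2 * (r : ℤ))) :
    ∃ (N : ℕ) (f g : Fin N → T.V r), o.ImageIsFacet f g e q := by
  obtain ⟨N, f, g, h⟩ := o.exists_sum_tensorImage (o.single_facet_mem e hq)
  have h1 : cellImage f g = 0 := congrArg Prod.fst h
  have h2 : o.facetImage f g = Pi.single e q := congrArg Prod.snd h
  refine ⟨N, f, g, fun K => congrFun h1 K, ?_, fun e' he' => ?_⟩
  · rw [h2, Pi.single_eq_same]
  · rw [h2, Pi.single_eq_of_ne he']

end Orientation

end Triangulation

end DiscreteFlow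

namespace DiscreteFlow

namespace Triangulation

namespace Orientation

variable {n : ℕ} {T : Triangulation n} (o : T.Orientation) {r : ℕ} {p : ℝ≥0∞}

/-! ### The operators `A_u` and the degrees of freedom -/

lemma flux_zero (hp : 2 < p) {u : T.L2Vec} (hu : u ∈ T.H0divLp p) (e : T.IntFacet) :
    o.flux u e 0 = 0 := by
  rw [← o.fluxL_apply hp e ⟨u, hu⟩, map_zero]

lemma cellDof_zero (u : T.L2Vec) (K : T.Cell) : T.cellDof u K 0 = 0 := by
  rw [← cellDofL_apply, map_zero]

lemma sum_form (hp : 2 < p) {u : T.L2Vec} (hu : u ∈ T.H0divLp p) {N : ℕ} (f g : Fin N → T.V r) :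
    ∑ j, o.form u (f j) (g j) = ∑ K, T.cellDof u K (cellImage f g K) +
      ∑ e, o.flux u e (-∑ j, o.jump (f j) e * o.avg (g j) e) := by
  have h1 : ∀ K, T.cellDof u K (cellImage f g K) =
      ∑ j, T.cellDofL K u (gradMul (T.loc (f j) K) (T.loc (g j) K)) := fun K => by
    rw [← map_sum, cellDofL_apply]
    congr 1
    funext i
    rw [Finset.sum_apply]
    rfl
  have h2 : ∀ e, o.flux u e (-∑ j, o.jump (f j) e * o.avg (g j) e) =
      -∑ j, o.fluxL hp e ⟨u, hu⟩ (o.jump (f j) e * o.avg (g j) e) := fun e => by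
    rw [← map_sum, ← map_neg, fluxL_apply]
  simp_rw [h1, h2]
  rw [Finset.sum_comm, Finset.sum_neg_distrib, Finset.sum_comm (s := (Finset.univ : Finset T.IntFacet)),
    ← sub_eq_add_neg, ← Finset.sum_sub_distrib]
  exact Finset.sum_congr rfl fun j _ => o.form_eq_fluxL hp ⟨u, hu⟩ (f j) (g j)

/-- The form factors through the image of the tensor. The facet component is known only as a
function on each facet, so the independence of the facet integral from the extension is needed. -/
lemma sum_inner_of_imageIsCell [NeZero n] (hp : 2 < p) {u : T.L2Vec} (hu : u ∈ T.H0divLp p) {N : ℕ}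
    {f g : Fin N → T.V r} {K : T.Cell} {P : Fin n → MvPolynomial (Fin n) ℝ}
    (h : o.ImageIsCell f g K P) :
    ∑ j, ⟪o.derivation r u (f j), g j⟫ = T.cellDof u K P := by
  rw [Finset.sum_congr rfl fun j _ => o.isDerivation_derivation hp hu (f j) (g j),
    o.sum_form hp hu, Finset.sum_eq_single K (fun K' _ h' => by
      rw [h.2.1 K' h', cellDof_zero]) (by simp), h.1, Finset.sum_eq_zero, add_zero]
  intro e _
  rw [o.flux_congr hp hu e (q' := 0), o.flux_zero hp hu]
  rw [map_zero]
  exact h.2.2 e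

lemma sum_inner_of_imageIsFacet [NeZero n] (hp : 2 < p) {u : T.L2Vec} (hu : u ∈ T.H0divLp p)
    {N : ℕ} {f g : Fin N → T.V r} {e : T.IntFacet} {Q : MvPolynomial (Fin n) ℝ}
    (h : o.ImageIsFacet f g e (restrictTo e.1 Q)) :
    ∑ j, ⟪o.derivation r u (f j), g j⟫ = o.flux u e Q := by
  rw [Finset.sum_congr rfl fun j _ => o.isDerivation_derivation hp hu (f j) (g j),
    o.sum_form hp hu, Finset.sum_eq_zero fun K _ => by rw [h.1 K, cellDof_zero], zero_add,
    Finset.sum_eq_single e (fun e' _ h' => ?_) (by simp)]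
  · exact o.flux_congr hp hu e h.2.1
  · rw [o.flux_congr hp hu e' (q' := 0), o.flux_zero hp hu]
    rw [map_zero]
    exact h.2.2 e' h'

/-- `u ↦ A_u` is injective on the Raviart-Thomas space. -/
lemma RT_eq_zero_of_derivation_eq_zero [NeZero n] (hp : 2 < p) {u : T.L2Vec}
    (hu : u ∈ T.RT (2 * r)) (h : o.derivation r u = 0) : u = 0 := by
  have hu' := T.RT_le_H0divLp (2 * r) p hu
  refine RT_eq_zero o hu (fun K P hP => ?_) fun e q hq => ?_
  · obtain ⟨N, f, g, hfg⟩ := o.exists_imageIsCell (r := r) K (P := P) (by simpa using hP)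
    rw [← o.sum_inner_of_imageIsCell hp hu' hfg, h]
    simp
  · obtain ⟨N, f, g, hfg⟩ := o.exists_imageIsFacet (r := r) e (q := restrictTo e.1 q)
      ⟨q, by simpa using hq, rfl⟩
    rw [← o.sum_inner_of_imageIsFacet hp hu' hfg, h]
    simp

/-- `A_u` is determined by the degrees of freedom of `u`. -/
lemma derivation_eq_zero (hp : 2 < p) {u : T.L2Vec} (hu : u ∈ T.H0divLp p)
    (hcell : ∀ K, ∀ P ∈ vecPolyLE n (2 * (r : ℤ) - 1), T.cellDof u K P = 0)
    (hflux : ∀ e, ∀ q ∈ polyLE n (2 * (r : ℤ)), o.flux u e q = 0) : o.derivation r u = 0 := by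
  refine LinearMap.ext fun f => ext_inner_right ℝ fun g => ?_
  rw [o.isDerivation_derivation hp hu f g, form_eq, LinearMap.zero_apply, inner_zero_left,
    Finset.sum_eq_zero fun K _ => hcell K _ fun i _ => ?_, Finset.sum_eq_zero fun e _ => hflux e _ ?_,
    sub_zero]
  · exact mul_mem_polyLE (o.jump_mem f e) (o.avg_mem g e) (by omega)
  · exact mul_mem_polyLE (pderiv_mem_polyLE (loc_mem f K) i) (loc_mem g K) (by omega)

/-! ### The basis of degrees of freedom -/

variable {ι : T.Cell → Type*} {κ : T.IntFacet → Type*}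

/-- The degrees of freedom given by families of polynomials. -/
def dofL (hp : 2 < p) (P : ∀ K, ι K → Fin n → MvPolynomial (Fin n) ℝ)
    (Q : ∀ e, κ e → MvPolynomial (Fin n) ℝ) :
    T.H0divLp p →ₗ[ℝ] (((Σ K, ι K) ⊕ (Σ e, κ e)) → ℝ) :=
  LinearMap.pi (Sum.elim
    (fun i => (T.cellDofL i.1).flip (P i.1 i.2) ∘ₗ (T.H0divLp p).subtype)
    (fun i => (o.fluxL hp i.1).flip (Q i.1 i.2)))

lemma dofL_inr (hp : 2 < p) (P : ∀ K, ι K → Fin n → MvPolynomial (Fin n) ℝ)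
    (Q : ∀ e, κ e → MvPolynomial (Fin n) ℝ) (u : T.H0divLp p) (e : T.IntFacet) (β : κ e) :
    o.dofL hp P Q u (Sum.inr ⟨e, β⟩) = o.flux u e (Q e β) := rfl

variable [∀ K, Fintype (ι K)] [∀ e, Fintype (κ e)]
  (P : ∀ K, Module.Basis (ι K) ℝ (vecPolyLE n (2 * (r : ℤ) - 1)))
  (q : ∀ e : T.IntFacet, Module.Basis (κ e) ℝ (facetPoly e.1 (2 * (r : ℤ))))
  {Q : ∀ e, κ e → MvPolynomial (Fin n) ℝ} (hQ : ∀ e β, restrictTo e.1 (Q e β) = q e β)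

omit [∀ K, Fintype (ι K)] in
include hQ in
/-- If the degrees of freedom given by bases vanish, then so do all degrees of freedom. -/
lemma dof_eq_zero_of_dofL_eq_zero [NeZero n] (hp : 2 < p) {u : T.H0divLp p}
    (hu : o.dofL hp (fun K α => (P K α : Fin n → MvPolynomial (Fin n) ℝ)) Q u = 0) :
    (∀ K, ∀ P ∈ vecPolyLE n (2 * (r : ℤ) - 1), T.cellDof u K P = 0) ∧
    (∀ e, ∀ q ∈ polyLE n (2 * (r : ℤ)), o.flux (u : T.L2Vec) e q = 0) := by
  refine ⟨fun K P' hP' => ?_, fun e q' hq' => ?_⟩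
  · have h : (T.cellDofL K u).domRestrict (vecPolyLE n (2 * (r : ℤ) - 1)) = 0 :=
      (P K).ext fun α => congrFun hu (Sum.inl ⟨K, α⟩)
    exact LinearMap.congr_fun h ⟨P', hP'⟩
  · let y : facetPoly e.1 (2 * (r : ℤ)) := ⟨restrictTo e.1 q', q', hq', rfl⟩
    have h1 : restrictTo e.1 q' = restrictTo e.1 (∑ β, (q e).repr y β • Q e β) := by
      rw [map_sum]
      simp_rw [map_smul, hQ]
      have := congrArg Subtype.val ((q e).sum_repr y)
      rw [Submodule.coe_sum] at this
      exact this.symm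
    rw [o.flux_congr hp u.2 e h1, ← o.fluxL_apply hp e u, map_sum]
    refine Finset.sum_eq_zero fun β _ => ?_
    rw [map_smul, fluxL_apply, ← o.dofL_inr hp (fun K α => (P K α : Fin n → MvPolynomial (Fin n) ℝ)) Q,
      hu]
    simp

-- `Q e β` is an arbitrary extension, possibly of higher degree; here it is exchanged for one of
-- degree at most `2r`.
omit [∀ e, Fintype (κ e)] in
include hQ in
lemma mem_polyLE_of_restrictTo : ∀ e β, ∃ q' ∈ polyLE n (2 * (r : ℤ)),
    restrictTo e.1 q' = restrictTo e.1 (Q e β) := fun e β => by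
  obtain ⟨q', hq', h⟩ := (q e β).2
  exact ⟨q', hq', h.trans (hQ e β).symm⟩

include hQ in
/-- The degrees of freedom form a basis of the dual of the Raviart-Thomas space. -/
lemma dofL_bijective [NeZero n] (hp : 2 < p) : Function.Bijective
    (o.dofL hp (fun K α => (P K α : Fin n → MvPolynomial (Fin n) ℝ)) Q ∘ₗ
      Submodule.inclusion (T.RT_le_H0divLp (2 * r) p)) := by
  classical
  set D := o.dofL hp (fun K α => (P K α : Fin n → MvPolynomial (Fin n) ℝ)) Q ∘ₗ
      Submodule.inclusion (T.RT_le_H0divLp (2 * r) p) with hD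
  constructor
  · rw [← LinearMap.ker_eq_bot, LinearMap.ker_eq_bot']
    intro u hu
    obtain ⟨h1, h2⟩ := o.dof_eq_zero_of_dofL_eq_zero P q hQ hp hu
    exact Subtype.ext (RT_eq_zero o u.2 (by simpa using h1) (by simpa using h2))
  · rw [← LinearMap.range_eq_top]
    by_contra hne
    -- A functional annihilating the range is a linear relation between the degrees of freedom on
    -- the Raviart-Thomas space; its coefficients assemble into one polynomial datum per element and
    -- per facet.
    obtain ⟨f, hf0, hf⟩ := Submodule.exists_le_ker_of_lt_top _ (lt_top_iff_ne_top.2 hne)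
    let c : ((Σ K, ι K) ⊕ (Σ e, κ e)) → ℝ := fun i => f (Pi.single i 1)
    have hfc : ∀ y, f y = ∑ i, c i * y i := fun y => by
      conv_lhs => rw [← Finset.univ_sum_single y]
      rw [map_sum]
      refine Finset.sum_congr rfl fun i _ => ?_
      have : (Pi.single i (y i) : ((Σ K, ι K) ⊕ (Σ e, κ e)) → ℝ) = y i • Pi.single i 1 := by
        rw [← Pi.single_smul, smul_eq_mul, mul_one]
      rw [this, map_smul, smul_eq_mul, mul_comm]
    choose Q' hQ'mem hQ' using mem_polyLE_of_restrictTo q hQ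
    obtain ⟨h1, h2⟩ := eq_zero_of_forall_dof_eq_zero o (k := 2 * r)
      (P := fun K => ∑ α, c (Sum.inl ⟨K, α⟩) • (P K α : Fin n → MvPolynomial (Fin n) ℝ))
      (fun K => Submodule.sum_mem _ fun α _ => Submodule.smul_mem _ _ (by simp))
      (q := fun e => ∑ β, c (Sum.inr ⟨e, β⟩) • Q' e β)
      (fun e => Submodule.sum_mem _ fun β _ => Submodule.smul_mem _ _ (by
        simpa using hQ'mem e β)) (fun u hu => by
      have hu' := T.RT_le_H0divLp (2 * r) p hu
      have h3 : f (D ⟨u, hu⟩) = 0 := hf ⟨⟨u, hu⟩, rfl⟩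
      rw [hfc, Fintype.sum_sum_type, Fintype.sum_sigma, Fintype.sum_sigma] at h3
      rw [← h3]
      congr 1
      · refine Finset.sum_congr rfl fun K _ => ?_
        rw [← cellDofL_apply, map_sum]
        exact Finset.sum_congr rfl fun α _ => by rw [map_smul]; rfl
      · refine Finset.sum_congr rfl fun e _ => ?_
        rw [← o.fluxL_apply hp e ⟨u, hu'⟩, map_sum]
        refine Finset.sum_congr rfl fun β _ => ?_
        rw [map_smul, fluxL_apply, o.flux_congr hp hu' e (hQ' e β)]
        rfl)
    refine hf0 (LinearMap.ext fun y => ?_)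
    have hc : ∀ i, c i = 0 := by
      rintro (⟨K, α⟩ | ⟨e, β⟩)
      · refine Fintype.linearIndependent_iff.1 (P K).linearIndependent
          (fun α => c (Sum.inl ⟨K, α⟩)) (Subtype.ext ?_) α
        rw [Submodule.coe_sum]
        exact h1 K
      · refine Fintype.linearIndependent_iff.1 (q e).linearIndependent
          (fun β => c (Sum.inr ⟨e, β⟩)) (Subtype.ext ?_) β
        rw [Submodule.coe_sum]
        have h3 := h2 e
        rw [map_sum] at h3
        simp_rw [map_smul, hQ', hQ] at h3
        exact h3
    rw [hfc]
    simp [hc]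

instance (d : ℤ) : FiniteDimensional ℝ (vecPolyLE n d) := by
  let L : vecPolyLE n d →ₗ[ℝ] (Fin n → polyLE n d) :=
    LinearMap.pi fun i => (LinearMap.proj i ∘ₗ (vecPolyLE n d).subtype).codRestrict _
      fun P => P.2 i trivial
  exact FiniteDimensional.of_injective L fun P P' h => Subtype.ext (funext fun i =>
    congrArg Subtype.val (congrFun h i))

instance (e : Finset (E n)) (d : ℤ) : FiniteDimensional ℝ (facetPoly e d) :=
  inferInstanceAs (FiniteDimensional ℝ ((polyLE n d).map (restrictTo e)))

/-- Every `A_u` is the operator of a Raviart-Thomas field. -/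
lemma exists_RT_derivation_eq [NeZero n] (hp : 2 < p) {u : T.L2Vec} (hu : u ∈ T.H0divLp p) :
    ∃ v ∈ T.RT (2 * r), o.derivation r v = o.derivation r u := by
  let P := fun _ : T.Cell => Module.finBasis ℝ (vecPolyLE n (2 * (r : ℤ) - 1))
  let q := fun e : T.IntFacet => Module.finBasis ℝ (facetPoly e.1 (2 * (r : ℤ)))
  have hex : ∀ e β, ∃ Q, restrictTo e.1 Q = q e β := fun e β => by
    obtain ⟨Q, -, h⟩ := (q e β).2
    exact ⟨Q, h⟩
  choose Q hQ using hex
  -- The Raviart-Thomas interpolant of `u`: all degrees of freedom of `v - u` vanish, so its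
  -- operator does too.
  obtain ⟨v, hv⟩ := (o.dofL_bijective P q hQ hp).2 (o.dofL hp (fun K α => P K α) Q ⟨u, hu⟩)
  have hv' := T.RT_le_H0divLp (2 * r) p v.2
  obtain ⟨h1, h2⟩ := o.dof_eq_zero_of_dofL_eq_zero P q hQ hp
    (u := ⟨v, hv'⟩ - ⟨u, hu⟩) (by rw [map_sub]; exact sub_eq_zero.2 hv)
  have h3 := o.derivation_eq_zero hp (⟨v, hv'⟩ - ⟨u, hu⟩ : T.H0divLp p).2 h1 h2
  refine ⟨v, v.2, sub_eq_zero.1 ?_⟩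
  have h4 := (o.derivationL hp r).map_sub ⟨v, hv'⟩ ⟨u, hu⟩
  exact h4.symm.trans h3

/-- `u ↦ A_u` as an isomorphism from the Raviart-Thomas space. -/
lemma exists_linearEquiv [NeZero n] (hp : 2 < p) :
    ∃ Φ : T.RT (2 * r) ≃ₗ[ℝ] LinearMap.range (o.derivationL hp r),
      ∀ u : T.RT (2 * r), (Φ u : Module.End ℝ (T.V r)) = o.derivation r u := by
  let L : T.RT (2 * r) →ₗ[ℝ] LinearMap.range (o.derivationL hp r) :=
    (o.derivationL hp r).rangeRestrict ∘ₗ Submodule.inclusion (T.RT_le_H0divLp (2 * r) p)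
  have hL : ∀ u, (L u : Module.End ℝ (T.V r)) = o.derivation r u := fun u => rfl
  refine ⟨LinearEquiv.ofBijective L ⟨?_, ?_⟩, hL⟩
  · refine (injective_iff_map_eq_zero L).2 fun u hu => ?_
    refine Subtype.ext (o.RT_eq_zero_of_derivation_eq_zero hp u.2 ?_)
    rw [← hL, hu]; rfl
  · rintro ⟨_, u, rfl⟩
    obtain ⟨v, hv, h⟩ := o.exists_RT_derivation_eq (r := r) hp u.2
    exact ⟨⟨v, hv⟩, Subtype.ext h⟩

end Orientation

end Triangulation

end DiscreteFlow

end

/-! ### Assembly of the proposition. -/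

theorem proposition3p4 (n : ℕ) (hn : 1 ≤ n) (T : DiscreteFlow.Triangulation n)
    (o : T.Orientation) (r : ℕ) (p : ℝ≥0∞) (hp : 2 < p) :
    T.RT (2 * r) ≤ T.H0divLp p ∧
    (∀ u ∈ T.H0divLp p, o.IsDerivation u (o.derivation r u)) ∧
    ∃ S : Submodule ℝ (Module.End ℝ (T.V r)),
      (S : Set (Module.End ℝ (T.V r))) = o.S r p ∧ S ≤ T.𝔤 r ∧
      ∃ Φ : T.RT (2 * r) ≃ₗ[ℝ] S,
        (∀ u : T.RT (2 * r), (Φ u : Module.End ℝ (T.V r)) = o.derivation r u) ∧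
        -- bases of `P_{2r-1}(K)^n` for all elements and of `P_{2r}(e)` for all interior facets
        ∀ (ι : T.Cell → Type) (_ : ∀ K, Fintype (ι K))
          (P : ∀ K, Module.Basis (ι K) ℝ (DiscreteFlow.vecPolyLE n (2 * (r : ℤ) - 1)))
          (κ : T.IntFacet → Type) (_ : ∀ e, Fintype (κ e))
          (q : ∀ e : T.IntFacet, Module.Basis (κ e) ℝ (DiscreteFlow.facetPoly e.1 (2 * (r : ℤ))))
          -- polynomials on `ℝⁿ` that restrict to the basis functions of `P_{2r}(e)`
          (Q : ∀ e, κ e → MvPolynomial (Fin n) ℝ)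
          (_ : ∀ e β, DiscreteFlow.restrictTo e.1 (Q e β) = q e β),
          -- the associated functionals are a basis of the dual space of `RT_{2r}`
          ∃ b : Module.Basis ((Σ K, ι K) ⊕ (Σ e, κ e)) ℝ (Module.Dual ℝ (T.RT (2 * r))),
            (∀ K α (u : T.RT (2 * r)), b (Sum.inl ⟨K, α⟩) u =
              T.cellDof u K (P K α)) ∧
            (∀ e β (u : T.RT (2 * r)), b (Sum.inr ⟨e, β⟩) u = o.flux u e (Q e β)) ∧
          -- the dual basis of `RT_{2r}`
          ∃ φ : Module.Basis ((Σ K, ι K) ⊕ (Σ e, κ e)) ℝ (T.RT (2 * r)),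
            (∀ i, b i (φ i) = 1) ∧ (∀ i j, i ≠ j → b i (φ j) = 0) ∧
          -- existence of the pairs `(f_j, g_j)`
          (∀ K α, ∃ (N : ℕ) (f g : Fin N → T.V r), o.ImageIsCell f g K (P K α)) ∧
          (∀ e β, ∃ (N : ℕ) (f g : Fin N → T.V r), o.ImageIsFacet f g e (q e β)) ∧
          -- the formula for the inverse
          ∀ (N : ∀ K, ι K → ℕ) (f g : ∀ K (α : ι K), Fin (N K α) → T.V r)
            (N' : ∀ e, κ e → ℕ) (f' g' : ∀ e (β : κ e), Fin (N' e β) → T.V r),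
            (∀ K α, o.ImageIsCell (f K α) (g K α) K (P K α)) →
            (∀ e β, o.ImageIsFacet (f' e β) (g' e β) e (q e β)) →
            ∀ A : S, Φ.symm A =
              (∑ K, ∑ α, (∑ j, ⟪(A : Module.End ℝ (T.V r)) (f K α j), g K α j⟫) •
                φ (Sum.inl ⟨K, α⟩)) +
              ∑ e, ∑ β, (∑ j, ⟪(A : Module.End ℝ (T.V r)) (f' e β j), g' e β j⟫) •
                φ (Sum.inr ⟨e, β⟩) := by
  classical
  have : NeZero n := ⟨by omega⟩
  obtain ⟨Φ, hΦ⟩ := o.exists_linearEquiv (r := r) hp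
  refine ⟨T.RT_le_H0divLp _ p, fun u hu => o.isDerivation_derivation hp hu,
    LinearMap.range (o.derivationL hp r), ?_, ?_, Φ, hΦ, ?_⟩
  · ext A
    constructor
    · rintro ⟨u, rfl⟩
      exact ⟨u, u.2, rfl⟩
    · rintro ⟨u, hu, rfl⟩
      exact ⟨⟨u, hu⟩, rfl⟩
  · rintro _ ⟨u, rfl⟩
    exact o.derivation_mem_𝔤 hp u.2
  intro ι _ P κ _ q Q hQ
  have hRT := T.RT_le_H0divLp (2 * r) p
  -- The basis whose coordinate functions are the degrees of freedom, so that its dual basis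
  -- consists of exactly these functionals.
  let φ := Module.Basis.ofEquivFun (LinearEquiv.ofBijective _ (o.dofL_bijective P q hQ hp))
  have hcell : ∀ K α (u : T.RT (2 * r)), φ.dualBasis (Sum.inl ⟨K, α⟩) u =
      T.cellDof u K (P K α) := fun K α u => by
    rw [Module.Basis.coe_dualBasis, Module.Basis.coord_apply]; rfl
  have hflux : ∀ e β (u : T.RT (2 * r)), φ.dualBasis (Sum.inr ⟨e, β⟩) u =
      o.flux u e (Q e β) := fun e β u => by
    rw [Module.Basis.coe_dualBasis, Module.Basis.coord_apply]; rfl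
  refine ⟨φ.dualBasis, hcell, hflux, φ, fun i => ?_, fun i j hij => ?_,
    fun K α => o.exists_imageIsCell K (P K α).2, fun e β => o.exists_imageIsFacet e (q e β).2,
    fun N f g N' f' g' hfg hfg' A => ?_⟩
  · rw [φ.dualBasis_apply_self, if_pos rfl]
  · rw [φ.dualBasis_apply_self, if_neg hij.symm]
  -- With `A = A_u`, the coefficients in the formula are the degrees of freedom of `u`, that is, its
  -- coordinates in the basis `φ`.
  · obtain ⟨u, rfl⟩ := Φ.surjective A
    have h1 : ∀ K α, ∑ j, ⟪(Φ u : Module.End ℝ (T.V r)) (f K α j), g K α j⟫ =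
        φ.repr u (Sum.inl ⟨K, α⟩) := fun K α => by
      rw [hΦ, o.sum_inner_of_imageIsCell hp (hRT u.2) (hfg K α), ← hcell, Module.Basis.coe_dualBasis,
        Module.Basis.coord_apply]
    have h2 : ∀ e β, ∑ j, ⟪(Φ u : Module.End ℝ (T.V r)) (f' e β j), g' e β j⟫ =
        φ.repr u (Sum.inr ⟨e, β⟩) := fun e β => by
      rw [hΦ, o.sum_inner_of_imageIsFacet hp (hRT u.2) (Q := Q e β) ((hQ e β).symm ▸ hfg' e β),
        ← hflux, Module.Basis.coe_dualBasis, Module.Basis.coord_apply]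
    simp_rw [h1, h2]
    rw [LinearEquiv.symm_apply_apply]
    conv_lhs => rw [← φ.sum_repr u]
    rw [Fintype.sum_sum_type, Fintype.sum_sigma, Fintype.sum_sigma]
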